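/- **Theorem (Global well-posedness).** Consider the one-dimensional Schrödinger equation with a nonlinearity concentrated at the origin, $$i\dot\psi(x,t)=-\psi''(x,t)-\delta(x)F(\psi(0,t)),\qquad x\in\mathbb R,\ t\in\mathbb R,\qquad(*)$$ where $\psi$ is complex-valued, dots and primes denote the partial derivatives in $t$ and $x$, and all derivatives are understood in the sense of distributions on $\mathbb R\times\mathbb R$. Let $F=-\nabla U$, where $U\in C^2(\mathbb C,\mathbb R)$ and $\nabla$ is the real gradient with respect to $(\operatorname{Re}\psi,\operatorname{Im}\psi)$. Assume that $U(\psi)=u(|\psi|^2)$ for all $\psi\in\mathbb C$ with some real function $u$, and that there are $A\in\mathbb R$ and $B>0$ with $U(z)\ge A-B|z|^2$ for all $z\in\mathbb C$. Let $H^1=H^1(\mathbb R)$, with $\|\psi\|_{H^1}^2=\|\psi\|_{L^2}^2+\|\psi'\|_{L^2}^2$, and for $\psi\in H^1$ put $$Q(\psi)=\frac12\int_{\mathbb R}|\psi(x)|^2\,dx,\qquad \mathscr H(\psi)=\int_{\mathbb R}\frac{|\psi'(x)|^2}{2}\,dx+U(\psi(0)),$$ point values of elements of $H^1$ being those of the continuous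 representative. Then: 1. For every $\phi\in H^1$, equation $(*)$ with the initial data $\psi|_{t=0}=\phi$ has a unique solution $\psi\in C(\mathbb R,H^1)$. 2. The charge and the energy are conserved: $Q(\psi(t))=Q(\phi)$ and $\mathscr H(\psi(t))=\mathscr H(\phi)$ for all $t\in\mathbb R$. 3. There is $\Lambda(\phi)>0$ such that $\sup_{t\in\mathbb R}\|\psi(t)\|_{H^1}\le\Lambda(\phi)<\infty$. 4. For every $T>0$, the map $\psi(0)\mapsto\psi$ is continuous from $H^1$ to $L^\infty([0,T],H^1)$. -/

import Mathlib

open MeasureTheory Set Filter Topology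
open scoped ENNReal ContDiff Gradient SchwartzMap

/-! ### The Sobolev space `H¹(ℝ)` -/

/-- The space `H¹(ℝ) = H¹(ℝ; ℂ)`, realized as the space of pairs `(f, f')` in `L² × L²` such that
`f'` is the derivative of `f` in the sense of distributions. The norm inherited from the Hilbert
space `L² × L²` is `‖f‖²_{H¹} = ‖f‖²_{L²} + ‖f'‖²_{L²}`. -/
def sobolevH1Submodule : Submodule ℂ
    (WithLp 2 (Lp ℂ 2 (volume : Measure ℝ) × Lp ℂ 2 (volume : Measure ℝ))) where
  carrier := {p | TemperedDistribution.derivCLM ℂ (Lp.toTemperedDistributionCLM ℂ volume 2 p.fst) =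
    Lp.toTemperedDistributionCLM ℂ volume 2 p.snd}
  add_mem' {p q} hp hq := by
    simp only [mem_ofPred_eq] at hp hq
    simp only [mem_ofPred_eq, WithLp.add_fst, WithLp.add_snd, map_add, hp, hq]
  zero_mem' := by
    simp only [mem_ofPred_eq, WithLp.zero_fst, WithLp.zero_snd, map_zero]
  smul_mem' c p hp := by
    simp only [mem_ofPred_eq] at hp
    simp only [mem_ofPred_eq, WithLp.smul_fst, WithLp.smul_snd, map_smul, hp]

/-- The Hilbert space `H¹(ℝ)`. -/
abbrev SobolevH1 : Type := sobolevH1Submodule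

namespace SobolevH1

/-- The function `f ∈ L²(ℝ)` underlying an element of `H¹(ℝ)`. -/
noncomputable def toL2 (f : SobolevH1) : Lp ℂ 2 (volume : Measure ℝ) := f.1.fst

/-- The distributional derivative `f' ∈ L²(ℝ)` of an element of `H¹(ℝ)`. -/
noncomputable def derivL2 (f : SobolevH1) : Lp ℂ 2 (volume : Measure ℝ) := f.1.snd

/-- A locally integrable function with locally integrable distributional derivative agrees almost
everywhere with a continuous function. -/
theorem exists_continuous_ae_eq_real {a b : ℝ → ℝ} (ha : LocallyIntegrable a)
    (hb : LocallyIntegrable b)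
    (h : ∀ φ : ℝ → ℝ, ContDiff ℝ ∞ φ → HasCompactSupport φ →
      ∫ x, deriv φ x * a x = -∫ x, φ x * b x) :
    ∃ g : ℝ → ℝ, Continuous g ∧ a =ᵐ[volume] g := by
  have hbi : ∀ x y, IntervalIntegrable b volume x y := fun x y =>
    (hb.integrableOn_isCompact isCompact_uIcc).intervalIntegrable
  set G : ℝ → ℝ := fun x => ∫ t in (0 : ℝ)..x, b t with hG
  have hGc : Continuous G := intervalIntegral.continuous_primitive hbi 0
  have hGd : ∀ᵐ x, deriv G x = b x := by
    filter_upwards [LocallyIntegrable.ae_hasDerivAt_integral hb] with x hx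
    exact (hx 0).deriv
  have haG : LocallyIntegrable (fun x => a x - G x) := ha.sub hGc.locallyIntegrable
  -- smooth compactly supported functions are integrable against locally integrable ones
  have hint : ∀ (η w : ℝ → ℝ), ContDiff ℝ ∞ η → HasCompactSupport η → LocallyIntegrable w →
      Integrable (fun x => η x * w x) := fun η w h1 h2 hw =>
    hw.integrable_smul_left_of_hasCompactSupport h1.continuous h2
  -- functions of zero mean annihilate `a - G`
  have key : ∀ η : ℝ → ℝ, ContDiff ℝ ∞ η → HasCompactSupport η → ∫ x, η x = 0 →
      ∫ x, η x * (a x - G x) = 0 := by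
    intro η hη hηs hη0
    obtain ⟨R, hR0, hR⟩ := hηs.isCompact.isBounded.subset_ball_lt 0 (0 : ℝ)
    rw [Real.ball_eq_Ioo, zero_sub, zero_add] at hR
    have hηout : ∀ x, x ∉ Ioo (-R) R → η x = 0 := fun x hx =>
      image_eq_zero_of_notMem_tsupport fun h' => hx (hR h')
    have hηi : ∀ x y, IntervalIntegrable η volume x y := fun x y =>
      hη.continuous.intervalIntegrable x y
    set φ : ℝ → ℝ := fun x => ∫ t in (-R)..x, η t with hφ
    have hφd : ∀ x, HasDerivAt φ (η x) x := fun x =>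
      intervalIntegral.integral_hasDerivAt_right (hηi _ _)
        (hη.continuous.stronglyMeasurableAtFilter _ _) hη.continuous.continuousAt
    have hφd' : deriv φ = η := funext fun x => (hφd x).deriv
    have hφs : ContDiff ℝ ∞ φ := by
      rw [contDiff_infty_iff_deriv, hφd']
      exact ⟨fun x => (hφd x).differentiableAt, hη⟩
    -- a function vanishing outside `(-R, R)` can be integrated over `(-R, R)`
    have hloc : ∀ w : ℝ → ℝ, (∀ x, x ∉ Ioo (-R) R → w x = 0) →
        ∫ x in (-R)..R, w x = ∫ x, w x := fun w hw =>
      intervalIntegral.integral_eq_integral_of_support_subset fun x hx =>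
        Ioo_subset_Ioc_self (by_contra fun h' => hx (hw x h'))
    have hφR : φ R = 0 := by rw [hφ, ← hη0]; exact hloc η hηout
    have hφL : φ (-R) = 0 := intervalIntegral.integral_same
    have hφout : ∀ x, x ∉ Ioo (-R) R → φ x = 0 := by
      intro x hx
      rcases le_or_gt x (-R) with hxl | hxl
      · refine intervalIntegral.integral_zero_ae (ae_of_all _ fun t ht => hηout t fun ht' => ?_)
        rw [uIoc_of_ge hxl] at ht
        exact absurd ht.2 (not_le.2 ht'.1)
      · have hxr : R ≤ x := not_lt.1 fun h' => hx ⟨hxl, h'⟩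
        have h1 : φ R + ∫ t in R..x, η t = φ x :=
          intervalIntegral.integral_add_adjacent_intervals (hηi _ _) (hηi _ _)
        rw [← h1, hφR, zero_add]
        refine intervalIntegral.integral_zero_ae (ae_of_all _ fun t ht => hηout t fun ht' => ?_)
        rw [uIoc_of_le hxr] at ht
        exact absurd ht.1 (not_lt.2 ht'.2.le)
    have hφc : HasCompactSupport φ := HasCompactSupport.intro isCompact_Icc fun x hx =>
      hφout x fun h' => hx (Ioo_subset_Icc_self h')
    have hGac : AbsolutelyContinuousOnInterval G (-R) R :=
      (hbi _ _).absolutelyContinuousOnInterval_intervalIntegral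
        (by rw [uIcc_of_le (by linarith)]; exact ⟨by linarith, hR0.le⟩)
    have hφac : AbsolutelyContinuousOnInterval φ (-R) R :=
      (hφs.of_le (by exact_mod_cast le_top)).contDiffOn.absolutelyContinuousOnInterval
    have hparts := hφac.integral_mul_deriv_eq_deriv_mul hGac
    rw [hφR, hφL, zero_mul, zero_mul, sub_zero, zero_sub, hφd',
      hloc _ fun x hx => by rw [hφout x hx, zero_mul],
      hloc _ fun x hx => by rw [hηout x hx, zero_mul]] at hparts
    have h2 : ∫ x, φ x * deriv G x = ∫ x, φ x * b x :=
      integral_congr_ae (hGd.mono fun x hx => by simp only [hx])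
    have h3 := h φ hφs hφc
    rw [hφd', ← h2, hparts, neg_neg] at h3
    simp only [mul_sub]
    rw [integral_sub (hint η a hη hηs ha) (hint η G hη hηs hGc.locallyIntegrable), h3, sub_self]
  obtain ⟨ρ⟩ : Nonempty (ContDiffBump (0 : ℝ)) := inferInstance
  set r : ℝ → ℝ := ρ.normed volume with hr
  have hrs : ContDiff ℝ ∞ r := ρ.contDiff_normed
  have hrc : HasCompactSupport r := ρ.hasCompactSupport_normed
  have hr1 : ∫ x, r x = 1 := ρ.integral_normed
  set C : ℝ := ∫ x, r x * (a x - G x) with hC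
  refine ⟨fun x => G x + C, hGc.add continuous_const, ?_⟩
  have hmain : ∀ᵐ x, a x - G x - C = 0 := by
    refine ae_eq_zero_of_integral_contDiff_smul_eq_zero (haG.sub (locallyIntegrable_const C)) ?_
    intro ψ hψ hψc
    have hψi : Integrable ψ := hψ.continuous.integrable_of_hasCompactSupport hψc
    have hri : Integrable r := hrs.continuous.integrable_of_hasCompactSupport hrc
    have h4 := key (fun x => ψ x - (∫ y, ψ y) * r x) (hψ.sub (contDiff_const.mul hrs))
      (hψc.sub hrc.mul_left)
      (by rw [integral_sub hψi (hri.const_mul _), integral_const_mul, hr1, mul_one, sub_self])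
    simp only [sub_mul, mul_assoc] at h4
    rw [integral_sub (hint ψ _ hψ hψc haG) ((hint r _ hrs hrc haG).const_mul _),
      integral_const_mul] at h4
    simp only [smul_eq_mul, mul_sub _ (_ - _)]
    rw [integral_sub (hint ψ _ hψ hψc haG) (hψi.mul_const _), integral_mul_const]
    exact h4
  filter_upwards [hmain] with x hx
  linarith

/-- Every element of `H¹(ℝ)` has a continuous representative. -/
theorem exists_continuous_ae_eq (f : SobolevH1) :
    ∃ g : ℝ → ℂ, Continuous g ∧ f.toL2 =ᵐ[volume] g := by
  have hL : ∀ w : Lp ℂ 2 (volume : Measure ℝ), LocallyIntegrable w := fun w =>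
    (Lp.memLp w).locallyIntegrable (by norm_num)
  have hdist : ∀ φ : ℝ → ℝ, ContDiff ℝ ∞ φ → HasCompactSupport φ →
      ∫ x, deriv φ x • f.toL2 x = -∫ x, φ x • f.derivL2 x := by
    intro φ hφ hφc
    have hφ' : ContDiff ℝ ∞ (fun x => (φ x : ℂ)) := Complex.ofRealCLM.contDiff.comp hφ
    have hφc' : HasCompactSupport (fun x => (φ x : ℂ)) := hφc.comp_left Complex.ofReal_zero
    have h := congrArg (fun T => T (hφc'.toSchwartzMap hφ')) f.2
    simp only [TemperedDistribution.derivCLM_apply_apply, Lp.toTemperedDistributionCLM_apply,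
      Lp.toTemperedDistribution_apply, map_neg] at h
    have e1 : ∀ x, SchwartzMap.derivCLM ℂ ℂ (hφc'.toSchwartzMap hφ') x = ((deriv φ x : ℝ) : ℂ) :=
      fun x => by
        rw [SchwartzMap.derivCLM_apply]
        exact ((hφ.differentiable (by simp) x).hasDerivAt.ofReal_comp).deriv
    have e2 : ∀ x, hφc'.toSchwartzMap hφ' x = (φ x : ℂ) := fun x => rfl
    simp only [e1, e2, smul_eq_mul] at h
    simp only [Complex.real_smul]
    rw [neg_eq_iff_eq_neg] at h
    exact h
  have hloc : ∀ (w : Lp ℂ 2 (volume : Measure ℝ)) (φ : ℝ → ℝ), Continuous φ →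
      HasCompactSupport φ → Integrable (fun x => φ x • w x) := fun w φ h1 h2 =>
    (hL w).integrable_smul_left_of_hasCompactSupport h1 h2
  have hpart : ∀ L : ℂ →L[ℝ] ℝ, ∃ g : ℝ → ℝ, Continuous g ∧
      (fun x => L (f.toL2 x)) =ᵐ[volume] g := by
    intro L
    have hLL : ∀ w : Lp ℂ 2 (volume : Measure ℝ), LocallyIntegrable fun x => L (w x) :=
      fun w x => by
        obtain ⟨s, hs, hw⟩ := hL w x
        exact ⟨s, hs, L.integrable_comp hw⟩
    refine exists_continuous_ae_eq_real (hLL _) (hLL f.derivL2) fun φ hφ hφc => ?_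
    have h := congrArg L (hdist φ hφ hφc)
    rw [map_neg, ← L.integral_comp_comm (hloc _ _ (hφ.continuous_deriv (by simp)) hφc.deriv),
      ← L.integral_comp_comm (hloc _ _ hφ.continuous hφc)] at h
    simpa only [map_smul, smul_eq_mul] using h
  obtain ⟨g₁, h₁, e₁⟩ := hpart Complex.reCLM
  obtain ⟨g₂, h₂, e₂⟩ := hpart Complex.imCLM
  refine ⟨fun x => (g₁ x : ℂ) + g₂ x * Complex.I, by fun_prop, ?_⟩
  filter_upwards [e₁, e₂] with x hx₁ hx₂
  rw [← hx₁, ← hx₂]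
  exact (Complex.re_add_im _).symm

/-- The continuous representative `x ↦ f(x)` of an element of `H¹(ℝ)`; point values of elements
of `H¹(ℝ)` are always those of this representative. -/
noncomputable def rep (f : SobolevH1) : ℝ → ℂ := f.exists_continuous_ae_eq.choose

theorem continuous_rep (f : SobolevH1) : Continuous f.rep :=
  f.exists_continuous_ae_eq.choose_spec.1

theorem toL2_ae_eq_rep (f : SobolevH1) : f.toL2 =ᵐ[volume] f.rep :=
  f.exists_continuous_ae_eq.choose_spec.2

/-- The charge `Q(ψ) = ½ ∫ |ψ|² dx`. -/
noncomputable def charge (f : SobolevH1) : ℝ := (1 / 2) * ∫ x, ‖f.toL2 x‖ ^ 2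

/-- The energy `ℋ(ψ) = ∫ |ψ'|² / 2 dx + U(ψ(0))`. -/
noncomputable def energy (U : ℂ → ℝ) (f : SobolevH1) : ℝ :=
  (∫ x, ‖f.derivL2 x‖ ^ 2 / 2) + U (f.rep 0)

end SobolevH1

/-! ### The equation -/

/-- `ψ ∈ C(ℝ, H¹(ℝ))` solves `i ∂ₜψ = -∂ₓ²ψ - δ(x) F(ψ(0,t))` in the sense of distributions on
`ℝ × ℝ`: for every test function `Φ ∈ C_c^∞(ℝ × ℝ; ℂ)`, `Φ = Φ(x, t)`,
`-i ∬ ψ ∂ₜΦ dx dt = -∬ ψ ∂ₓ²Φ dx dt - ∫ F(ψ(0,t)) Φ(0,t) dt`. -/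
def IsConcentratedNLSSolution (F : ℂ → ℂ) (ψ : C(ℝ, SobolevH1)) : Prop :=
  ∀ Φ : ℝ × ℝ → ℂ, ContDiff ℝ ∞ Φ → HasCompactSupport Φ →
    -Complex.I * (∫ t : ℝ, ∫ x : ℝ, (ψ t).rep x * deriv (fun s => Φ (x, s)) t) =
      -(∫ t : ℝ, ∫ x : ℝ, (ψ t).rep x * iteratedDeriv 2 (fun y => Φ (y, t)) x) -
        ∫ t : ℝ, F ((ψ t).rep 0) * Φ (0, t)

/-! ### An Abel–Gronwall inequality -/

/-! The flow is built from finite-frequency truncations, for which the problem is a Lipschitz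
differential equation. Set `x(ξ) = (1 + 4π²ξ²)^{1/2} f̂(ξ)`. This maps `H¹` isometrically onto `L²`;
the Laplacian and its truncations become multipliers, and evaluation at the origin becomes pairing
with the `L²` function `(1 + 4π²ξ²)^{-1/2}`. `TruncatedModel` records what is needed of this
picture, `fourierModel` is the concrete instance, and `isConcentratedNLSSolution_iff` identifies
distributional solutions with curves solving every truncated equation.

The key point is that the nonlinearity sees only the trace `z(t) = ψ(0,t)`. Duhamel's formula
evaluated at the origin is a Volterra equation for `z` whose kernel, the truncated free propagator
at the origin, is `O(|t|^{-1/2})` uniformly in the truncation (`kernel_bound`). Gronwall's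
inequality for this integrable singularity makes traces of solutions depend Lipschitz-continuously
on the data, up to a tail that vanishes as the truncation is removed (`exists_norm_tr_sub_le`).
Uniqueness, convergence of the truncated solutions and continuity in the data all rest on this
estimate.

For globally Lipschitz `F` the truncated equations have global solutions. They conserve charge
because `U` is radial, and energy because the truncation keeps the Hamiltonian structure. The trace
is controlled by a large multiple of the `L²` norm plus a small multiple of the `H¹` norm, so the
quadratic lower bound on `U` turns conservation into a uniform `H¹` bound
(`norm_sq_le_of_energy_le`). The truncated solutions converge weakly; the limit solves the equation,
and lower semicontinuity gives charge and energy at most their initial values. By uniqueness the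
limits form a flow, and running it backwards from time `t` gives the reverse inequalities.
Conservation then makes the `H¹` norm a continuous function of the data and the trace, so weak
continuity becomes strong, both in time and in the initial data.

For general `F` the potential is cut off radially far out. The a priori bound does not depend on the
cutoff, so the trace never reaches the modified region. -/

theorem exists_pos_mul_integral_rpow_mul_exp_le {C : ℝ} (hC : 0 ≤ C) :
    ∃ l : ℝ, 0 < l ∧ ∀ t : ℝ, 0 ≤ t →
      C * ∫ r in (0 : ℝ)..t, r ^ (-1 / 2 : ℝ) * Real.exp (-(l * r)) ≤ 1 / 2 := by
  have hG : 0 < Real.Gamma (1 / 2) := Real.Gamma_pos_of_pos (by norm_num)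
  -- With `l = δ⁻²` the integral over the half-line is `Γ(1/2) l^{-1/2} = Γ(1/2) δ`. The `+ 1` keeps
  -- `δ` finite when `C = 0`.
  set δ : ℝ := 1 / (2 * (C * Real.Gamma (1 / 2) + 1)) with hδ
  have hCG : 0 ≤ C * Real.Gamma (1 / 2) := by positivity
  have hδ0 : 0 < δ := by positivity
  refine ⟨1 / δ ^ 2, by positivity, fun t ht => ?_⟩
  have hl : 0 < 1 / δ ^ 2 := by positivity
  have h1 := Real.integral_rpow_mul_exp_neg_mul_Ioi (a := 1 / 2) (by norm_num) hl
  have e : (1 / 2 - 1 : ℝ) = -1 / 2 := by norm_num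
  rw [e] at h1
  have hint : IntegrableOn (fun r : ℝ => r ^ (-1 / 2 : ℝ) * Real.exp (-(1 / δ ^ 2 * r)))
      (Ioi 0) := by
    have := integrableOn_rpow_mul_exp_neg_mul_rpow (p := 1) (s := -1 / 2) (b := 1 / δ ^ 2)
      (by norm_num) (by norm_num) hl
    simpa only [Real.rpow_one, neg_mul] using this
  have h2 : ∫ r in (0 : ℝ)..t, r ^ (-1 / 2 : ℝ) * Real.exp (-(1 / δ ^ 2 * r)) ≤
      ∫ r in Ioi (0 : ℝ), r ^ (-1 / 2 : ℝ) * Real.exp (-(1 / δ ^ 2 * r)) := by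
    rw [intervalIntegral.integral_of_le ht]
    refine setIntegral_mono_set hint ?_ (Ioc_subset_Ioi_self.eventuallyLE)
    filter_upwards [ae_restrict_mem measurableSet_Ioi] with x hx
    have : (0 : ℝ) < x := hx
    positivity
  have h3 : (1 / (1 / δ ^ 2)) ^ (1 / 2 : ℝ) = δ := by
    rw [one_div_one_div, ← Real.sqrt_eq_rpow, Real.sqrt_sq hδ0.le]
  rw [h1, h3] at h2
  calc _ ≤ C * (δ * Real.Gamma (1 / 2)) := by gcongr
    _ = (C * Real.Gamma (1 / 2)) / (2 * (C * Real.Gamma (1 / 2) + 1)) := by rw [hδ]; ring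
    _ ≤ 1 / 2 := by
      rw [div_le_div_iff₀ (by positivity) (by norm_num)]
      nlinarith

theorem intervalIntegrable_mul_abs_rpow {d : ℝ → ℝ} (hd : Continuous d) (t a b : ℝ) :
    IntervalIntegrable (fun s => d s * |t - s| ^ (-1 / 2 : ℝ)) volume a b := by
  have h0 : ∀ a b : ℝ, IntervalIntegrable (fun x : ℝ => |x| ^ (-1 / 2 : ℝ)) volume a b := by
    have hp : ∀ c : ℝ, 0 ≤ c →
        IntervalIntegrable (fun x : ℝ => |x| ^ (-1 / 2 : ℝ)) volume 0 c := fun c hc =>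
      (intervalIntegral.intervalIntegrable_rpow' (r := -1 / 2) (by norm_num)).congr fun x hx => by
        rw [uIoc_of_le hc] at hx
        simp only [abs_of_pos hx.1]
    have hz : ∀ c : ℝ, IntervalIntegrable (fun x : ℝ => |x| ^ (-1 / 2 : ℝ)) volume 0 c := by
      intro c
      rcases le_total 0 c with hc | hc
      · exact hp c hc
      · have := (hp (-c) (by linarith)).comp_sub_left 0
        simpa using this
    exact fun a b => (hz a).symm.trans (hz b)
  have h1 : IntervalIntegrable (fun s : ℝ => |t - s| ^ (-1 / 2 : ℝ)) volume a b := by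
    simpa using (h0 (t - a) (t - b)).comp_sub_left t
  exact h1.continuousOn_mul hd.continuousOn

/-- The weight `e^{-lt}` makes the Volterra operator a contraction with factor `1/2`, so the
integral term is absorbed at the maximum point of the weighted function. The constant depends only
on `C` and `T`, hence serves all truncations at once. -/
theorem abel_gronwall_of_nonneg {C T : ℝ} (hC : 0 ≤ C) (hT : 0 ≤ T) :
    ∃ M : ℝ, 0 ≤ M ∧ ∀ (d : ℝ → ℝ) (ε : ℝ), Continuous d → (∀ t, 0 ≤ d t) → 0 ≤ ε →
      (∀ t ∈ Icc 0 T, d t ≤ ε + C * ∫ s in (0 : ℝ)..t, d s * |t - s| ^ (-1 / 2 : ℝ)) →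
      ∀ t ∈ Icc 0 T, d t ≤ M * ε := by
  obtain ⟨l, hl, hlC⟩ := exists_pos_mul_integral_rpow_mul_exp_le hC
  refine ⟨2 * Real.exp (l * T), by positivity, fun d ε hd hd0 hε h => ?_⟩
  obtain ⟨t₀, ht₀, hmax⟩ := isCompact_Icc.exists_isMaxOn (nonempty_Icc.2 hT)
    (f := fun t => Real.exp (-(l * t)) * d t) (by fun_prop)
  set m := Real.exp (-(l * t₀)) * d t₀ with hm
  have hm0 : 0 ≤ m := by have := hd0 t₀; positivity
  have hdm : ∀ s ∈ Icc 0 T, d s ≤ m * Real.exp (l * s) := by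
    intro s hs
    have h1 : Real.exp (-(l * s)) * d s ≤ m := hmax hs
    rw [Real.exp_neg, inv_mul_eq_div, div_le_iff₀ (Real.exp_pos _)] at h1
    exact h1
  have hint : ∫ s in (0 : ℝ)..t₀, d s * |t₀ - s| ^ (-1 / 2 : ℝ) ≤
      ∫ s in (0 : ℝ)..t₀, (m * Real.exp (l * s)) * |t₀ - s| ^ (-1 / 2 : ℝ) := by
    refine intervalIntegral.integral_mono_on ht₀.1 (intervalIntegrable_mul_abs_rpow hd _ _ _)
      (intervalIntegrable_mul_abs_rpow (by fun_prop) _ _ _) fun s hs => ?_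
    have := hdm s ⟨hs.1, hs.2.trans ht₀.2⟩
    gcongr
  have hsub : ∫ s in (0 : ℝ)..t₀, (m * Real.exp (l * s)) * |t₀ - s| ^ (-1 / 2 : ℝ) =
      m * Real.exp (l * t₀) * ∫ r in (0 : ℝ)..t₀, r ^ (-1 / 2 : ℝ) * Real.exp (-(l * r)) := by
    have := intervalIntegral.integral_comp_sub_left (a := 0) (b := t₀)
      (fun r : ℝ => m * Real.exp (l * (t₀ - r)) * |r| ^ (-1 / 2 : ℝ)) t₀
    simp only [sub_sub_cancel, sub_self, sub_zero] at this
    rw [this, ← intervalIntegral.integral_const_mul]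
    refine intervalIntegral.integral_congr fun r hr => ?_
    rw [uIcc_of_le ht₀.1] at hr
    simp only [abs_of_nonneg hr.1]
    rw [mul_sub, sub_eq_add_neg, Real.exp_add]
    ring
  have hk := hlC t₀ ht₀.1
  have h2 := h t₀ ht₀
  have h3 : m ≤ 2 * ε := by
    have h4 : d t₀ ≤ ε + m * Real.exp (l * t₀) * (1 / 2) := by
      calc d t₀ ≤ _ := h2
        _ ≤ ε + C * (m * Real.exp (l * t₀) *
            ∫ r in (0 : ℝ)..t₀, r ^ (-1 / 2 : ℝ) * Real.exp (-(l * r))) := by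
          rw [← hsub]; gcongr
        _ = ε + m * Real.exp (l * t₀) *
            (C * ∫ r in (0 : ℝ)..t₀, r ^ (-1 / 2 : ℝ) * Real.exp (-(l * r))) := by ring
        _ ≤ _ := by gcongr
    have h5 : m * Real.exp (l * t₀) = d t₀ := by
      rw [hm, mul_right_comm, ← Real.exp_add]; simp
    have h6 : d t₀ ≤ 2 * ε := by rw [h5] at h4; linarith
    have h7 : Real.exp (-(l * t₀)) ≤ 1 :=
      Real.exp_le_one_iff.2 (by have := mul_nonneg hl.le ht₀.1; linarith)
    calc m ≤ 1 * d t₀ := by rw [hm]; have := hd0 t₀; gcongr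
      _ ≤ 2 * ε := by linarith
  intro t ht
  calc d t ≤ m * Real.exp (l * t) := hdm t ht
    _ ≤ (2 * ε) * Real.exp (l * T) := by have := ht.2; gcongr
    _ = _ := by ring

/-- Gronwall's inequality for the Abel kernel `|t - s|^{-1/2}`. -/
theorem abel_gronwall {C T : ℝ} (hC : 0 ≤ C) (hT : 0 ≤ T) :
    ∃ M : ℝ, 0 ≤ M ∧ ∀ (d : ℝ → ℝ) (ε : ℝ), Continuous d → (∀ t, 0 ≤ d t) → 0 ≤ ε →
      (∀ t, |t| ≤ T → d t ≤ ε + C * |∫ s in (0 : ℝ)..t, d s * |t - s| ^ (-1 / 2 : ℝ)|) →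
      ∀ t, |t| ≤ T → d t ≤ M * ε := by
  obtain ⟨M, hM, h⟩ := abel_gronwall_of_nonneg hC hT
  refine ⟨M, hM, fun d ε hd hd0 hε hdt t ht => ?_⟩
  rcases le_total 0 t with h0 | h0
  · refine h d ε hd hd0 hε (fun s hs => ?_) t ⟨h0, (abs_le.1 ht).2⟩
    have := hdt s (by rw [abs_of_nonneg hs.1]; exact hs.2)
    rwa [abs_of_nonneg (intervalIntegral.integral_nonneg hs.1 fun r _ =>
      mul_nonneg (hd0 r) (by positivity))] at this
  · have := h (fun s => d (-s)) ε (by fun_prop) (fun s => hd0 _) hε (fun s hs => ?_) (-t)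
      ⟨by linarith, by have := (abs_le.1 ht).1; linarith⟩
    · simpa using this
    · have h1 := hdt (-s) (by rw [abs_neg, abs_of_nonneg hs.1]; exact hs.2)
      have h2 : ∫ r in (0 : ℝ)..(-s), d r * |(-s) - r| ^ (-1 / 2 : ℝ) =
          -∫ r in (0 : ℝ)..s, d (-r) * |s - r| ^ (-1 / 2 : ℝ) := by
        rw [intervalIntegral.integral_symm]
        have := intervalIntegral.integral_comp_neg (a := 0) (b := s)
          (fun r => d r * |(-s) - r| ^ (-1 / 2 : ℝ))
        rw [neg_zero] at this
        rw [← this]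
        congr 1
        refine intervalIntegral.integral_congr fun r _ => ?_
        have : -s - -r = -(s - r) := by ring
        simp only [this, abs_neg]
      rwa [h2, abs_neg, abs_of_nonneg (intervalIntegral.integral_nonneg hs.1 fun r _ =>
        mul_nonneg (hd0 _) (by positivity))] at h1

/-! ### Global solutions of Lipschitz differential equations -/

/-- Picard iteration contracts on the whole line at once in the norm `sup e^{-l|t|} ‖u(t)‖`, so no
local solutions have to be glued. -/
theorem exists_global_solution_of_lipschitz {E : Type*} [NormedAddCommGroup E] [NormedSpace ℝ E]
    [CompleteSpace E] {v : E → E} {K : NNReal} (hv : LipschitzWith K v) (x₀ : E) :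
    ∃ u : ℝ → E, u 0 = x₀ ∧ ∀ t, HasDerivAt u (v (u t)) t := by
  -- This gives the contraction factor `K / l ≤ 1/2`, and `l > 0` also for `K = 0`.
  set l : ℝ := 2 * K + 1 with hl
  have hl0 : 0 < l := by positivity
  have hvc : Continuous v := hv.continuous
  have hexp : ∀ t : ℝ, |∫ s in (0 : ℝ)..t, Real.exp (l * |s|)| ≤ Real.exp (l * |t|) / l := by
    have hp : ∀ t : ℝ, 0 ≤ t → ∫ s in (0 : ℝ)..t, Real.exp (l * |s|) ≤ Real.exp (l * t) / l := by
      intro t ht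
      have h1 : ∫ s in (0 : ℝ)..t, Real.exp (l * |s|) = ∫ s in (0 : ℝ)..t, Real.exp (l * s) :=
        intervalIntegral.integral_congr fun s hs => by
          rw [uIcc_of_le ht] at hs
          simp only [abs_of_nonneg hs.1]
      have h2 : ∫ s in (0 : ℝ)..t, Real.exp (l * s) =
          Real.exp (l * t) / l - Real.exp (l * 0) / l := by
        refine intervalIntegral.integral_eq_sub_of_hasDerivAt
          (f := fun s => Real.exp (l * s) / l) (fun x _ => ?_)
          ((by fun_prop : Continuous fun s => Real.exp (l * s)).intervalIntegrable _ _)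
        have := (((hasDerivAt_id x).const_mul l).exp).div_const l
        simpa [hl0.ne'] using this
      rw [h1, h2]
      have : 0 ≤ Real.exp (l * 0) / l := by positivity
      linarith
    have hpos : ∀ t : ℝ, 0 ≤ t → |∫ s in (0 : ℝ)..t, Real.exp (l * |s|)| ≤
        Real.exp (l * t) / l := fun t ht => by
      rw [abs_of_nonneg (intervalIntegral.integral_nonneg ht fun s _ => (Real.exp_pos _).le)]
      exact hp t ht
    intro t
    rcases le_total 0 t with ht | ht
    · rw [abs_of_nonneg ht]; exact hpos t ht
    · have h1 := intervalIntegral.integral_comp_neg (a := 0) (b := -t)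
        (fun s => Real.exp (l * |s|))
      simp only [abs_neg, neg_neg, neg_zero] at h1
      rw [intervalIntegral.integral_symm, ← h1, abs_neg, abs_of_nonpos ht]
      exact hpos (-t) (by linarith)
  have hbound : ∀ (C : ℝ) (f : ℝ → E) (t : ℝ), 0 ≤ C → (∀ s, ‖f s‖ ≤ C * Real.exp (l * |s|)) →
      ‖Real.exp (-(l * |t|)) • ∫ s in (0 : ℝ)..t, f s‖ ≤ C / l := by
    intro C f t hC hf
    have h1 : ‖∫ s in (0 : ℝ)..t, f s‖ ≤ |∫ s in (0 : ℝ)..t, C * Real.exp (l * |s|)| :=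
      intervalIntegral.norm_integral_le_abs_of_norm_le (ae_of_all _ fun s => hf s)
        (Continuous.intervalIntegrable (by fun_prop) _ _)
    rw [intervalIntegral.integral_const_mul, abs_mul, abs_of_nonneg hC] at h1
    rw [norm_smul, Real.norm_of_nonneg (Real.exp_pos _).le]
    calc _ ≤ Real.exp (-(l * |t|)) * (C * (Real.exp (l * |t|) / l)) := by
          gcongr
          exact h1.trans (by gcongr; exact hexp t)
      _ = (Real.exp (-(l * |t|)) * Real.exp (l * |t|)) * (C / l) := by ring
      _ = C / l := by rw [← Real.exp_add]; simp
  have hvn : ∀ x, ‖v x‖ ≤ ‖v 0‖ + K * ‖x‖ := fun x => by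
    have := hv.norm_sub_le x 0
    rw [sub_zero] at this
    calc ‖v x‖ = ‖v 0 + (v x - v 0)‖ := by rw [add_sub_cancel]
      _ ≤ _ := (norm_add_le _ _).trans (by gcongr)
  have hint : ∀ (y : BoundedContinuousFunction ℝ E) (a b : ℝ),
      IntervalIntegrable (fun s => v (Real.exp (l * |s|) • y s)) volume a b := fun y a b =>
    Continuous.intervalIntegrable (by fun_prop) _ _
  have hcont : ∀ y : BoundedContinuousFunction ℝ E,
      Continuous fun t => ∫ s in (0 : ℝ)..t, v (Real.exp (l * |s|) • y s) := fun y =>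
    intervalIntegral.continuous_primitive (hint y) 0
  have hexp1 : ∀ t : ℝ, 1 ≤ Real.exp (l * |t|) := fun t => Real.one_le_exp (by positivity)
  -- The unknown is the rescaled curve `y(t) = e^{-l|t|} u(t)`, which is bounded although `u` may
  -- grow exponentially.
  let Γ : BoundedContinuousFunction ℝ E → BoundedContinuousFunction ℝ E := fun y =>
    BoundedContinuousFunction.ofNormedAddCommGroup
      (fun t => Real.exp (-(l * |t|)) • (x₀ + ∫ s in (0 : ℝ)..t, v (Real.exp (l * |s|) • y s)))
      (by have := hcont y; fun_prop) (‖x₀‖ + (‖v 0‖ + K * ‖y‖) / l) (fun t => by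
        rw [smul_add]
        refine (norm_add_le _ _).trans (add_le_add ?_ (hbound _ _ t (by positivity) fun s => ?_))
        · rw [norm_smul, Real.norm_of_nonneg (Real.exp_pos _).le]
          exact mul_le_of_le_one_left (norm_nonneg _)
            (Real.exp_le_one_iff.2 (by have := mul_nonneg hl0.le (abs_nonneg t); linarith))
        · refine (hvn _).trans ?_
          rw [norm_smul, Real.norm_of_nonneg (Real.exp_pos _).le, add_mul (‖v 0‖)]
          refine add_le_add (le_mul_of_one_le_right (norm_nonneg _) (hexp1 s)) ?_
          rw [mul_assoc, mul_comm ‖y‖]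
          gcongr
          exact y.norm_coe_le_norm s)
  have hΓ : ContractingWith (1 / 2) Γ := by
    refine ⟨by rw [← NNReal.coe_lt_coe]; norm_num, LipschitzWith.of_dist_le_mul fun y y' => ?_⟩
    rw [BoundedContinuousFunction.dist_le (by positivity)]
    intro t
    have e : Γ y t - Γ y' t = Real.exp (-(l * |t|)) • ∫ s in (0 : ℝ)..t,
        (v (Real.exp (l * |s|) • y s) - v (Real.exp (l * |s|) • y' s)) := by
      rw [intervalIntegral.integral_sub (hint y _ _) (hint y' _ _)]
      change Real.exp (-(l * |t|)) • (x₀ + _) - Real.exp (-(l * |t|)) • (x₀ + _) = _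
      rw [← smul_sub, add_sub_add_left_eq_sub]
    rw [dist_eq_norm, e]
    refine (hbound (K * dist y y') _ t (by positivity) fun s => ?_).trans ?_
    · refine (hv.norm_sub_le _ _).trans ?_
      rw [← smul_sub, norm_smul, Real.norm_of_nonneg (Real.exp_pos _).le, mul_assoc,
        mul_comm (dist y y')]
      gcongr
      rw [← dist_eq_norm]
      exact BoundedContinuousFunction.dist_coe_le_dist s
    · rw [div_le_iff₀ hl0, hl]
      have : 0 ≤ dist y y' := dist_nonneg
      push_cast
      nlinarith
  obtain ⟨y, hy⟩ : ∃ y, Γ y = y := ⟨_, hΓ.fixedPoint_isFixedPt⟩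
  have hu : ∀ t, Real.exp (l * |t|) • y t =
      x₀ + ∫ s in (0 : ℝ)..t, v (Real.exp (l * |s|) • y s) := by
    intro t
    conv_lhs => rw [← hy]
    change Real.exp (l * |t|) • (Real.exp (-(l * |t|)) • (x₀ + _)) = _
    rw [smul_smul, ← Real.exp_add, add_neg_cancel, Real.exp_zero, one_smul]
  refine ⟨fun t => Real.exp (l * |t|) • y t, (hu 0).trans (by simp), fun t => ?_⟩
  have hc : Continuous fun s => v (Real.exp (l * |s|) • y s) := by fun_prop
  have h1 := (intervalIntegral.integral_hasDerivAt_right (hint y 0 t)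
    (hc.stronglyMeasurableAtFilter _ _) hc.continuousAt).const_add x₀
  exact h1.congr_of_eventuallyEq (Eventually.of_forall hu)

/-! ### An abstract model of the equation

The Hilbert space `X` is a model of `H¹`, `⟪x, a x⟫` is the square of the `L²` norm, `g` represents
the point evaluation at the origin, `P R` are the spectral projections of the Laplacian, `H R` are
its truncations and `W R` the unitary groups that they generate. -/

structure TruncatedModel (X : Type*) [NormedAddCommGroup X] [InnerProductSpace ℂ X] where
  P : ℕ → X →L[ℂ] X
  H : ℕ → X →L[ℂ] X
  W : ℕ → ℝ → X →L[ℂ] X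
  a : X →L[ℂ] X
  g : X
  inner_P : ∀ R x y, inner ℂ (P R x) y = inner ℂ x (P R y)
  P_P : ∀ {R S : ℕ}, R ≤ S → ∀ x, P R (P S x) = P R x
  P_P' : ∀ {R S : ℕ}, R ≤ S → ∀ x, P S (P R x) = P R x
  norm_P_le : ∀ R x, ‖P R x‖ ≤ ‖x‖
  tendsto_P : ∀ x, Tendsto (fun R => P R x) atTop (𝓝 x)
  H_P : ∀ {R S : ℕ}, R ≤ S → ∀ x, H R (P S x) = H R x
  P_H : ∀ {R S : ℕ}, R ≤ S → ∀ x, P R (H S x) = H R x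
  inner_a : ∀ x y, inner ℂ (a x) y = inner ℂ x (a y)
  norm_a_sq_le : ∀ x, ‖a x‖ ^ 2 ≤ (inner ℂ x (a x)).re
  inner_a_le : ∀ x, (inner ℂ x (a x)).re ≤ ‖x‖ ^ 2
  P_a : ∀ R x, P R (a x) = a (P R x)
  a_H : ∀ R x, a (H R x) = P R x - a (P R x)
  W_zero : ∀ R, W R 0 = 1
  norm_W_le : ∀ R t x, ‖W R t x‖ ≤ ‖x‖
  hasDerivAt_W : ∀ R t, HasDerivAt (W R) (-Complex.I • (W R t ∘L H R)) t
  kernel_le : ∃ C : ℝ, 0 ≤ C ∧ ∀ (R : ℕ) (t : ℝ), t ≠ 0 →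
    ‖inner ℂ g (W R t (P R g + H R g))‖ ≤ C * |t| ^ (-1 / 2 : ℝ)

/-! ### Strong convergence and differentiation in complex Hilbert spaces. -/

section Hilbert

variable {X : Type*} [NormedAddCommGroup X] [InnerProductSpace ℂ X]

theorem Complex.re_inner_comm (x y : X) : (inner ℂ x y).re = (inner ℂ y x).re :=
  inner_re_symm (𝕜 := ℂ) x y

theorem Complex.re_inner_self (x : X) : (inner ℂ x x).re = ‖x‖ ^ 2 :=
  inner_self_eq_norm_sq (𝕜 := ℂ) x

theorem Complex.norm_sub_sq (x y : X) :
    ‖x - y‖ ^ 2 = ‖x‖ ^ 2 - 2 * (inner ℂ y x).re + ‖y‖ ^ 2 := by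
  rw [Complex.re_inner_comm]; exact _root_.norm_sub_sq (𝕜 := ℂ) x y

/-- Expanding `‖x i - y‖²` shows that only the pairing with the limit `y` itself is needed. -/
theorem tendsto_of_tendsto_inner_of_tendsto_norm {ι : Type*} {l : Filter ι} {x : ι → X} {y : X}
    (hw : Tendsto (fun i => inner ℂ y (x i)) l (𝓝 (inner ℂ y y)))
    (hn : Tendsto (fun i => ‖x i‖ ^ 2) l (𝓝 (‖y‖ ^ 2))) : Tendsto x l (𝓝 y) := by
  rw [tendsto_iff_norm_sub_tendsto_zero]
  have h1 : Tendsto (fun i => ‖x i - y‖ ^ 2) l (𝓝 0) := by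
    have e : ∀ i, ‖x i - y‖ ^ 2 = ‖x i‖ ^ 2 - 2 * (inner ℂ y (x i)).re + ‖y‖ ^ 2 :=
      fun i => Complex.norm_sub_sq _ _
    simp only [e]
    have h2 := (hn.sub (((Complex.continuous_re.tendsto _).comp hw).const_mul 2)).add_const (‖y‖ ^ 2)
    have e2 : ‖y‖ ^ 2 - 2 * (inner ℂ y y).re + ‖y‖ ^ 2 = 0 := by
      rw [Complex.re_inner_self]; ring
    rwa [e2] at h2
  have h3 := h1.sqrt
  simpa [Real.sqrt_sq] using h3

theorem HasDerivAt.complexCLM {Y : Type*} [NormedAddCommGroup Y] [NormedSpace ℂ Y]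
    {Z : Type*} [NormedAddCommGroup Z] [NormedSpace ℂ Z] (A : Y →L[ℂ] Z)
    {u : ℝ → Y} {u' : Y} {t : ℝ} (hu : HasDerivAt u u' t) :
    HasDerivAt (fun t => A (u t)) (A u') t :=
  (A.restrictScalars ℝ).hasFDerivAt.comp_hasDerivAt t hu

end Hilbert

/-! ### The quadratic forms of the model, weak limits and the a priori bound. -/

namespace TruncatedModel

variable {X : Type*} [NormedAddCommGroup X] [InnerProductSpace ℂ X] (M : TruncatedModel X)

/-- The truncated point mass. -/
def e (R : ℕ) : X := M.P R M.g + M.H R M.g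

/-- The point value at the origin. -/
noncomputable def tr (x : X) : ℂ := inner ℂ M.g x

/-- The square of the `L²` norm. -/
noncomputable def q (x : X) : ℝ := (inner ℂ x (M.a x)).re

/-- The square of the `L²` norm of the derivative. -/
noncomputable def k (x : X) : ℝ := ‖x‖ ^ 2 - M.q x

theorem continuous_tr : Continuous M.tr := by unfold tr; fun_prop

theorem continuous_q : Continuous M.q := by unfold q; fun_prop

theorem q_nonneg (x : X) : 0 ≤ M.q x := (sq_nonneg _).trans (M.norm_a_sq_le x)

theorem k_nonneg (x : X) : 0 ≤ M.k x := sub_nonneg.2 (M.inner_a_le x)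

theorem tr_sub (x y : X) : M.tr (x - y) = M.tr x - M.tr y := inner_sub_right _ _ _

theorem norm_tr_le (x : X) : ‖M.tr x‖ ≤ ‖M.g‖ * ‖x‖ := norm_inner_le_norm _ _

theorem a_e (R : ℕ) : M.a (M.e R) = M.P R M.g := by
  rw [e, map_add, M.a_H]; abel

theorem P_e {R S : ℕ} (h : R ≤ S) : M.P R (M.e S) = M.e R := by
  rw [e, e, map_add, M.P_P h, M.P_H h]

theorem ext_of_P {x y : X} (h : ∀ R, M.P R x = M.P R y) : x = y :=
  tendsto_nhds_unique (M.tendsto_P x) (by simpa only [h] using M.tendsto_P y)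

theorem q_sub (x y : X) : M.q (x - y) = M.q x - 2 * (inner ℂ (M.a y) x).re + M.q y := by
  have h1 : (inner ℂ x (M.a y)).re = (inner ℂ (M.a y) x).re :=
    Complex.re_inner_comm _ _
  have h2 : (inner ℂ y (M.a x)).re = (inner ℂ (M.a y) x).re := by rw [M.inner_a]
  simp only [q, map_sub, inner_sub_left, inner_sub_right, Complex.sub_re, h1, h2]
  ring

theorem k_sub (x y : X) : M.k (x - y) = M.k x - 2 * (inner ℂ (y - M.a y) x).re + M.k y := by
  rw [k, k, k, M.q_sub, Complex.norm_sub_sq, inner_sub_left, Complex.sub_re]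
  ring

/-- Weak convergence of a bounded family follows from convergence of the truncations. -/
theorem tendsto_inner_of_tendsto_P {ι : Type*} {l : Filter ι} {x : ι → X} {y : X} {C : ℝ}
    (hC : ∀ᶠ i in l, ‖x i‖ ≤ C)
    (h : ∀ R, Tendsto (fun i => M.P R (x i)) l (𝓝 (M.P R y))) (v : X) :
    Tendsto (fun i => inner ℂ v (x i)) l (𝓝 (inner ℂ v y)) := by
  rw [tendsto_iff_norm_sub_tendsto_zero, Metric.tendsto_nhds]
  intro ε hε
  have h1 : Tendsto (fun R => ‖v - M.P R v‖ * (|C| + ‖y‖)) atTop (𝓝 0) := by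
    have := ((tendsto_iff_norm_sub_tendsto_zero.1 (M.tendsto_P v))).mul_const (|C| + ‖y‖)
    simpa only [norm_sub_rev, zero_mul] using this
  obtain ⟨R, hR⟩ := (h1.eventually_lt_const (half_pos hε)).exists
  have h2 : Tendsto (fun i => ‖v‖ * ‖M.P R (x i) - M.P R y‖) l (𝓝 0) := by
    have := (tendsto_iff_norm_sub_tendsto_zero.1 (h R)).const_mul ‖v‖
    simpa only [mul_zero] using this
  filter_upwards [hC, h2.eventually_lt_const (half_pos hε)] with i hi hi2
  -- The tail of `v` is paired with a bounded vector. For the rest, self-adjointness moves the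
  -- projection onto `x i - y`, where convergence is known.
  have e1 : inner ℂ v (x i) - inner ℂ v y =
      inner ℂ (v - M.P R v) (x i - y) + inner ℂ v (M.P R (x i) - M.P R y) := by
    rw [inner_sub_left, M.inner_P, map_sub, sub_add_cancel, inner_sub_right]
  rw [Real.dist_0_eq_abs, abs_norm, e1]
  calc _ ≤ ‖v - M.P R v‖ * ‖x i - y‖ + ‖v‖ * ‖M.P R (x i) - M.P R y‖ :=
        (norm_add_le _ _).trans (add_le_add (norm_inner_le_norm _ _) (norm_inner_le_norm _ _))
    _ ≤ ‖v - M.P R v‖ * (|C| + ‖y‖) + ‖v‖ * ‖M.P R (x i) - M.P R y‖ := by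
        gcongr
        exact (norm_sub_le _ _).trans (by gcongr; exact hi.trans (le_abs_self C))
    _ < ε := by linarith

/-- Every `v` is close to some `P R v`, so boundedness and Cauchy truncations make all scalar
products Cauchy. Their limit is a bounded functional, and the Riesz theorem represents it by `y`. -/
theorem exists_weak_limit [CompleteSpace X] {x : ℕ → X} {C : ℝ} (hC : ∀ n, ‖x n‖ ≤ C)
    (h : ∀ R, CauchySeq fun n => M.P R (x n)) :
    ∃ y, ‖y‖ ≤ C ∧ ∀ R, Tendsto (fun n => M.P R (x n)) atTop (𝓝 (M.P R y)) := by
  have hC0 : 0 ≤ C := (norm_nonneg _).trans (hC 0)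
  choose p hp using fun R => cauchySeq_tendsto_of_complete (h R)
  have hcs : ∀ v, CauchySeq fun n => inner ℂ (x n) v := by
    intro v
    rw [Metric.cauchySeq_iff']
    intro ε hε
    have h1 : Tendsto (fun R => ‖v - M.P R v‖ * (C + C)) atTop (𝓝 0) := by
      have := ((tendsto_iff_norm_sub_tendsto_zero.1 (M.tendsto_P v))).mul_const (C + C)
      simpa only [norm_sub_rev, zero_mul] using this
    obtain ⟨R, hR⟩ := (h1.eventually_lt_const (half_pos hε)).exists
    obtain ⟨N, hN⟩ := Metric.cauchySeq_iff'.1 (h R) (ε / 2 / (‖v‖ + 1)) (by positivity)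
    refine ⟨N, fun n hn => ?_⟩
    have hn' := hN n hn
    rw [dist_eq_norm, lt_div_iff₀ (by positivity)] at hn'
    have e1 : inner ℂ (x n) v - inner ℂ (x N) v =
        inner ℂ (x n - x N) (v - M.P R v) + inner ℂ (M.P R (x n) - M.P R (x N)) v := by
      rw [inner_sub_right, ← map_sub, M.inner_P, sub_add_cancel, inner_sub_left]
    rw [dist_eq_norm, e1]
    calc _ ≤ ‖x n - x N‖ * ‖v - M.P R v‖ + ‖M.P R (x n) - M.P R (x N)‖ * ‖v‖ :=
          (norm_add_le _ _).trans (add_le_add (norm_inner_le_norm _ _) (norm_inner_le_norm _ _))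
      _ ≤ (C + C) * ‖v - M.P R v‖ + ‖M.P R (x n) - M.P R (x N)‖ * (‖v‖ + 1) := by
          gcongr
          · exact (norm_sub_le _ _).trans (add_le_add (hC _) (hC _))
          · linarith
      _ < ε := by linarith
  choose f hf using fun v => cauchySeq_tendsto_of_complete (hcs v)
  let F : X →L[ℂ] ℂ := continuousLinearMapOfTendsto (l := atTop) (fun n => innerSL ℂ (x n))
    (f := f) (tendsto_pi_nhds.2 hf)
  set y := (InnerProductSpace.toDual ℂ X).symm F with hy
  have hyf : ∀ v, inner ℂ y v = f v := fun v => by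
    rw [hy, InnerProductSpace.toDual_symm_apply]; rfl
  have hweak : ∀ v, Tendsto (fun n => inner ℂ (x n) v) atTop (𝓝 (inner ℂ y v)) := fun v => by
    rw [hyf]; exact hf v
  have hpy : ∀ R, p R = M.P R y := by
    intro R
    refine ext_inner_right ℂ fun v => ?_
    refine tendsto_nhds_unique (f := fun n => inner ℂ (M.P R (x n)) v) (l := atTop) ?_ ?_
    · exact (hp R).inner tendsto_const_nhds
    · simp only [M.inner_P]; exact hweak _
  refine ⟨y, ?_, fun R => hpy R ▸ hp R⟩
  refine le_of_tendsto (M.tendsto_P y).norm (Eventually.of_forall fun R => ?_)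
  rw [← hpy]
  exact le_of_tendsto (hp R).norm (Eventually.of_forall fun n => (M.norm_P_le _ _).trans (hC n))

/-- A nonnegative quadratic form is weakly lower semicontinuous: expand it at `x i - y` and pass to
the limit in the cross term. The same argument applies to `k`. -/
theorem q_le_of_tendsto {ι : Type*} {l : Filter ι} [l.NeBot] {x : ι → X} {y : X} {m : ℝ}
    (hw : ∀ v, Tendsto (fun i => inner ℂ v (x i)) l (𝓝 (inner ℂ v y)))
    (hm : Tendsto (fun i => M.q (x i)) l (𝓝 m)) : M.q y ≤ m := by
  have h1 : Tendsto (fun i => M.q (x i - y)) l (𝓝 (m - 2 * M.q y + M.q y)) := by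
    simp only [M.q_sub]
    have := (Complex.continuous_re.tendsto _).comp (hw (M.a y))
    rw [M.inner_a] at this
    exact (hm.sub (this.const_mul 2)).add_const _
  have := ge_of_tendsto' h1 fun i => M.q_nonneg _
  linarith

theorem k_le_of_tendsto {ι : Type*} {l : Filter ι} [l.NeBot] {x : ι → X} {y : X} {m : ℝ}
    (hw : ∀ v, Tendsto (fun i => inner ℂ v (x i)) l (𝓝 (inner ℂ v y)))
    (hm : Tendsto (fun i => M.k (x i)) l (𝓝 m)) : M.k y ≤ m := by
  have hk : (inner ℂ (y - M.a y) y).re = M.k y := by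
    rw [inner_sub_left, Complex.sub_re, M.inner_a, k, q]
    rw [Complex.re_inner_self]
  have h1 : Tendsto (fun i => M.k (x i - y)) l (𝓝 (m - 2 * M.k y + M.k y)) := by
    simp only [M.k_sub]
    have := (Complex.continuous_re.tendsto _).comp (hw (y - M.a y))
    rw [hk] at this
    exact (hm.sub (this.const_mul 2)).add_const _
  have := ge_of_tendsto' h1 fun i => M.k_nonneg _
  linarith

/-- This is the coercivity of the energy at fixed charge. Split `g` into `P R g = a (e R)`, whose
pairing with `x` costs only `√(q x)`, and a tail whose contribution is absorbed once `R` is large.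
`D` is chosen before `A` and `U`, so the same bound serves the cut-off potentials. -/
theorem norm_sq_le_of_energy_le {B : ℝ} (hB : 0 ≤ B) : ∃ D : ℝ, 0 ≤ D ∧
    ∀ (A : ℝ) (U : ℂ → ℝ), (∀ z, A - B * ‖z‖ ^ 2 ≤ U z) → ∀ (x : X) (q₀ E₀ : ℝ), M.q x ≤ q₀ →
      M.k x / 2 + U (M.tr x) ≤ E₀ → ‖x‖ ^ 2 ≤ 2 * q₀ + 4 * (E₀ - A + D * q₀) := by
  have h1 : Tendsto (fun R => B * (2 * ‖M.g - M.P R M.g‖ ^ 2)) atTop (𝓝 0) := by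
    have := (((tendsto_iff_norm_sub_tendsto_zero.1 (M.tendsto_P M.g)).pow 2).const_mul 2).const_mul B
    simpa [norm_sub_rev] using this
  -- The threshold `1/4` leaves half of `‖x‖²` on the left after doubling the energy inequality;
  -- this produces the factors `2` and `4` in the bound.
  obtain ⟨R, hR⟩ := (h1.eventually_lt_const (show (0 : ℝ) < 1 / 4 by norm_num)).exists
  refine ⟨B * (2 * ‖M.e R‖ ^ 2), by positivity, fun A U hU x q₀ E₀ hq hE => ?_⟩
  have hz : ‖M.tr x‖ ^ 2 ≤ 2 * ‖M.e R‖ ^ 2 * M.q x + 2 * ‖M.g - M.P R M.g‖ ^ 2 * ‖x‖ ^ 2 := by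
    have e1 : M.tr x = inner ℂ (M.e R) (M.a x) + inner ℂ (M.g - M.P R M.g) x := by
      rw [← M.inner_a, M.a_e, inner_sub_left, add_sub_cancel, tr]
    have h2 : ‖M.tr x‖ ≤ ‖M.e R‖ * ‖M.a x‖ + ‖M.g - M.P R M.g‖ * ‖x‖ := by
      rw [e1]
      exact (norm_add_le _ _).trans (add_le_add (norm_inner_le_norm _ _) (norm_inner_le_norm _ _))
    calc ‖M.tr x‖ ^ 2 ≤ (‖M.e R‖ * ‖M.a x‖ + ‖M.g - M.P R M.g‖ * ‖x‖) ^ 2 := by gcongr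
      _ ≤ 2 * ‖M.e R‖ ^ 2 * ‖M.a x‖ ^ 2 + 2 * ‖M.g - M.P R M.g‖ ^ 2 * ‖x‖ ^ 2 := by
        nlinarith [sq_nonneg (‖M.e R‖ * ‖M.a x‖ - ‖M.g - M.P R M.g‖ * ‖x‖)]
      _ ≤ _ := by gcongr; exact M.norm_a_sq_le x
  have hk : ‖x‖ ^ 2 = M.k x + M.q x := by rw [k]; ring
  have h3 := hU (M.tr x)
  have h4 : B * ‖M.tr x‖ ^ 2 ≤ B * (2 * ‖M.e R‖ ^ 2) * q₀ + 1 / 4 * ‖x‖ ^ 2 := by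
    calc B * ‖M.tr x‖ ^ 2 ≤ B * (2 * ‖M.e R‖ ^ 2 * M.q x + 2 * ‖M.g - M.P R M.g‖ ^ 2 * ‖x‖ ^ 2) := by
          gcongr
      _ = B * (2 * ‖M.e R‖ ^ 2) * M.q x + B * (2 * ‖M.g - M.P R M.g‖ ^ 2) * ‖x‖ ^ 2 := by ring
      _ ≤ _ := by gcongr
  linarith

end TruncatedModel

theorem HasDerivAt.complexCLM_apply {Y : Type*} [NormedAddCommGroup Y] [NormedSpace ℂ Y]
    {Z : Type*} [NormedAddCommGroup Z] [NormedSpace ℂ Z] {A : ℝ → Y →L[ℂ] Z} {A' : Y →L[ℂ] Z}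
    {u : ℝ → Y} {u' : Y} {t : ℝ} (hA : HasDerivAt A A' t) (hu : HasDerivAt u u' t) :
    HasDerivAt (fun t => A t (u t)) (A' (u t) + A t u') t := by
  have h1 := (ContinuousLinearMap.restrictScalarsL ℂ Y Z ℝ ℝ).hasFDerivAt.comp_hasDerivAt t hA
  exact h1.clm_apply hu

/-! ### Truncated equations: Duhamel's formula, stability of the trace, uniqueness. -/

namespace TruncatedModel

variable {X : Type*} [NormedAddCommGroup X] [InnerProductSpace ℂ X] (M : TruncatedModel X)

/-- The truncation of `w` to frequencies at most `R` solves the truncated equation with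
right-hand side `f`. -/
def SolvesLinear (R : ℕ) (f : ℝ → ℂ) (w : ℝ → X) : Prop :=
  ∀ t, HasDerivAt (fun t => M.P R (w t))
    (-(Complex.I • M.H R (w t)) + (Complex.I * f t) • M.e R) t

/-- The truncation of `w` to frequencies at most `R` solves the truncated equation. -/
def Solves (F : ℂ → ℂ) (R : ℕ) (w : ℝ → X) : Prop :=
  M.SolvesLinear R (fun t => F (M.tr (w t))) w

variable {M}

theorem SolvesLinear.sub {R : ℕ} {f₁ f₂ : ℝ → ℂ} {w₁ w₂ : ℝ → X} (h₁ : M.SolvesLinear R f₁ w₁)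
    (h₂ : M.SolvesLinear R f₂ w₂) :
    M.SolvesLinear R (fun t => f₁ t - f₂ t) (fun t => w₁ t - w₂ t) := by
  intro t
  have := (h₁ t).sub (h₂ t)
  refine (this.congr_deriv ?_).congr_of_eventuallyEq (Eventually.of_forall fun s => ?_)
  · simp only [map_sub]
    module
  · simp

theorem SolvesLinear.comp_add_const {R : ℕ} {f : ℝ → ℂ} {w : ℝ → X} (h : M.SolvesLinear R f w)
    (c : ℝ) : M.SolvesLinear R (fun t => f (c + t)) (fun t => w (c + t)) := fun t =>
  HasDerivAt.comp_const_add c t (h (c + t))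

/-- The truncations are nested, so solutions at different levels can be compared at a common lower
one. -/
theorem SolvesLinear.mono {R S : ℕ} (hRS : R ≤ S) {f : ℝ → ℂ} {w : ℝ → X}
    (h : M.SolvesLinear S f w) : M.SolvesLinear R f w := by
  intro t
  have h1 := (h t).complexCLM (M.P R)
  simp only [M.P_P hRS] at h1
  refine h1.congr_deriv ?_
  rw [map_add, map_neg, map_smul, map_smul, M.P_H hRS, M.P_e hRS]

theorem SolvesLinear.continuous_P {R : ℕ} {f : ℝ → ℂ} {w : ℝ → X} (h : M.SolvesLinear R f w) :
    Continuous fun t => M.P R (w t) :=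
  continuous_iff_continuousAt.2 fun t => (h t).continuousAt

theorem continuous_W (R : ℕ) : Continuous (M.W R) :=
  continuous_iff_continuousAt.2 fun t => (M.hasDerivAt_W R t).continuousAt

/-- Duhamel's formula. -/
theorem SolvesLinear.eq_integral [CompleteSpace X] {R : ℕ} {f : ℝ → ℂ} {w : ℝ → X}
    (h : M.SolvesLinear R f w) (hf : Continuous f) (t : ℝ) :
    M.P R (w t) = M.W R t (M.P R (w 0)) +
      ∫ s in (0 : ℝ)..t, (Complex.I * f s) • M.W R (t - s) (M.e R) := by
  -- Pulling the solution back along the free group cancels the terms in `H R` and leaves only the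
  -- source.
  have hd : ∀ s, HasDerivAt (fun s => M.W R (t - s) (M.P R (w s)))
      ((Complex.I * f s) • M.W R (t - s) (M.e R)) s := by
    intro s
    have h1 : HasDerivAt (fun s => M.W R (t - s)) (Complex.I • (M.W R (t - s) ∘L M.H R)) s := by
      have := HasDerivAt.comp_const_sub t s (M.hasDerivAt_W R (t - s))
      refine this.congr_deriv ?_
      rw [neg_smul, neg_neg]
    refine (h1.complexCLM_apply (h s)).congr_deriv ?_
    simp only [_root_.smul_apply, ContinuousLinearMap.comp_apply, map_add, map_neg,
      map_smul, M.H_P le_rfl]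
    abel
  have hc : Continuous fun s => (Complex.I * f s) • M.W R (t - s) (M.e R) := by
    have := M.continuous_W R
    fun_prop
  have h2 := intervalIntegral.integral_eq_sub_of_hasDerivAt (a := 0) (b := t) (fun s _ => hd s)
    (hc.intervalIntegrable _ _)
  rw [h2]
  simp [M.W_zero]

/-- Duhamel's formula and contractivity of the group suffice here. The bound degrades through `‖e
R‖`, so it is used at fixed `R` only, once the traces are controlled. -/
theorem SolvesLinear.norm_P_le [CompleteSpace X] {R : ℕ} {f : ℝ → ℂ} {w : ℝ → X}
    (h : M.SolvesLinear R f w) (hf : Continuous f) {T δ : ℝ} (hδ : 0 ≤ δ)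
    (hfδ : ∀ t, |t| ≤ T → ‖f t‖ ≤ δ) {t : ℝ} (ht : |t| ≤ T) :
    ‖M.P R (w t)‖ ≤ ‖M.P R (w 0)‖ + δ * ‖M.e R‖ * T := by
  rw [h.eq_integral hf t]
  refine (norm_add_le _ _).trans (add_le_add (M.norm_W_le _ _ _) ?_)
  have h1 : ∀ s ∈ uIoc 0 t, ‖(Complex.I * f s) • M.W R (t - s) (M.e R)‖ ≤ δ * ‖M.e R‖ := by
    intro s hs
    rw [norm_smul, norm_mul, Complex.norm_I, one_mul]
    refine mul_le_mul (hfδ s ?_) (M.norm_W_le _ _ _) (norm_nonneg _) hδ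
    have h2 := abs_sub_left_of_mem_uIcc (uIoc_subset_uIcc hs)
    simp only [sub_zero] at h2
    exact h2.trans ht
  refine (intervalIntegral.norm_integral_le_of_norm_le_const h1).trans ?_
  rw [sub_zero]
  gcongr

theorem norm_tr_sub_P_le (M : TruncatedModel X) (R : ℕ) (x : X) :
    ‖M.tr x - M.tr (M.P R x)‖ ≤ ‖M.g - M.P R M.g‖ * ‖x‖ := by
  have : M.tr x - M.tr (M.P R x) = inner ℂ (M.g - M.P R M.g) x := by
    rw [inner_sub_left, M.inner_P, tr, tr]
  rw [this]
  exact norm_inner_le_norm _ _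

/-- The trace at the origin depends in a Lipschitz way on the initial data, up to an error due to
the truncation. -/
theorem exists_norm_tr_sub_le [CompleteSpace X] (M : TruncatedModel X) (L : NNReal) {T : ℝ}
    (hT : 0 ≤ T) :
    ∃ K : ℝ, 0 ≤ K ∧ ∀ (F : ℂ → ℂ) (s : Set ℂ) (R : ℕ) (C : ℝ) (w₁ w₂ : ℝ → X), Continuous F →
      LipschitzOnWith L F s → 0 ≤ C →
      M.Solves F R w₁ → M.Solves F R w₂ →
      Continuous (fun t => M.tr (w₁ t)) → Continuous (fun t => M.tr (w₂ t)) →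
      (∀ t, |t| ≤ T → ‖w₁ t‖ ≤ C ∧ ‖w₂ t‖ ≤ C ∧ M.tr (w₁ t) ∈ s ∧ M.tr (w₂ t) ∈ s) →
      ∀ t, |t| ≤ T → ‖M.tr (w₁ t) - M.tr (w₂ t)‖ ≤
        K * (‖M.g‖ * ‖w₁ 0 - w₂ 0‖ + 2 * C * ‖M.g - M.P R M.g‖) := by
  obtain ⟨Ck, hCk, hk⟩ := M.kernel_le
  -- Gronwall is applied with the product of the Lipschitz and kernel constants. Hence `K` is fixed
  -- before `R`, `C` and the two solutions.
  obtain ⟨K, hK, hgr⟩ := abel_gronwall (C := L * Ck) (T := T) (by positivity) hT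
  refine ⟨K, hK, fun F s R C w₁ w₂ hF hL hC h₁ h₂ hc₁ hc₂ hb t ht => ?_⟩
  refine hgr (fun t => ‖M.tr (w₁ t) - M.tr (w₂ t)‖) _ (by fun_prop) (fun t => norm_nonneg _)
    (by positivity) (fun t ht => ?_) t ht
  have hfc : Continuous fun t => F (M.tr (w₁ t)) - F (M.tr (w₂ t)) := by fun_prop
  have hd := (SolvesLinear.sub h₁ h₂).eq_integral hfc t
  set k : ℝ → ℂ := fun r => inner ℂ M.g (M.W R r (M.e R)) with hkdef
  have hWc := M.continuous_W R
  have e1 : M.tr (M.P R (w₁ t - w₂ t)) = inner ℂ M.g (M.W R t (M.P R (w₁ 0 - w₂ 0))) +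
      ∫ s in (0 : ℝ)..t, (Complex.I * (F (M.tr (w₁ s)) - F (M.tr (w₂ s)))) * k (t - s) := by
    rw [hd, tr, inner_add_right]
    congr 1
    have := ContinuousLinearMap.intervalIntegral_comp_comm (𝕜 := ℂ) (a := 0) (b := t)
      (μ := volume) (innerSL ℂ M.g)
      (f := fun s => (Complex.I * (F (M.tr (w₁ s)) - F (M.tr (w₂ s)))) • M.W R (t - s) (M.e R))
      (Continuous.intervalIntegrable (by fun_prop) _ _)
    simp only [innerSL_apply_apply, inner_smul_right] at this
    rw [← this]
  have h3 : ‖∫ s in (0 : ℝ)..t, (Complex.I * (F (M.tr (w₁ s)) - F (M.tr (w₂ s)))) * k (t - s)‖ ≤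
      |∫ s in (0 : ℝ)..t, (L * Ck) *
        (‖M.tr (w₁ s) - M.tr (w₂ s)‖ * |t - s| ^ (-1 / 2 : ℝ))| := by
    refine intervalIntegral.norm_integral_le_abs_of_norm_le ?_
      ((intervalIntegrable_mul_abs_rpow (by fun_prop) _ _ _).const_mul _)
    -- The kernel estimate excludes time zero, so the null set `s = t` is discarded.
    have hne : ∀ᵐ s ∂(volume.restrict (uIoc 0 t)), s ≠ t :=
      ae_restrict_of_ae (Measure.ae_ne volume t)
    filter_upwards [hne, ae_restrict_mem measurableSet_uIoc] with s hs hs'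
    have hst : |s| ≤ T := by
      have h2 := abs_sub_left_of_mem_uIcc (uIoc_subset_uIcc hs')
      simp only [sub_zero] at h2
      exact h2.trans ht
    have h4 := hL.norm_sub_le (hb s hst).2.2.1 (hb s hst).2.2.2
    have h5 := hk R (t - s) (sub_ne_zero.2 hs.symm)
    rw [norm_mul, norm_mul, Complex.norm_I, one_mul]
    calc _ ≤ (L * ‖M.tr (w₁ s) - M.tr (w₂ s)‖) * (Ck * |t - s| ^ (-1 / 2 : ℝ)) := by
          refine mul_le_mul h4 h5 (norm_nonneg _) (by positivity)
      _ = _ := by ring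
  rw [intervalIntegral.integral_const_mul, abs_mul, abs_of_nonneg (by positivity : 0 ≤ L * Ck)] at h3
  -- Duhamel's formula controls only the truncated difference. The missing high frequencies
  -- contribute through the tail of `g`, which vanishes as `R` grows.
  have h6 : ‖M.tr (w₁ t) - M.tr (w₂ t) - M.tr (M.P R (w₁ t - w₂ t))‖ ≤
      ‖M.g - M.P R M.g‖ * (C + C) := by
    rw [← tr_sub]
    refine (M.norm_tr_sub_P_le R _).trans ?_
    gcongr
    exact (norm_sub_le _ _).trans (add_le_add (hb t ht).1 (hb t ht).2.1)
  have h7 : ‖inner ℂ M.g (M.W R t (M.P R (w₁ 0 - w₂ 0)))‖ ≤ ‖M.g‖ * ‖w₁ 0 - w₂ 0‖ :=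
    (norm_inner_le_norm _ _).trans (by
      gcongr
      exact (M.norm_W_le _ _ _).trans (M.norm_P_le _ _))
  calc ‖M.tr (w₁ t) - M.tr (w₂ t)‖
      = ‖(M.tr (w₁ t) - M.tr (w₂ t) - M.tr (M.P R (w₁ t - w₂ t))) +
          (inner ℂ M.g (M.W R t (M.P R (w₁ 0 - w₂ 0))) + ∫ s in (0 : ℝ)..t,
            (Complex.I * (F (M.tr (w₁ s)) - F (M.tr (w₂ s)))) * k (t - s))‖ := by
        rw [← e1, sub_add_cancel]
    _ ≤ ‖M.g - M.P R M.g‖ * (C + C) + (‖M.g‖ * ‖w₁ 0 - w₂ 0‖ + L * Ck *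
          |∫ s in (0 : ℝ)..t, ‖M.tr (w₁ s) - M.tr (w₂ s)‖ * |t - s| ^ (-1 / 2 : ℝ)|) :=
        (norm_add_le _ _).trans (add_le_add h6 ((norm_add_le _ _).trans (add_le_add h7 h3)))
    _ = _ := by ring

/-- Bounded solutions with the same initial data coincide. -/
theorem eq_of_solves [CompleteSpace X] {F : ℂ → ℂ} (hF : ContDiff ℝ 1 F) {w₁ w₂ : ℝ → X}
    (h₁ : ∀ R, M.Solves F R w₁) (h₂ : ∀ R, M.Solves F R w₂)
    (hc₁ : Continuous (fun t => M.tr (w₁ t))) (hc₂ : Continuous (fun t => M.tr (w₂ t)))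
    (hb : ∀ T, ∃ C, ∀ t, |t| ≤ T → ‖w₁ t‖ ≤ C ∧ ‖w₂ t‖ ≤ C) (h0 : w₁ 0 = w₂ 0) : w₁ = w₂ := by
  have htr : ∀ t, M.tr (w₁ t) = M.tr (w₂ t) := by
    intro t
    obtain ⟨C, hC⟩ := hb |t|
    have hC0 : 0 ≤ C := (norm_nonneg _).trans (hC t le_rfl).1
    obtain ⟨L, hL⟩ := (hF.contDiffOn (s := Metric.closedBall 0 (‖M.g‖ * C))).exists_lipschitzOnWith
      one_ne_zero (convex_closedBall _ _) (isCompact_closedBall _ _)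
    obtain ⟨K, hK, h⟩ := M.exists_norm_tr_sub_le L (abs_nonneg t)
    have hmem : ∀ x : X, ‖x‖ ≤ C → M.tr x ∈ Metric.closedBall (0 : ℂ) (‖M.g‖ * C) := fun x hx => by
      rw [mem_closedBall_zero_iff]
      exact (M.norm_tr_le x).trans (by gcongr)
    have h2 : ∀ R, ‖M.tr (w₁ t) - M.tr (w₂ t)‖ ≤
        K * (‖M.g‖ * 0 + 2 * C * ‖M.g - M.P R M.g‖) := fun R => by
      have := h F _ R C w₁ w₂ hF.continuous hL hC0 (h₁ R) (h₂ R) hc₁ hc₂ (fun s hs =>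
        ⟨(hC s hs).1, (hC s hs).2, hmem _ (hC s hs).1, hmem _ (hC s hs).2⟩) t le_rfl
      rwa [h0, sub_self, norm_zero] at this
    have h3 : Tendsto (fun R => K * (‖M.g‖ * 0 + 2 * C * ‖M.g - M.P R M.g‖)) atTop (𝓝 0) := by
      have := ((((tendsto_iff_norm_sub_tendsto_zero.1 (M.tendsto_P M.g))).const_mul
        (2 * C)).const_add (‖M.g‖ * 0)).const_mul K
      simpa [norm_sub_rev] using this
    exact sub_eq_zero.1 (norm_le_zero_iff.1 (ge_of_tendsto' h3 h2))
  funext t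
  refine M.ext_of_P fun R => sub_eq_zero.1 ?_
  -- Equal traces remove the source, so each truncation of the difference solves the free equation
  -- with zero data.
  have h3 := SolvesLinear.sub (h₁ R) (h₂ R)
  simp only [htr, sub_self] at h3
  have h4 := h3.norm_P_le continuous_const le_rfl (fun s _ => norm_zero.le) (le_refl |t|)
  rw [h0, sub_self, map_zero, norm_zero, zero_mul, zero_mul, add_zero, map_sub] at h4
  exact norm_le_zero_iff.1 h4

end TruncatedModel

/-! ### Conservation laws, existence and continuous dependence. -/

namespace TruncatedModel

variable {X : Type*} [NormedAddCommGroup X] [InnerProductSpace ℂ X] (M : TruncatedModel X)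

/-- The energy with potential `U`. -/
noncomputable def en (U : ℂ → ℝ) (x : X) : ℝ := M.k x / 2 + U (M.tr x)

theorem hasDerivAt_q {u : ℝ → X} {u' : X} {t : ℝ} (hu : HasDerivAt u u' t) :
    HasDerivAt (fun t => M.q (u t)) (2 * (inner ℂ (M.a (u t)) u').re) t := by
  have h1 := hu.inner ℂ (hu.complexCLM M.a)
  have h2 := Complex.reCLM.hasFDerivAt.comp_hasDerivAt t h1
  refine h2.congr_deriv ?_
  rw [Complex.reCLM_apply, Complex.add_re, ← M.inner_a, Complex.re_inner_comm u', two_mul]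

theorem hasDerivAt_norm_sq {u : ℝ → X} {u' : X} {t : ℝ} (hu : HasDerivAt u u' t) :
    HasDerivAt (fun t => ‖u t‖ ^ 2) (2 * (inner ℂ (u t) u').re) t := by
  have h1 := hu.inner ℂ hu
  have h2 := Complex.reCLM.hasFDerivAt.comp_hasDerivAt t h1
  refine (h2.congr_deriv ?_).congr_of_eventuallyEq (Eventually.of_forall fun s => ?_)
  · rw [Complex.reCLM_apply, Complex.add_re, Complex.re_inner_comm u', two_mul]
  · exact (Complex.re_inner_self _).symm

theorem hasDerivAt_k {u : ℝ → X} {u' : X} {t : ℝ} (hu : HasDerivAt u u' t) :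
    HasDerivAt (fun t => M.k (u t)) (2 * (inner ℂ (u t - M.a (u t)) u').re) t := by
  refine ((hasDerivAt_norm_sq hu).sub (M.hasDerivAt_q hu)).congr_deriv ?_
  rw [inner_sub_left, Complex.sub_re]
  ring

theorem hasDerivAt_comp_tr {U : ℂ → ℝ} (hU : Differentiable ℝ U) {u : ℝ → X} {u' : X} {t : ℝ}
    (hu : HasDerivAt u u' t) :
    HasDerivAt (fun t => U (M.tr (u t)))
      ((starRingEnd ℂ (∇ U (M.tr (u t)))) * M.tr u').re t := by
  have h1 : HasDerivAt (fun t => M.tr (u t)) (M.tr u') t := hu.complexCLM (innerSL ℂ M.g)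
  have h2 := (hU (M.tr (u t))).hasGradientAt.hasFDerivAt.comp_hasDerivAt t h1
  refine h2.congr_deriv ?_
  rw [InnerProductSpace.toDual_apply_apply, Complex.inner, mul_comm]

/-- The truncated flow conserves the charge and the energy. -/
theorem conservation_of_truncated {U : ℂ → ℝ} {F : ℂ → ℂ} (hU : Differentiable ℝ U)
    (hF : ∀ z, F z = -∇ U z) (hg : ∀ z, (F z * starRingEnd ℂ z).im = 0) {N : ℕ} {u : ℝ → X}
    (hu : ∀ t, HasDerivAt u (-(Complex.I • M.H N (u t)) + (Complex.I * F (M.tr (u t))) • M.e N) t)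
    (hP : ∀ t, M.P N (u t) = u t) (t : ℝ) :
    M.q (u t) = M.q (u 0) ∧ M.en U (u t) = M.en U (u 0) := by
  have aH : ∀ t, M.a (M.H N (u t)) = u t - M.a (u t) := fun t => by rw [M.a_H, hP]
  have hself : ∀ x : X, (inner ℂ x x).im = 0 := fun x => inner_self_im (𝕜 := ℂ) x
  have haself : ∀ x : X, (inner ℂ (M.a x) x).im = 0 := fun x => by
    have h1 : starRingEnd ℂ (inner ℂ (M.a x) x) = inner ℂ (M.a x) x := by
      rw [inner_conj_symm, M.inner_a]
    exact Complex.conj_eq_iff_im.1 h1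
  have hPz : ∀ x, M.P N x = x → inner ℂ (M.P N M.g) x = M.tr x := fun x hx => by
    rw [M.inner_P, hx, tr]
  have hq : ∀ t, HasDerivAt (fun t => M.q (u t)) 0 t := by
    intro t
    refine (M.hasDerivAt_q (hu t)).congr_deriv ?_
    -- Both terms are `i` times a real number: the first by self-adjointness, the second because `F
    -- z * conj z` is real by `hg`.
    have h1 : inner ℂ (M.a (u t)) (-(Complex.I • M.H N (u t)) +
        (Complex.I * F (M.tr (u t))) • M.e N) = -(Complex.I * (inner ℂ (u t) (u t) -
          inner ℂ (M.a (u t)) (u t))) +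
          Complex.I * (F (M.tr (u t)) * starRingEnd ℂ (M.tr (u t))) := by
      rw [inner_add_right, inner_neg_right, inner_smul_right, inner_smul_right, M.inner_a, aH,
        M.inner_a _ (M.e N), M.a_e, inner_sub_right, ← M.inner_a,
        ← inner_conj_symm (u t) (M.P N M.g), hPz _ (hP t)]
      ring
    rw [h1]
    simp only [Complex.add_re, Complex.neg_re, Complex.mul_re Complex.I, Complex.I_re, Complex.I_im,
      Complex.sub_im, hself, haself, hg]
    ring
  have hE : ∀ t, HasDerivAt (fun t => M.en U (u t)) 0 t := by
    intro t
    set u' := -(Complex.I • M.H N (u t)) + (Complex.I * F (M.tr (u t))) • M.e N with hu'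
    refine (((M.hasDerivAt_k (hu t)).div_const 2).add
      (M.hasDerivAt_comp_tr hU (hu t))).congr_deriv ?_
    have hPu' : M.P N u' = u' := by
      rw [hu', map_add, map_neg, map_smul, map_smul, M.P_H le_rfl, M.P_e le_rfl]
    -- This is the equation solved for the gradient of the kinetic energy. Paired with `u'`, the
    -- first term is purely imaginary; the second cancels the derivative of `U`, since `P N g` and
    -- `g` pair equally with `u'`.
    have h1 : u t - M.a (u t) = Complex.I • M.a u' + F (M.tr (u t)) • M.P N M.g := by
      rw [hu', map_add, map_neg, map_smul, map_smul, aH, M.a_e, smul_add, smul_neg, smul_smul,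
        smul_smul, ← mul_assoc, Complex.I_mul_I]
      module
    have h2 : ∇ U (M.tr (u t)) = -F (M.tr (u t)) := by rw [hF, neg_neg]
    rw [← hu', h1, h2, inner_add_left, inner_smul_left, inner_smul_left, hPz _ hPu', Complex.conj_I,
      map_neg, neg_mul, neg_mul, Complex.neg_re, Complex.add_re, Complex.neg_re,
      Complex.mul_re Complex.I, haself, Complex.I_re]
    ring
  have hc : ∀ f : ℝ → ℝ, (∀ t, HasDerivAt f 0 t) → f t = f 0 := fun f hf =>
    is_const_of_deriv_eq_zero (fun t => (hf t).differentiableAt) (fun t => (hf t).deriv) t 0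
  exact ⟨hc _ hq, hc _ hE⟩

/-- The truncated Laplacian is bounded, so the vector field is globally Lipschitz. Since it takes
values in the range of `P N`, the solution stays there. -/
theorem exists_truncated_solution [CompleteSpace X] {F : ℂ → ℂ} {K : NNReal}
    (hF : LipschitzWith K F) (N : ℕ) (φ : X) : ∃ u : ℝ → X, u 0 = M.P N φ ∧
      (∀ t, HasDerivAt u (-(Complex.I • M.H N (u t)) + (Complex.I * F (M.tr (u t))) • M.e N) t) ∧
      ∀ t, M.P N (u t) = u t := by
  have hLip : LipschitzWith (‖M.H N‖₊ + K * ‖M.g‖₊ * ‖M.e N‖₊)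
      (fun x : X => -(Complex.I • M.H N x) + (Complex.I * F (M.tr x)) • M.e N) := by
    refine LipschitzWith.of_dist_le_mul fun x y => ?_
    rw [dist_eq_norm, dist_eq_norm]
    have e1 : -(Complex.I • M.H N x) + (Complex.I * F (M.tr x)) • M.e N -
        (-(Complex.I • M.H N y) + (Complex.I * F (M.tr y)) • M.e N) =
        -(Complex.I • M.H N (x - y)) + (Complex.I * (F (M.tr x) - F (M.tr y))) • M.e N := by
      rw [map_sub]; module
    rw [e1]
    refine (norm_add_le _ _).trans ?_
    rw [norm_neg, norm_smul, norm_smul, norm_mul, Complex.norm_I, one_mul, one_mul]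
    push_cast
    rw [add_mul]
    refine add_le_add ((M.H N).le_opNorm _) ?_
    calc ‖F (M.tr x) - F (M.tr y)‖ * ‖M.e N‖ ≤ (K * (‖M.g‖ * ‖x - y‖)) * ‖M.e N‖ := by
          gcongr
          refine (hF.norm_sub_le _ _).trans ?_
          gcongr
          rw [← tr_sub]
          exact M.norm_tr_le _
      _ = _ := by ring
  obtain ⟨u, hu0, hu⟩ := exists_global_solution_of_lipschitz hLip (M.P N φ)
  refine ⟨u, hu0, hu, fun t => ?_⟩
  have h1 : ∀ t, HasDerivAt (fun t => M.P N (u t) - u t) 0 t := by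
    intro t
    refine (((hu t).complexCLM (M.P N)).sub (hu t)).congr_deriv ?_
    rw [map_add, map_neg, map_smul, map_smul, M.P_H le_rfl, M.P_e le_rfl, sub_self]
  have h2 := is_const_of_deriv_eq_zero (fun t => (h1 t).differentiableAt) (fun t => (h1 t).deriv) t 0
  rw [hu0, M.P_P le_rfl, sub_self] at h2
  exact sub_eq_zero.1 h2

theorem continuous_k : Continuous M.k := by
  have := M.continuous_q
  unfold k
  fun_prop

theorem norm_P_sub_P_le {R m n : ℕ} (hm : R ≤ m) (hn : R ≤ n) (φ : X) :
    ‖M.P m φ - M.P n φ‖ ≤ 2 * ‖φ - M.P R φ‖ := by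
  have : M.P m φ - M.P n φ = M.P m (φ - M.P R φ) - M.P n (φ - M.P R φ) := by
    rw [map_sub, map_sub, M.P_P' hm, M.P_P' hn]; abel
  rw [this, two_mul]
  exact (norm_sub_le _ _).trans (add_le_add (M.norm_P_le _ _) (M.norm_P_le _ _))

/-- Limits of solutions of the truncated equations. -/
theorem exists_solves_of_truncated [CompleteSpace X] {F : ℂ → ℂ} {K : NNReal}
    (hF : LipschitzWith K F) {φ : X} {u : ℕ → ℝ → X} {C : ℝ} (hu0 : ∀ N, u N 0 = M.P N φ)
    (hu : ∀ N, M.Solves F N (u N)) (huc : ∀ N, Continuous (u N)) (hC : ∀ N t, ‖u N t‖ ≤ C) :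
    ∃ w : ℝ → X, w 0 = φ ∧ (∀ R, M.Solves F R w) ∧ Continuous (fun t => M.tr (w t)) ∧
      (∀ t, ‖w t‖ ≤ C) ∧
      ∀ t v, Tendsto (fun N => inner ℂ v (u N t)) atTop (𝓝 (inner ℂ v (w t))) := by
  have hC0 : 0 ≤ C := (norm_nonneg _).trans (hC 0 0)
  have hsolve : ∀ {R N}, R ≤ N → M.Solves F R (u N) := fun h => SolvesLinear.mono h (hu _)
  have hFc := hF.continuous
  have htc : ∀ N, Continuous fun t => M.tr (u N t) := fun N => M.continuous_tr.comp (huc N)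
  -- the traces are uniformly Cauchy on bounded intervals
  have hβ : ∀ T : ℝ, 0 ≤ T → ∃ β : ℕ → ℝ, Tendsto β atTop (𝓝 0) ∧ (∀ R, 0 ≤ β R) ∧
      ∀ R m n, R ≤ m → R ≤ n → ∀ t, |t| ≤ T → ‖M.tr (u m t) - M.tr (u n t)‖ ≤ β R := by
    intro T hT
    -- Both `u m` and `u n` solve the equation at every level `R ≤ m, n`, and there the stability
    -- estimate compares them.
    obtain ⟨K', hK', h⟩ := M.exists_norm_tr_sub_le K hT
    refine ⟨fun R => K' * (‖M.g‖ * (2 * ‖φ - M.P R φ‖) + 2 * C * ‖M.g - M.P R M.g‖), ?_,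
      fun R => by positivity, fun R m n hm hn t ht => ?_⟩
    · have h1 := tendsto_iff_norm_sub_tendsto_zero.1 (M.tendsto_P M.g)
      have h2 := tendsto_iff_norm_sub_tendsto_zero.1 (M.tendsto_P φ)
      have := (((h2.const_mul 2).const_mul ‖M.g‖).add (h1.const_mul (2 * C))).const_mul K'
      simpa [norm_sub_rev] using this
    · refine (h F univ R C (u m) (u n) hFc hF.lipschitzOnWith hC0 (hsolve hm) (hsolve hn)
        (htc m) (htc n) (fun t _ => ⟨hC _ _, hC _ _, mem_univ _, mem_univ _⟩) t ht).trans ?_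
      rw [hu0, hu0]
      beta_reduce; gcongr
      exact M.norm_P_sub_P_le hm hn φ
  -- so are the truncations
  have hγ : ∀ (S : ℕ) (T : ℝ), 0 ≤ T → ∃ γ : ℕ → ℝ, Tendsto γ atTop (𝓝 0) ∧
      ∀ R m n, S ≤ R → R ≤ m → R ≤ n → ∀ t, |t| ≤ T →
        ‖M.P S (u m t) - M.P S (u n t)‖ ≤ γ R := by
    intro S T hT
    obtain ⟨β, hβ0, hβp, hβ⟩ := hβ T hT
    refine ⟨fun R => 2 * ‖φ - M.P R φ‖ + K * β R * ‖M.e S‖ * T, ?_,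
      fun R m n hS hm hn t ht => ?_⟩
    · have h2 := tendsto_iff_norm_sub_tendsto_zero.1 (M.tendsto_P φ)
      have := (h2.const_mul 2).add (((hβ0.const_mul (K : ℝ)).mul_const ‖M.e S‖).mul_const T)
      simpa [norm_sub_rev] using this
    · have h1 := SolvesLinear.sub (hsolve (hS.trans hm)) (hsolve (hS.trans hn))
      have hc : Continuous fun t => F (M.tr (u m t)) - F (M.tr (u n t)) := by
        have := htc m; have := htc n; fun_prop
      have h2 := h1.norm_P_le hc (T := T) (δ := K * β R) (by have := hβp R; positivity)
        (fun s hs => (hF.norm_sub_le _ _).trans (by gcongr; exact hβ R m n hm hn s hs)) ht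
      rw [map_sub] at h2
      refine h2.trans ?_
      beta_reduce; gcongr
      rw [hu0, hu0]
      exact (M.norm_P_le _ _).trans (M.norm_P_sub_P_le hm hn φ)
  have hcs : ∀ t S, CauchySeq fun n => M.P S (u n t) := by
    intro t S
    obtain ⟨γ, hγ0, hγ⟩ := hγ S |t| (abs_nonneg t)
    rw [Metric.cauchySeq_iff]
    intro ε hε
    obtain ⟨R, hR, hRS⟩ := ((hγ0.eventually_lt_const hε).and (eventually_ge_atTop S)).exists
    exact ⟨R, fun m hm n hn => by
      rw [dist_eq_norm]; exact (hγ R m n hRS hm hn t le_rfl).trans_lt hR⟩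
  choose w hwC hw using fun t => M.exists_weak_limit (hC · t) (hcs t)
  have hweak : ∀ t v, Tendsto (fun N => inner ℂ v (u N t)) atTop (𝓝 (inner ℂ v (w t))) :=
    fun t v => M.tendsto_inner_of_tendsto_P (Eventually.of_forall fun N => hC N t) (hw t) v
  have htr : ∀ T : ℝ, 0 ≤ T → TendstoUniformlyOn (fun N t => M.tr (u N t)) (fun t => M.tr (w t))
      atTop (Ioo (-T) T) := by
    intro T hT
    obtain ⟨β, hβ0, hβp, hβ⟩ := hβ T hT
    rw [Metric.tendstoUniformlyOn_iff]
    intro ε hε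
    filter_upwards [hβ0.eventually_lt_const hε] with n hn t ht
    refine lt_of_le_of_lt ?_ hn
    rw [dist_eq_norm]
    refine le_of_tendsto ((hweak t M.g).sub_const _).norm ?_
    filter_upwards [eventually_ge_atTop n] with m hm
    exact hβ n m n hm le_rfl t (abs_le.2 ⟨ht.1.le, ht.2.le⟩)
  have hPu : ∀ (S : ℕ) (T : ℝ), 0 ≤ T → TendstoUniformlyOn (fun N t => M.P S (u N t))
      (fun t => M.P S (w t)) atTop (Ioo (-T) T) := by
    intro S T hT
    obtain ⟨γ, hγ0, hγ⟩ := hγ S T hT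
    rw [Metric.tendstoUniformlyOn_iff]
    intro ε hε
    filter_upwards [hγ0.eventually_lt_const hε, eventually_ge_atTop S] with n hn hS t ht
    refine lt_of_le_of_lt ?_ hn
    rw [dist_eq_norm]
    refine le_of_tendsto ((hw t S).sub_const _).norm ?_
    filter_upwards [eventually_ge_atTop n] with m hm
    exact hγ n m n hS hm le_rfl t (abs_le.2 ⟨ht.1.le, ht.2.le⟩)
  refine ⟨w, ?_, fun S t => ?_, ?_, hwC, hweak⟩
  · refine M.ext_of_P fun S => tendsto_nhds_unique (hw 0 S) ?_
    refine tendsto_const_nhds.congr' ?_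
    filter_upwards [eventually_ge_atTop S] with n hn
    rw [hu0, M.P_P hn]
  · have hT : 0 ≤ |t| + 1 := by positivity
    -- The velocities converge uniformly on a neighbourhood of `t`, so the derivative passes to the
    -- limit.
    refine hasDerivAt_of_tendstoLocallyUniformlyOn (l := atTop) (s := Ioo (-(|t| + 1)) (|t| + 1))
      (f := fun N t => M.P S (u N t))
      (f' := fun N t => -(Complex.I • M.H S (u N t)) + (Complex.I * F (M.tr (u N t))) • M.e S)
      (g' := fun t => -(Complex.I • M.H S (w t)) + (Complex.I * F (M.tr (w t))) • M.e S)
      isOpen_Ioo (TendstoUniformlyOn.tendstoLocallyUniformlyOn ?_) ?_ (fun t _ => hw t S)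
      ⟨by linarith [neg_abs_le t], by linarith [le_abs_self t]⟩
    · have h1 := Metric.tendstoUniformlyOn_iff.1 (htr _ hT)
      have h2 := Metric.tendstoUniformlyOn_iff.1 (hPu S _ hT)
      rw [Metric.tendstoUniformlyOn_iff]
      intro ε hε
      filter_upwards [h1 (ε / 2 / (K * ‖M.e S‖ + 1)) (by positivity),
        h2 (ε / 2 / (‖M.H S‖ + 1)) (by positivity)] with n hn1 hn2 s hs
      have h3 := hn1 s hs
      have h4 := hn2 s hs
      rw [dist_eq_norm, lt_div_iff₀ (by positivity)] at h3 h4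
      -- Inserting `P S` behind `H S` makes convergence of the truncations sufficient; `w` itself is
      -- only a weak limit.
      have e1 : -(Complex.I • M.H S (w s)) + (Complex.I * F (M.tr (w s))) • M.e S -
          (-(Complex.I • M.H S (u n s)) + (Complex.I * F (M.tr (u n s))) • M.e S) =
          -(Complex.I • M.H S (M.P S (w s) - M.P S (u n s))) +
            (Complex.I * (F (M.tr (w s)) - F (M.tr (u n s)))) • M.e S := by
        rw [map_sub, M.H_P le_rfl, M.H_P le_rfl]; module
      rw [dist_eq_norm, e1]
      refine (norm_add_le _ _).trans_lt ?_
      rw [norm_neg, norm_smul, norm_smul, norm_mul, Complex.norm_I, one_mul, one_mul]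
      have h5 : ‖M.H S (M.P S (w s) - M.P S (u n s))‖ < ε / 2 := by
        refine ((M.H S).le_opNorm _).trans_lt (lt_of_le_of_lt ?_ h4)
        rw [mul_comm]
        gcongr
        linarith
      have h6 : ‖F (M.tr (w s)) - F (M.tr (u n s))‖ * ‖M.e S‖ < ε / 2 := by
        refine lt_of_le_of_lt ?_ h3
        calc _ ≤ (K * ‖M.tr (w s) - M.tr (u n s)‖) * ‖M.e S‖ := by
              gcongr
              exact hF.norm_sub_le _ _
          _ = ‖M.tr (w s) - M.tr (u n s)‖ * (K * ‖M.e S‖) := by ring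
          _ ≤ _ := by gcongr; linarith
      linarith
    · filter_upwards [eventually_ge_atTop S] with n hn s _ using hsolve hn s
  · rw [continuous_iff_continuousAt]
    intro t
    have h1 := (htr (|t| + 1) (by positivity)).continuousOn
      (Eventually.of_forall fun N => (htc N).continuousOn).frequently
    exact h1.continuousAt (isOpen_Ioo.mem_nhds
      ⟨by linarith [neg_abs_le t], by linarith [le_abs_self t]⟩)

/-- A bounded solution along which the charge and the energy do not exceed their initial values. -/
theorem exists_solves_of_lipschitz [CompleteSpace X] {U : ℂ → ℝ} {F : ℂ → ℂ} {K : NNReal} {A B : ℝ}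
    (hU : ContDiff ℝ 1 U) (hF : ∀ z, F z = -∇ U z) (hK : LipschitzWith K F)
    (hg : ∀ z, (F z * starRingEnd ℂ z).im = 0) (hB : 0 ≤ B) (hAB : ∀ z, A - B * ‖z‖ ^ 2 ≤ U z)
    (φ : X) :
    ∃ w : ℝ → X, w 0 = φ ∧ (∀ R, M.Solves F R w) ∧ Continuous (fun t => M.tr (w t)) ∧
      (∃ C, ∀ t, ‖w t‖ ≤ C) ∧ ∀ t, M.q (w t) ≤ M.q φ ∧ M.en U (w t) ≤ M.en U φ := by
  have hUd : Differentiable ℝ U := hU.differentiable one_ne_zero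
  choose u hu0 hu huP using fun N => M.exists_truncated_solution hK N φ
  have hcons := fun N t => M.conservation_of_truncated hUd hF hg (hu N) (huP N) t
  have hqc : Tendsto (fun N => M.q (M.P N φ)) atTop (𝓝 (M.q φ)) :=
    (M.continuous_q.tendsto _).comp (M.tendsto_P φ)
  have hec : Tendsto (fun N => M.en U (M.P N φ)) atTop (𝓝 (M.en U φ)) := by
    have h : Continuous (M.en U) := by
      have := M.continuous_k; have := M.continuous_tr; have := hU.continuous
      unfold en; fun_prop
    exact (h.tendsto _).comp (M.tendsto_P φ)
  obtain ⟨q₀, hq₀⟩ := hqc.bddAbove_range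
  obtain ⟨E₀, hE₀⟩ := hec.bddAbove_range
  obtain ⟨D, hD, hapriori⟩ := M.norm_sq_le_of_energy_le hB
  have hC : ∀ N t, ‖u N t‖ ≤ √(2 * q₀ + 4 * (E₀ - A + D * q₀)) := fun N t => by
    refine Real.le_sqrt_of_sq_le (hapriori A U hAB _ _ _ ?_ ?_)
    · rw [(hcons N t).1, hu0]; exact hq₀ (mem_range_self N)
    · have := (hcons N t).2
      rw [hu0] at this
      exact this.le.trans (hE₀ (mem_range_self N))
  obtain ⟨w, hw0, hw, hwc, hwC, hweak⟩ := M.exists_solves_of_truncated hK hu0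
    (fun N t => (hu N t).congr_of_eventuallyEq (Eventually.of_forall (huP N)))
    (fun N => continuous_iff_continuousAt.2 fun t => (hu N t).continuousAt) hC
  refine ⟨w, hw0, hw, hwc, ⟨_, hwC⟩, fun t => ⟨?_, ?_⟩⟩
  · refine M.q_le_of_tendsto (hweak t) (hqc.congr fun N => ?_)
    rw [(hcons N t).1, hu0]
  -- The trace is weakly continuous, so the potential energy converges, and energy conservation then
  -- determines the limit of the kinetic part.
  · have h1 : Tendsto (fun N => M.k (u N t)) atTop (𝓝 (2 * (M.en U φ - U (M.tr (w t))))) := by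
      have h2 := ((hU.continuous.tendsto _).comp (hweak t M.g))
      refine ((hec.sub h2).const_mul 2).congr fun N => ?_
      have := (hcons N t).2
      rw [hu0] at this
      rw [← this, en, Function.comp, tr]
      ring
    have h2 := M.k_le_of_tendsto (hweak t) h1
    rw [en]
    linarith

/-- Weak continuity comes from the truncations. The conservation laws express `‖w t‖²` through the
continuous trace, which upgrades it to strong continuity. -/
theorem continuous_of_solves {U : ℂ → ℝ} (hU : Continuous U) {F : ℂ → ℂ} {w : ℝ → X}
    (hw : ∀ R, M.Solves F R w) (hwc : Continuous fun t => M.tr (w t)) {C : ℝ}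
    (hC : ∀ t, ‖w t‖ ≤ C) {q₀ E₀ : ℝ} (hq : ∀ t, M.q (w t) = q₀) (hE : ∀ t, M.en U (w t) = E₀) :
    Continuous w := by
  rw [continuous_iff_continuousAt]
  intro t
  refine tendsto_of_tendsto_inner_of_tendsto_norm ?_ ?_
  · exact M.tendsto_inner_of_tendsto_P (Eventually.of_forall hC)
      (fun R => ((hw R).continuous_P).tendsto t) _
  · have e1 : ∀ s, ‖w s‖ ^ 2 = q₀ + 2 * (E₀ - U (M.tr (w s))) := fun s => by
      rw [← hq s, ← hE s, en, k]; ring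
    simp only [e1]
    have : Continuous fun s => q₀ + 2 * (E₀ - U (M.tr (w s))) := by fun_prop
    exact this.tendsto t

/-- Global existence for Lipschitz nonlinearities. -/
theorem exists_conservative_solution [CompleteSpace X] {U : ℂ → ℝ} {F : ℂ → ℂ} {K : NNReal}
    {A B : ℝ} (hU : ContDiff ℝ 1 U) (hF : ∀ z, F z = -∇ U z) (hFc : ContDiff ℝ 1 F)
    (hK : LipschitzWith K F) (hg : ∀ z, (F z * starRingEnd ℂ z).im = 0) (hB : 0 ≤ B)
    (hAB : ∀ z, A - B * ‖z‖ ^ 2 ≤ U z) (φ : X) :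
    ∃ w : ℝ → X, w 0 = φ ∧ Continuous w ∧ (∀ R, M.Solves F R w) ∧
      ∀ t, M.q (w t) = M.q φ ∧ M.en U (w t) = M.en U φ := by
  choose S hS0 hS hSc hSC hSle using M.exists_solves_of_lipschitz hU hF hK hg hB hAB
  have hflow : ∀ s t, S (S φ s) t = S φ (s + t) := by
    intro s t
    refine congrFun (eq_of_solves hFc (hS _) (fun R => (hS φ R).comp_add_const s) (hSc _)
      ((hSc φ).comp (continuous_const_add s)) (fun T => ?_) (by rw [hS0, add_zero])) t
    obtain ⟨C₁, h₁⟩ := hSC (S φ s)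
    obtain ⟨C₂, h₂⟩ := hSC φ
    exact ⟨max C₁ C₂, fun t _ => ⟨(h₁ t).trans (le_max_left _ _),
      (h₂ (s + t)).trans (le_max_right _ _)⟩⟩
  have hcons : ∀ t, M.q (S φ t) = M.q φ ∧ M.en U (S φ t) = M.en U φ := by
    intro t
    -- Restarting at `S φ t` and running for time `-t` returns to `φ` by uniqueness, so charge and
    -- energy cannot have decreased.
    have h1 := hSle (S φ t) (-t)
    rw [hflow, add_neg_cancel, hS0] at h1
    exact ⟨le_antisymm (hSle φ t).1 h1.1, le_antisymm (hSle φ t).2 h1.2⟩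
  obtain ⟨C, hC⟩ := hSC φ
  exact ⟨S φ, hS0 φ, M.continuous_of_solves hU.continuous (hS φ) (hSc φ) hC (fun t => (hcons t).1)
    (fun t => (hcons t).2), hS φ, hcons⟩

/-- Continuous dependence on the initial data. -/
theorem tendstoUniformlyOn_of_solves [CompleteSpace X] {U : ℂ → ℝ} (hU : Continuous U) {F : ℂ → ℂ}
    (hF : ContDiff ℝ 1 F) {S : X → ℝ → X} (hS0 : ∀ φ, S φ 0 = φ) (hSc : ∀ φ, Continuous (S φ))
    (hS : ∀ φ R, M.Solves F R (S φ))
    (hcons : ∀ φ t, M.q (S φ t) = M.q φ ∧ M.en U (S φ t) = M.en U φ) {φ : X} {C : ℝ}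
    (hC : ∀ᶠ φ' in 𝓝 φ, ∀ t, ‖S φ' t‖ ≤ C) {T : ℝ} (hT : 0 ≤ T) :
    TendstoUniformlyOn S (S φ) (𝓝 φ) (Icc 0 T) := by
  have hC0 : 0 ≤ C := (norm_nonneg _).trans (hC.self_of_nhds 0)
  have htc : ∀ φ, Continuous fun t => M.tr (S φ t) := fun φ => M.continuous_tr.comp (hSc φ)
  obtain ⟨L, hL⟩ := (hF.contDiffOn (s := Metric.closedBall 0 (‖M.g‖ * C))).exists_lipschitzOnWith
    one_ne_zero (convex_closedBall _ _) (isCompact_closedBall _ _)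
  have hmem : ∀ x : X, ‖x‖ ≤ C → M.tr x ∈ Metric.closedBall (0 : ℂ) (‖M.g‖ * C) := fun x hx => by
    rw [mem_closedBall_zero_iff]
    exact (M.norm_tr_le x).trans (by gcongr)
  obtain ⟨K, hK, hst⟩ := M.exists_norm_tr_sub_le L hT
  have htr : ∀ᶠ φ' in 𝓝 φ, ∀ t, |t| ≤ T →
      ‖M.tr (S φ' t) - M.tr (S φ t)‖ ≤ K * (‖M.g‖ * ‖φ' - φ‖) := by
    filter_upwards [hC] with φ' hφ' t ht
    have h3 : Tendsto (fun R => K * (‖M.g‖ * ‖φ' - φ‖ + 2 * C * ‖M.g - M.P R M.g‖)) atTop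
        (𝓝 (K * (‖M.g‖ * ‖φ' - φ‖))) := by
      have := ((((tendsto_iff_norm_sub_tendsto_zero.1 (M.tendsto_P M.g))).const_mul
        (2 * C)).const_add (‖M.g‖ * ‖φ' - φ‖)).const_mul K
      simpa [norm_sub_rev] using this
    refine ge_of_tendsto' h3 fun R => ?_
    have := hst F _ R C (S φ') (S φ) hF.continuous hL hC0 (hS φ' R) (hS φ R) (htc φ') (htc φ)
      (fun s _ => ⟨hφ' s, hC.self_of_nhds s, hmem _ (hφ' s), hmem _ (hC.self_of_nhds s)⟩) t ht
    rwa [hS0, hS0] at this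
  have habs : ∀ {t : ℝ}, t ∈ Icc 0 T → |t| ≤ T := fun ht => by rw [abs_of_nonneg ht.1]; exact ht.2
  have hP : ∀ R, ∀ᶠ φ' in 𝓝 φ, ∀ t, |t| ≤ T →
      ‖M.P R (S φ' t - S φ t)‖ ≤
        ‖φ' - φ‖ + L * (K * (‖M.g‖ * ‖φ' - φ‖)) * ‖M.e R‖ * T := by
    intro R
    filter_upwards [hC, htr] with φ' hφ' htr' t ht
    have hc : Continuous fun t => F (M.tr (S φ' t)) - F (M.tr (S φ t)) := by
      have := htc φ; have := htc φ'; have := hF.continuous; fun_prop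
    have h2 := (SolvesLinear.sub (hS φ' R) (hS φ R)).norm_P_le hc (T := T)
      (δ := L * (K * (‖M.g‖ * ‖φ' - φ‖))) (by positivity)
      (fun s hs => (hL.norm_sub_le (hmem _ (hφ' s)) (hmem _ (hC.self_of_nhds s))).trans
        (by gcongr; exact htr' s hs)) ht
    refine h2.trans ?_
    gcongr
    rw [hS0, hS0]
    exact M.norm_P_le _ _
  -- Compactness of the time interval reduces the claim to joint convergence as data and time tend
  -- to `(φ, t₀)`; there the weak-plus-norm criterion applies.
  rw [← tendstoLocallyUniformlyOn_iff_tendstoUniformlyOn_of_compact isCompact_Icc,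
    tendstoLocallyUniformlyOn_iff_forall_tendsto]
  intro t₀ ht₀
  set l : Filter (X × ℝ) := 𝓝 φ ×ˢ 𝓝[Icc 0 T] t₀ with hl
  have hfst : Tendsto (fun y : X × ℝ => y.1) l (𝓝 φ) := tendsto_fst
  have hsnd : Tendsto (fun y : X × ℝ => y.2) l (𝓝 t₀) := tendsto_snd.mono_right nhdsWithin_le_nhds
  have hmemT : ∀ᶠ y in l, |y.2| ≤ T := by
    have : ∀ᶠ y in l, y.2 ∈ Icc 0 T := tendsto_snd.eventually self_mem_nhdsWithin
    filter_upwards [this] with y hy using habs hy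
  have hdiff : Tendsto (fun y : X × ℝ => ‖y.1 - φ‖) l (𝓝 0) :=
    tendsto_iff_norm_sub_tendsto_zero.1 hfst
  have hbase : Tendsto (fun y : X × ℝ => S φ y.2) l (𝓝 (S φ t₀)) :=
    ((hSc φ).tendsto t₀).comp hsnd
  have htr₀ : Tendsto (fun y : X × ℝ => M.tr (S y.1 y.2)) l (𝓝 (M.tr (S φ t₀))) := by
    have h1 : Tendsto (fun y : X × ℝ => M.tr (S y.1 y.2) - M.tr (S φ y.2)) l (𝓝 0) := by
      refine squeeze_zero_norm' ?_ (by simpa using (hdiff.const_mul ‖M.g‖).const_mul K)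
      filter_upwards [hfst.eventually htr, hmemT] with y hy hyT using hy y.2 hyT
    simpa using h1.add ((M.continuous_tr.tendsto _).comp hbase)
  have hmain : Tendsto (fun y : X × ℝ => S y.1 y.2) l (𝓝 (S φ t₀)) := by
    refine tendsto_of_tendsto_inner_of_tendsto_norm
      (M.tendsto_inner_of_tendsto_P (C := C) ?_ (fun R => ?_) _) ?_
    · filter_upwards [hfst.eventually hC] with y hy using hy y.2
    · have h1 : Tendsto (fun y : X × ℝ => M.P R (S y.1 y.2 - S φ y.2)) l (𝓝 0) := by
        refine squeeze_zero_norm' (a := fun y : X × ℝ => ‖y.1 - φ‖ +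
          L * (K * (‖M.g‖ * ‖y.1 - φ‖)) * ‖M.e R‖ * T) ?_ ?_
        · filter_upwards [hfst.eventually (hP R), hmemT] with y hy hyT using hy y.2 hyT
        · have := hdiff.add (((((hdiff.const_mul ‖M.g‖).const_mul K).const_mul (L : ℝ)).mul_const
            ‖M.e R‖).mul_const T)
          simpa using this
      have h2 := h1.add (((M.P R).continuous.tendsto _).comp hbase)
      simpa [map_sub] using h2
    -- By conservation the norm is a continuous function of the data and the trace, so it converges
    -- too.
    · have e1 : ∀ φ s, ‖S φ s‖ ^ 2 = M.q φ + 2 * (M.en U φ - U (M.tr (S φ s))) := fun φ s => by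
        rw [← (hcons φ s).1, ← (hcons φ s).2, en, k]; ring
      simp only [e1]
      have hqc := (M.continuous_q.tendsto φ).comp hfst
      have hec : Tendsto (fun y : X × ℝ => M.en U y.1) l (𝓝 (M.en U φ)) := by
        have h : Continuous (M.en U) := by
          have := M.continuous_k; have := M.continuous_tr
          unfold en; fun_prop
        exact (h.tendsto _).comp hfst
      exact hqc.add ((hec.sub ((hU.tendsto _).comp htr₀)).const_mul 2)
  have hpair := hbase.prodMk_nhds hmain
  exact hpair.mono_right (nhds_le_uniformity _)

end TruncatedModel

/-! ### Radial potentials -/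

theorem contDiff_gradient {U : ℂ → ℝ} (hU : ContDiff ℝ 2 U) : ContDiff ℝ 1 (∇ U) := by
  have h1 : ContDiff ℝ 1 (fderiv ℝ U) := hU.fderiv_right (by norm_num)
  exact (InnerProductSpace.toDual ℝ ℂ).symm.contDiff.comp h1

/-- `U` is constant on the circle `e^{iθ} z`, so its gradient is orthogonal to the tangent vector `i
z`. -/
theorem im_gradient_mul_conj_eq_zero {U : ℂ → ℝ} {u : ℝ → ℝ} (hU : Differentiable ℝ U)
    (hu : ∀ z : ℂ, U z = u (‖z‖ ^ 2)) (z : ℂ) : (∇ U z * starRingEnd ℂ z).im = 0 := by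
  have h1 : HasDerivAt (fun θ : ℝ => Complex.exp (θ * Complex.I) * z) (Complex.I * z) 0 := by
    have h2 : HasDerivAt (fun θ : ℝ => (θ : ℂ) * Complex.I) Complex.I 0 := by
      simpa using (Complex.ofRealCLM.hasDerivAt (x := (0 : ℝ))).mul_const Complex.I
    simpa using h2.cexp.mul_const z
  have hz : Complex.exp ((0 : ℝ) * Complex.I) * z = z := by simp
  have h2 : HasGradientAt U (∇ U z) (Complex.exp ((0 : ℝ) * Complex.I) * z) := by
    rw [hz]; exact (hU z).hasGradientAt
  have h3 := h2.hasFDerivAt.comp_hasDerivAt (0 : ℝ) h1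
  have h4 : (U ∘ fun θ : ℝ => Complex.exp (θ * Complex.I) * z) = fun _ => U z := by
    funext θ
    simp only [Function.comp, hu, norm_mul, Complex.norm_exp_ofReal_mul_I, one_mul]
  rw [h4] at h3
  have h5 := h3.unique (hasDerivAt_const _ _)
  rw [InnerProductSpace.toDual_apply_apply, Complex.inner] at h5
  simp only [Complex.mul_re, Complex.mul_im, Complex.conj_re, Complex.conj_im, Complex.I_re,
    Complex.I_im] at h5 ⊢
  linarith

/-- The potential `U` multiplied with a radial cutoff function. -/
noncomputable def cutoffPotential (U : ℂ → ℝ) (c : ℝ) (z : ℂ) : ℝ :=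
  Real.smoothTransition (c - ‖z‖ ^ 2) * U z

section Cutoff

variable {U : ℂ → ℝ} {c : ℝ}

theorem contDiff_cutoffPotential {n : ℕ∞} (hU : ContDiff ℝ n U) :
    ContDiff ℝ n (cutoffPotential U c) :=
  (Real.smoothTransition.contDiff.comp (contDiff_const.sub (contDiff_norm_sq ℝ))).mul hU

theorem cutoffPotential_of_le {z : ℂ} (hz : ‖z‖ ^ 2 ≤ c - 1) : cutoffPotential U c z = U z := by
  rw [cutoffPotential, Real.smoothTransition.one_of_one_le (by linarith), one_mul]

theorem gradient_cutoffPotential_of_lt {z : ℂ} (hz : ‖z‖ ^ 2 < c - 1) :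
    ∇ (cutoffPotential U c) z = ∇ U z := by
  have h1 : cutoffPotential U c =ᶠ[𝓝 z] U := by
    have : ∀ᶠ y : ℂ in 𝓝 z, ‖y‖ ^ 2 < c - 1 :=
      (by fun_prop : Continuous fun y : ℂ => ‖y‖ ^ 2).continuousAt.eventually_lt_const hz
    filter_upwards [this] with y hy using cutoffPotential_of_le hy.le
  rw [gradient, gradient, h1.fderiv_eq]

theorem exists_lipschitzWith_gradient_cutoffPotential (hU : ContDiff ℝ 2 U) :
    ∃ K, LipschitzWith K (∇ (cutoffPotential U c)) := by
  have h1 : HasCompactSupport (cutoffPotential U c) := by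
    refine HasCompactSupport.intro (isCompact_closedBall 0 (√c)) fun z hz => ?_
    rw [mem_closedBall_zero_iff, not_le] at hz
    have : c ≤ ‖z‖ ^ 2 := by
      rcases le_total 0 c with h | h
      · exact (Real.sqrt_le_left (norm_nonneg _)).1 hz.le
      · exact h.trans (sq_nonneg _)
    rw [cutoffPotential, Real.smoothTransition.zero_of_nonpos (by linarith), zero_mul]
  have h2 : HasCompactSupport (∇ (cutoffPotential U c)) :=
    (h1.fderiv ℝ).comp_left (g := (InnerProductSpace.toDual ℝ ℂ).symm) (map_zero _)
  exact ContDiff.lipschitzWith_of_hasCompactSupport h2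
    (contDiff_gradient (contDiff_cutoffPotential (n := 2) hU)) one_ne_zero

/-- A lower bound survives multiplication by a factor in `[0, 1]` only if it is nonpositive; hence
`-|A|` replaces `A`, with the same `B`. -/
theorem le_cutoffPotential {A B : ℝ} (hB : 0 ≤ B) (h : ∀ z, A - B * ‖z‖ ^ 2 ≤ U z) (z : ℂ) :
    -|A| - B * ‖z‖ ^ 2 ≤ cutoffPotential U c z := by
  have h0 := Real.smoothTransition.nonneg (c - ‖z‖ ^ 2)
  have h1 := Real.smoothTransition.le_one (c - ‖z‖ ^ 2)
  have h2 : 0 ≤ |A| + B * ‖z‖ ^ 2 := by positivity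
  have h3 : -(|A| + B * ‖z‖ ^ 2) ≤ U z := by linarith [h z, neg_abs_le A]
  rw [cutoffPotential]
  nlinarith

end Cutoff

/-! ### Global well-posedness in the abstract model, by removal of the cutoff. -/

namespace TruncatedModel

variable {X : Type*} [NormedAddCommGroup X] [InnerProductSpace ℂ X] (M : TruncatedModel X)

/-- Global well-posedness in the abstract model. -/
theorem global_wellposedness [CompleteSpace X] {U : ℂ → ℝ} {u : ℝ → ℝ} {F : ℂ → ℂ} {A B : ℝ}
    (hU : ContDiff ℝ 2 U) (hF : ∀ z : ℂ, F z = -∇ U z) (hu : ∀ z : ℂ, U z = u (‖z‖ ^ 2))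
    (hB : 0 ≤ B) (hAB : ∀ z : ℂ, A - B * ‖z‖ ^ 2 ≤ U z) :
    ∃ (S : X → ℝ → X) (Λ : X → ℝ), ∀ φ, S φ 0 = φ ∧ Continuous (S φ) ∧ (∀ R, M.Solves F R (S φ)) ∧
      (∀ t, M.q (S φ t) = M.q φ ∧ M.en U (S φ t) = M.en U φ) ∧ 0 < Λ φ ∧ (∀ t, ‖S φ t‖ ≤ Λ φ) ∧
      ∀ T, 0 ≤ T → TendstoUniformlyOn S (S φ) (𝓝 φ) (Icc 0 T) := by
  obtain ⟨D, hD, hapriori⟩ := M.norm_sq_le_of_energy_le hB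
  have hFC : ContDiff ℝ 1 F := by
    rw [funext hF]; exact (contDiff_gradient hU).neg
  set b : X → ℝ := fun φ => 2 * M.q φ + 4 * (M.en U φ - -|A| + D * M.q φ) with hb
  have hbc : Continuous b := by
    have := M.continuous_k; have := M.continuous_tr; have := M.continuous_q; have := hU.continuous
    unfold en at hb
    rw [hb]; fun_prop
  have key : ∀ φ, ∃ w : ℝ → X, w 0 = φ ∧ Continuous w ∧ (∀ R, M.Solves F R w) ∧
      (∀ t, M.q (w t) = M.q φ ∧ M.en U (w t) = M.en U φ) ∧ ∀ t, ‖w t‖ ≤ √(b φ) := by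
    intro φ
    -- The first summand bounds the squared trace along the solution, the second the initial one.
    -- With `c - 1` strictly above both, the cutoff changes neither the energy of `φ` nor the
    -- equation along the solution.
    set c : ℝ := ‖M.g‖ ^ 2 * |b φ| + ‖M.tr φ‖ ^ 2 + 2 with hc
    obtain ⟨K, hK⟩ := exists_lipschitzWith_gradient_cutoffPotential (c := c) hU
    have hUc : ContDiff ℝ 2 (cutoffPotential U c) := contDiff_cutoffPotential (n := 2) hU
    have hφ : M.en (cutoffPotential U c) φ = M.en U φ := by
      rw [en, en, cutoffPotential_of_le]
      have : 0 ≤ ‖M.g‖ ^ 2 * |b φ| := by positivity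
      linarith
    obtain ⟨w, hw0, hwc, hw, hcons⟩ := M.exists_conservative_solution
      (F := fun z => -∇ (cutoffPotential U c) z) (K := K) (A := -|A|)
      (hUc.of_le (by norm_num)) (fun _ => rfl)
      (contDiff_gradient hUc).neg hK.neg
      (fun z => by
        rw [neg_mul, Complex.neg_im, im_gradient_mul_conj_eq_zero
          (u := fun r => Real.smoothTransition (c - r) * u r) (hUc.differentiable two_ne_zero)
          (fun z => by rw [cutoffPotential, hu]), neg_zero])
      hB (le_cutoffPotential hB hAB) φ
    have hbound : ∀ t, ‖w t‖ ^ 2 ≤ b φ := fun t =>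
      hapriori (-|A|) _ (le_cutoffPotential hB hAB) (w t) _ _ (hcons t).1.le
        ((hcons t).2.le.trans hφ.le)
    have hsmall : ∀ t, ‖M.tr (w t)‖ ^ 2 < c - 1 := fun t => by
      have h1 : ‖M.tr (w t)‖ ^ 2 ≤ ‖M.g‖ ^ 2 * |b φ| := by
        calc ‖M.tr (w t)‖ ^ 2 ≤ (‖M.g‖ * ‖w t‖) ^ 2 := by gcongr; exact M.norm_tr_le _
          _ = ‖M.g‖ ^ 2 * ‖w t‖ ^ 2 := by ring
          _ ≤ _ := by gcongr; exact (hbound t).trans (le_abs_self _)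
      have := sq_nonneg ‖M.tr φ‖
      linarith
    refine ⟨w, hw0, hwc, fun R => ?_, fun t => ⟨(hcons t).1, ?_⟩,
      fun t => Real.le_sqrt_of_sq_le (hbound t)⟩
    · have h1 := hw R
      unfold Solves at h1 ⊢
      simpa only [gradient_cutoffPotential_of_lt (hsmall _), ← hF] using h1
    · rw [← hφ, ← (hcons t).2, en, en, cutoffPotential_of_le (hsmall t).le]
  choose S hS0 hSc hS hcons hbound using key
  refine ⟨S, fun φ => √(b φ) + 1, fun φ => ⟨hS0 φ, hSc φ, hS φ, hcons φ, by positivity,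
    fun t => (hbound φ t).trans (by linarith), fun T hT => ?_⟩⟩
  -- The a priori bound `b` is continuous, so one constant bounds all solutions starting near `φ`.
  refine M.tendstoUniformlyOn_of_solves hU.continuous hFC hS0 hSc hS hcons
    (C := √(b φ + 1)) ?_ hT
  filter_upwards [hbc.continuousAt.eventually_lt_const (lt_add_one (b φ))] with φ' hφ' t
  exact (hbound φ' t).trans (Real.sqrt_le_sqrt hφ'.le)

end TruncatedModel

/-! ### Multiplication operators on `L²(ℝ)` -/

/-- A quadratic remainder that is uniform over vectors gives differentiability in operator norm. -/
theorem hasDerivAt_clm_of_norm_le {Y : Type*} [NormedAddCommGroup Y] [NormedSpace ℂ Y]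
    {W : ℝ → Y →L[ℂ] Y} {D : Y →L[ℂ] Y} {t C δ : ℝ} (hδ : 0 < δ) (hC : 0 ≤ C)
    (h : ∀ r : ℝ, |r| ≤ δ → ∀ x, ‖W (t + r) x - W t x - (r : ℂ) • D x‖ ≤ C * r ^ 2 * ‖x‖) :
    HasDerivAt W D t := by
  rw [hasDerivAt_iff_isLittleO_nhds_zero]
  refine Asymptotics.IsBigO.trans_isLittleO (g := fun r : ℝ => r ^ 2) ?_
    (Asymptotics.isLittleO_pow_id one_lt_two)
  refine Asymptotics.IsBigO.of_bound C ?_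
  filter_upwards [Metric.closedBall_mem_nhds (0 : ℝ) hδ] with r hr
  rw [mem_closedBall_zero_iff, Real.norm_eq_abs] at hr
  rw [Real.norm_of_nonneg (sq_nonneg r)]
  refine ContinuousLinearMap.opNorm_le_bound _ (by positivity) fun x => ?_
  exact h r hr x

/-- The space `L²(ℝ)`. -/
abbrev L2 : Type := Lp ℂ 2 (volume : Measure ℝ)

open Classical in
/-- Multiplication with a bounded measurable function as an operator on `L²(ℝ)`. -/
noncomputable def mulOp (m : ℝ → ℂ) : L2 →L[ℂ] L2 :=
  if hm : MemLp m ∞ (volume : Measure ℝ) then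
    (ContinuousLinearMap.mul ℂ ℂ).holderL volume ∞ 2 2 (hm.toLp m) else 0

theorem coeFn_mulOp {m : ℝ → ℂ} (hm : MemLp m ∞ volume) (f : L2) :
    mulOp m f =ᵐ[volume] fun x => m x * f x := by
  rw [mulOp, dif_pos hm]
  refine ((ContinuousLinearMap.mul ℂ ℂ).coeFn_holder (r := 2) (hm.toLp m) f).trans ?_
  filter_upwards [hm.coeFn_toLp] with x hx
  rw [hx, ContinuousLinearMap.mul_apply']

theorem mulOp_mulOp {m n p : ℝ → ℂ} (hm : MemLp m ∞ volume) (hn : MemLp n ∞ volume)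
    (hp : MemLp p ∞ volume) (h : ∀ x, m x * n x = p x) (f : L2) :
    mulOp m (mulOp n f) = mulOp p f := by
  refine Lp.ext ?_
  filter_upwards [coeFn_mulOp hm (mulOp n f), coeFn_mulOp hn f, coeFn_mulOp hp f] with x h1 h2 h3
  rw [h1, h2, h3, ← h, mul_assoc]

theorem mulOp_add {m n p : ℝ → ℂ} (hm : MemLp m ∞ volume) (hn : MemLp n ∞ volume)
    (hp : MemLp p ∞ volume) (h : ∀ x, m x + n x = p x) (f : L2) :
    mulOp m f + mulOp n f = mulOp p f := by
  refine Lp.ext ?_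
  filter_upwards [coeFn_mulOp hm f, coeFn_mulOp hn f, coeFn_mulOp hp f,
    Lp.coeFn_add (mulOp m f) (mulOp n f)] with x h1 h2 h3 h4
  rw [h4, Pi.add_apply, h1, h2, h3, ← h, add_mul]

theorem norm_mulOp_le {m : ℝ → ℂ} (hm : MemLp m ∞ volume) {C : ℝ} (h : ∀ x, ‖m x‖ ≤ C) (f : L2) :
    ‖mulOp m f‖ ≤ C * ‖f‖ := by
  refine Lp.norm_le_mul_norm_of_ae_le_mul ?_
  filter_upwards [coeFn_mulOp hm f] with x hx
  rw [hx, norm_mul]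
  gcongr
  exact h x

theorem inner_mulOp_left {m n : ℝ → ℂ} (hm : MemLp m ∞ volume) (hn : MemLp n ∞ volume)
    (h : ∀ x, starRingEnd ℂ (m x) = n x) (f g : L2) :
    inner ℂ (mulOp m f) g = inner ℂ f (mulOp n g) := by
  rw [L2.inner_def, L2.inner_def]
  refine integral_congr_ae ?_
  filter_upwards [coeFn_mulOp hm f, coeFn_mulOp hn g] with x h1 h2
  rw [h1, h2, RCLike.inner_apply, RCLike.inner_apply, map_mul, h]
  ring

theorem norm_sq_eq_integral (f : L2) : ‖f‖ ^ 2 = ∫ x, ‖f x‖ ^ 2 := by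
  have h1 : (inner ℂ f f).re = ‖f‖ ^ 2 := Complex.re_inner_self f
  rw [← h1, L2.inner_def]
  have h2 : ∀ x, inner ℂ (f x) (f x) = ((‖f x‖ ^ 2 : ℝ) : ℂ) := fun x => by
    rw [inner_self_eq_norm_sq_to_K]; norm_cast
  simp only [h2]
  rw [integral_complex_ofReal, Complex.ofReal_re]

/-- Dominated convergence for the squared norm, with majorant `C² |f|²`. The convergence is strong,
not in operator norm. -/
theorem tendsto_mulOp {m : ℕ → ℝ → ℂ} (hm : ∀ n, MemLp (m n) ∞ volume) {C : ℝ}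
    (hC : ∀ n x, ‖m n x - 1‖ ≤ C) (hlim : ∀ x, Tendsto (fun n => m n x) atTop (𝓝 1)) (f : L2) :
    Tendsto (fun n => mulOp (m n) f) atTop (𝓝 f) := by
  rw [tendsto_iff_norm_sub_tendsto_zero]
  have h1 : ∀ n, ‖mulOp (m n) f - f‖ ^ 2 = ∫ x, ‖(m n x - 1) * f x‖ ^ 2 := fun n => by
    rw [norm_sq_eq_integral]
    refine integral_congr_ae ?_
    filter_upwards [coeFn_mulOp (hm n) f, Lp.coeFn_sub (mulOp (m n) f) f] with x h2 h3
    rw [h3, Pi.sub_apply, h2, sub_mul, one_mul]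
  have h2 : Tendsto (fun n => ‖mulOp (m n) f - f‖ ^ 2) atTop (𝓝 0) := by
    simp only [h1]
    have h3 : Tendsto (fun n => ∫ x, ‖(m n x - 1) * f x‖ ^ 2) atTop (𝓝 (∫ _ : ℝ, (0 : ℝ))) := by
      refine tendsto_integral_of_dominated_convergence (fun x => C ^ 2 * ‖f x‖ ^ 2) (fun n => ?_)
        ?_ (fun n => ae_of_all _ fun x => ?_) (ae_of_all _ fun x => ?_)
      · exact ((((hm n).1.sub aestronglyMeasurable_const).mul (Lp.aestronglyMeasurable f)).norm).pow 2
      · exact ((memLp_two_iff_integrable_sq_norm (Lp.aestronglyMeasurable f)).1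
          (Lp.memLp f)).const_mul _
      · rw [Real.norm_of_nonneg (sq_nonneg _), norm_mul, mul_pow]
        gcongr
        exact hC n x
      · have := ((((hlim x).sub_const 1).mul_const (f x)).norm).pow 2
        simpa using this
    simpa using h3
  simpa [Real.sqrt_sq] using h2.sqrt

/-! ### The Fourier multipliers of the model -/

/-- The symbol of `-∂ₓ²`. -/
noncomputable def symb (ξ : ℝ) : ℝ := (2 * Real.pi * ξ) ^ 2

/-- The symbol of `(1 - ∂ₓ²)^{-1/2}`. -/
noncomputable def wt (ξ : ℝ) : ℝ := (√(1 + symb ξ))⁻¹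

open Classical in
/-- The indicator function of the frequencies at most `R`. -/
noncomputable def cut (R : ℕ) (ξ : ℝ) : ℝ := if |ξ| ≤ R then 1 else 0

theorem symb_nonneg (ξ : ℝ) : 0 ≤ symb ξ := sq_nonneg _

theorem wt_pos (ξ : ℝ) : 0 < wt ξ := by
  have := symb_nonneg ξ
  unfold wt; positivity

theorem wt_sq (ξ : ℝ) : wt ξ * wt ξ = (1 + symb ξ)⁻¹ := by
  have := symb_nonneg ξ
  rw [wt, ← mul_inv, Real.mul_self_sqrt (by positivity)]

theorem wt_sq_mul (ξ : ℝ) : wt ξ * wt ξ * (1 + symb ξ) = 1 := by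
  have := symb_nonneg ξ
  rw [wt_sq, inv_mul_cancel₀ (by positivity)]

theorem wt_le_one (ξ : ℝ) : wt ξ ≤ 1 := by
  have h1 := wt_sq_mul ξ
  have h2 := wt_pos ξ
  have h3 := symb_nonneg ξ
  by_contra! h
  nlinarith [mul_pos h2 h2, mul_nonneg (mul_pos h2 h2).le h3]

theorem cut_mul_cut {R S : ℕ} (h : R ≤ S) (ξ : ℝ) : cut R ξ * cut S ξ = cut R ξ := by
  unfold cut
  have : (R : ℝ) ≤ S := by exact_mod_cast h
  by_cases h1 : |ξ| ≤ R
  · rw [if_pos h1, if_pos (h1.trans this), one_mul]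
  · rw [if_neg h1, zero_mul]

theorem cut_nonneg (R : ℕ) (ξ : ℝ) : 0 ≤ cut R ξ := by
  unfold cut; split_ifs <;> norm_num

theorem cut_le_one (R : ℕ) (ξ : ℝ) : cut R ξ ≤ 1 := by
  unfold cut; split_ifs <;> norm_num

theorem symb_mul_cut_le (R : ℕ) (ξ : ℝ) : symb ξ * cut R ξ ≤ symb R := by
  unfold cut
  split_ifs with h
  · rw [mul_one, symb, symb, mul_pow, mul_pow _ (R : ℝ), ← sq_abs ξ]
    gcongr
  · rw [mul_zero]; exact symb_nonneg _

theorem measurable_symb : Measurable symb := by unfold symb; fun_prop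

theorem measurable_wt : Measurable wt := by unfold wt symb; fun_prop

theorem measurable_cut (R : ℕ) : Measurable (cut R) := by
  unfold cut
  exact Measurable.ite (measurableSet_le (by fun_prop) (by fun_prop)) measurable_const
    measurable_const

theorem memLp_top_ofReal {m : ℝ → ℝ} (hm : Measurable m) {C : ℝ} (h : ∀ x, |m x| ≤ C) :
    MemLp (fun x => (m x : ℂ)) ∞ volume :=
  memLp_top_of_bound (by fun_prop) C (ae_of_all _ fun x => by
    rw [Complex.norm_real]; exact h x)

theorem memLp_wt : MemLp (fun ξ => (wt ξ : ℂ)) ∞ volume :=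
  memLp_top_ofReal measurable_wt (C := 1) fun ξ => by
    rw [abs_of_pos (wt_pos ξ)]; exact wt_le_one ξ

theorem memLp_wt_sq : MemLp (fun ξ => ((wt ξ * wt ξ : ℝ) : ℂ)) ∞ volume :=
  memLp_top_ofReal (measurable_wt.mul measurable_wt) (C := 1) fun ξ => by
    rw [abs_of_nonneg (mul_self_nonneg _)]
    exact mul_le_one₀ (wt_le_one ξ) (wt_pos ξ).le (wt_le_one ξ)

theorem memLp_cut (R : ℕ) : MemLp (fun ξ => (cut R ξ : ℂ)) ∞ volume :=
  memLp_top_ofReal (measurable_cut R) (C := 1) fun ξ => by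
    rw [abs_of_nonneg (cut_nonneg R ξ)]; exact cut_le_one R ξ

theorem memLp_symb_cut (R : ℕ) : MemLp (fun ξ => ((symb ξ * cut R ξ : ℝ) : ℂ)) ∞ volume :=
  memLp_top_ofReal (measurable_symb.mul (measurable_cut R)) (C := symb R) fun ξ => by
    rw [abs_of_nonneg (mul_nonneg (symb_nonneg ξ) (cut_nonneg R ξ))]; exact symb_mul_cut_le R ξ

/-- The symbol of the truncated Schrödinger group. -/
noncomputable def groupSymb (R : ℕ) (t ξ : ℝ) : ℂ :=
  Complex.exp (((-(t * (symb ξ * cut R ξ)) : ℝ) : ℂ) * Complex.I)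

theorem norm_groupSymb (R : ℕ) (t ξ : ℝ) : ‖groupSymb R t ξ‖ = 1 :=
  Complex.norm_exp_ofReal_mul_I _

theorem measurable_groupSymb (R : ℕ) (t : ℝ) : Measurable (groupSymb R t) := by
  have := measurable_symb; have := measurable_cut R
  unfold groupSymb; fun_prop

theorem memLp_groupSymb (R : ℕ) (t : ℝ) : MemLp (groupSymb R t) ∞ volume :=
  memLp_top_of_bound (measurable_groupSymb R t).aestronglyMeasurable 1
    (ae_of_all _ fun ξ => (norm_groupSymb R t ξ).le)

/-- Integrability of `1/(1 + 4π²ξ²)` in one dimension is what makes point evaluation continuous on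
`H¹`. -/
theorem memLp_two_wt : MemLp (fun ξ => (wt ξ : ℂ)) 2 volume := by
  rw [memLp_two_iff_integrable_sq_norm]
  · have h1 : Integrable fun ξ : ℝ => (1 + (2 * Real.pi * ξ) ^ 2)⁻¹ :=
      integrable_inv_one_add_sq.comp_mul_left' (by positivity)
    refine h1.congr (ae_of_all _ fun ξ => ?_)
    simp only [Complex.norm_real, Real.norm_of_nonneg (wt_pos ξ).le]
    rw [pow_two (wt ξ), wt_sq, symb]
  · have := measurable_wt
    fun_prop

/-- The function `(1 + 4π²ξ²)^{-1/2}` as an element of `L²`. -/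
noncomputable def wtL2 : L2 := memLp_two_wt.toLp _

theorem hasDerivAt_mulOp_groupSymb (R : ℕ) (t : ℝ) :
    HasDerivAt (fun t => mulOp (groupSymb R t))
      (-Complex.I • (mulOp (groupSymb R t) ∘L mulOp (fun ξ => ((symb ξ * cut R ξ : ℝ) : ℂ)))) t := by
  have hp : 0 < symb R + 1 := by have := symb_nonneg R; linarith
  -- The truncated symbol is at most `symb R`. This `δ` keeps the exponent in the unit disc, where
  -- `exp y - 1 - y` is at most `‖y‖²`.
  refine hasDerivAt_clm_of_norm_le (δ := 1 / (symb R + 1)) (C := (symb R) ^ 2) (by positivity)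
    (by positivity) fun r hr x => ?_
  refine Lp.norm_le_mul_norm_of_ae_le_mul ?_
  filter_upwards [coeFn_mulOp (memLp_groupSymb R (t + r)) x, coeFn_mulOp (memLp_groupSymb R t) x,
    coeFn_mulOp (memLp_groupSymb R t) (mulOp (fun ξ => ((symb ξ * cut R ξ : ℝ) : ℂ)) x),
    coeFn_mulOp (memLp_symb_cut R) x,
    Lp.coeFn_sub (mulOp (groupSymb R (t + r)) x - mulOp (groupSymb R t) x)
      ((r : ℂ) • (-Complex.I • (mulOp (groupSymb R t) ∘L
        mulOp (fun ξ => ((symb ξ * cut R ξ : ℝ) : ℂ)))) x),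
    Lp.coeFn_sub (mulOp (groupSymb R (t + r)) x) (mulOp (groupSymb R t) x),
    Lp.coeFn_smul (r : ℂ) ((-Complex.I • (mulOp (groupSymb R t) ∘L
        mulOp (fun ξ => ((symb ξ * cut R ξ : ℝ) : ℂ)))) x),
    Lp.coeFn_smul (-Complex.I) (mulOp (groupSymb R t)
        (mulOp (fun ξ => ((symb ξ * cut R ξ : ℝ) : ℂ)) x))] with ξ h1 h2 h3 h4 h5 h6 h7 h8
  rw [h5, Pi.sub_apply, h6, Pi.sub_apply, h7, Pi.smul_apply, h1, h2]
  change ‖_ - _ - (r : ℂ) • ((-Complex.I • mulOp (groupSymb R t)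
        (mulOp (fun ξ => ((symb ξ * cut R ξ : ℝ) : ℂ)) x) : L2) ξ)‖ ≤ _
  rw [h8, Pi.smul_apply, h3, h4]
  set l : ℝ := symb ξ * cut R ξ with hl
  have hl0 : 0 ≤ l := mul_nonneg (symb_nonneg ξ) (cut_nonneg R ξ)
  have hlR : l ≤ symb R := symb_mul_cut_le R ξ
  set y : ℂ := ((-(r * l) : ℝ) : ℂ) * Complex.I with hy
  have e1 : groupSymb R (t + r) ξ = groupSymb R t ξ * Complex.exp y := by
    rw [groupSymb, groupSymb, ← Complex.exp_add, hy, hl]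
    congr 1
    push_cast
    ring
  have e2 : groupSymb R (t + r) ξ * x ξ - groupSymb R t ξ * x ξ -
      (r : ℂ) • (-Complex.I • (groupSymb R t ξ * ((l : ℂ) * x ξ))) =
      groupSymb R t ξ * ((Complex.exp y - 1 - y) * x ξ) := by
    rw [e1, hy, smul_eq_mul, smul_eq_mul]
    push_cast
    ring
  have hyn : ‖y‖ = |r| * l := by
    rw [hy, norm_mul, Complex.norm_I, mul_one, Complex.norm_real, Real.norm_eq_abs, abs_neg,
      abs_mul, abs_of_nonneg hl0]
  have hy1 : ‖y‖ ≤ 1 := by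
    rw [hyn]
    rw [le_div_iff₀ hp] at hr
    nlinarith [abs_nonneg r]
  rw [e2, norm_mul, norm_groupSymb, one_mul, norm_mul]
  refine mul_le_mul_of_nonneg_right ?_ (norm_nonneg _)
  refine (Complex.norm_exp_sub_one_sub_id_le hy1).trans ?_
  rw [hyn, mul_pow, sq_abs, mul_comm]
  gcongr

/-! ### The kernel of the truncated Schrödinger group -/

/-- Integration by parts against `m = i/(2cξ)`, for which `f' m = f`. The boundary terms and the
monotone remainder add up to exactly `1/(|c| a)`. -/
theorem norm_integral_exp_mul_sq_le {c a b : ℝ} (hc : c ≠ 0) (ha : 0 < a) (hab : a ≤ b) :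
    ‖∫ ξ in a..b, Complex.exp (((-(c * ξ ^ 2) : ℝ) : ℂ) * Complex.I)‖ ≤ 1 / (|c| * a) := by
  set f : ℝ → ℂ := fun ξ => Complex.exp (((-(c * ξ ^ 2) : ℝ) : ℂ) * Complex.I) with hf
  have hfn : ∀ ξ, ‖f ξ‖ = 1 := fun ξ => Complex.norm_exp_ofReal_mul_I _
  have hfc : Continuous f := by fun_prop
  have hpos : ∀ ξ ∈ uIcc a b, 0 < ξ := fun ξ hξ => by
    rw [uIcc_of_le hab] at hξ; exact ha.trans_le hξ.1
  have hfd : ∀ ξ, HasDerivAt f (f ξ * (-(2 * c * ξ) * Complex.I)) ξ := by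
    intro ξ
    have h1 : HasDerivAt (fun ξ : ℝ => -(c * ξ ^ 2)) (-(2 * c * ξ)) ξ := by
      refine (((hasDerivAt_pow 2 ξ).const_mul c).neg).congr_deriv ?_
      simp; ring
    have := ((h1.ofReal_comp.mul_const Complex.I)).cexp
    refine this.congr_deriv ?_
    simp [hf]
  set m : ℝ → ℂ := fun ξ => (((2 * c)⁻¹ * ξ⁻¹ : ℝ) : ℂ) * Complex.I with hm
  have hmd : ∀ ξ, 0 < ξ → HasDerivAt m ((((2 * c)⁻¹ * -(ξ ^ 2)⁻¹ : ℝ) : ℂ) * Complex.I) ξ :=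
    fun ξ hξ => (((hasDerivAt_inv hξ.ne').const_mul _).ofReal_comp).mul_const _
  have hmn : ∀ ξ, 0 < ξ → ‖m ξ‖ = (2 * |c|)⁻¹ * ξ⁻¹ := fun ξ hξ => by
    rw [hm, norm_mul, Complex.norm_I, mul_one, Complex.norm_real, Real.norm_eq_abs, abs_mul,
      abs_inv, abs_mul, abs_inv, abs_of_pos hξ, abs_two]
  have hcont : ContinuousOn (fun ξ : ℝ => (ξ ^ 2)⁻¹) (uIcc a b) :=
    ContinuousOn.inv₀ (by fun_prop) fun ξ hξ => (pow_pos (hpos ξ hξ) 2).ne'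
  set r : ℝ → ℂ := fun ξ => f ξ * ((((2 * c)⁻¹ * -(ξ ^ 2)⁻¹ : ℝ) : ℂ) * Complex.I) with hr
  have hrc : ContinuousOn r (uIcc a b) := by
    refine hfc.continuousOn.mul (ContinuousOn.mul ?_ continuousOn_const)
    exact Complex.continuous_ofReal.comp_continuousOn (continuousOn_const.mul hcont.neg)
  have hparts : ∫ ξ in a..b, (f ξ + r ξ) = f b * m b - f a * m a := by
    refine intervalIntegral.integral_eq_sub_of_hasDerivAt (f := fun ξ => f ξ * m ξ)
      (fun ξ hξ => ?_) (hfc.continuousOn.add hrc).intervalIntegrable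
    have hξ0 : (ξ : ℂ) ≠ 0 := by exact_mod_cast (hpos ξ hξ).ne'
    have hc0 : (c : ℂ) ≠ 0 := by exact_mod_cast hc
    refine ((hfd ξ).mul (hmd ξ (hpos ξ hξ))).congr_deriv ?_
    rw [hr, add_left_inj]
    simp only [hm]
    push_cast
    field_simp
    rw [Complex.I_sq]
    ring
  rw [intervalIntegral.integral_add (hfc.intervalIntegrable _ _) hrc.intervalIntegrable] at hparts
  have hrn : ‖∫ ξ in a..b, r ξ‖ ≤ (2 * |c|)⁻¹ * (a⁻¹ - b⁻¹) := by
    have h1 : ∫ ξ in a..b, (2 * |c|)⁻¹ * (ξ ^ 2)⁻¹ = (2 * |c|)⁻¹ * (a⁻¹ - b⁻¹) := by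
      rw [intervalIntegral.integral_const_mul]
      congr 1
      have := intervalIntegral.integral_eq_sub_of_hasDerivAt (a := a) (b := b)
        (f := fun ξ : ℝ => -ξ⁻¹) (f' := fun ξ => (ξ ^ 2)⁻¹)
        (fun ξ hξ => (hasDerivAt_inv (hpos ξ hξ).ne').neg.congr_deriv (neg_neg _)) hcont.intervalIntegrable
      rw [this]; ring
    rw [← h1]
    refine intervalIntegral.norm_integral_le_of_norm_le hab (ae_of_all _ fun ξ hξ => ?_)
      (continuousOn_const.mul hcont).intervalIntegrable
    have hξ0 : 0 < ξ := ha.trans hξ.1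
    rw [hr, norm_mul, hfn, one_mul, norm_mul, Complex.norm_I, mul_one, Complex.norm_real,
      Real.norm_eq_abs, abs_mul, abs_inv, abs_mul, abs_neg, abs_inv, abs_two,
      abs_of_pos (pow_pos hξ0 2)]
  have e1 : ∫ ξ in a..b, f ξ = f b * m b - f a * m a - ∫ ξ in a..b, r ξ := by
    rw [← hparts]; ring
  rw [e1]
  refine (norm_sub_le _ _).trans ((add_le_add (norm_sub_le _ _) hrn).trans ?_)
  rw [norm_mul (f b), norm_mul (f a), hfn, hfn, one_mul, one_mul, hmn a ha,
    hmn b (ha.trans_le hab)]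
  have : 0 < |c| := abs_pos.2 hc
  apply le_of_eq
  field_simp
  ring

/-- The trivial bound on `[0, a]` and the oscillatory bound beyond `a` balance at `a = |c|^{-1/2}`.
No dependence on `b` remains, which makes the kernel bound uniform in `R`. -/
theorem norm_integral_exp_mul_sq_le_rpow {c b : ℝ} (hc : c ≠ 0) (hb : 0 ≤ b) :
    ‖∫ ξ in (0 : ℝ)..b, Complex.exp (((-(c * ξ ^ 2) : ℝ) : ℂ) * Complex.I)‖ ≤
      2 * |c| ^ (-1 / 2 : ℝ) := by
  have hc0 : 0 < |c| := abs_pos.2 hc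
  set a : ℝ := |c| ^ (-1 / 2 : ℝ) with ha
  have ha0 : 0 < a := by positivity
  have hca : 1 / (|c| * a) = a := by
    rw [div_eq_iff (by positivity), ha, mul_left_comm, ← Real.rpow_add hc0]
    norm_num
    rw [Real.rpow_neg_one, mul_inv_cancel₀ hc0.ne']
  have htriv : ∀ b, 0 ≤ b →
      ‖∫ ξ in (0 : ℝ)..b, Complex.exp (((-(c * ξ ^ 2) : ℝ) : ℂ) * Complex.I)‖ ≤ b := by
    intro b hb
    have := intervalIntegral.norm_integral_le_of_norm_le_const (a := 0) (b := b) (C := 1)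
      (f := fun ξ : ℝ => Complex.exp (((-(c * ξ ^ 2) : ℝ) : ℂ) * Complex.I))
      (fun ξ _ => (Complex.norm_exp_ofReal_mul_I _).le)
    rwa [sub_zero, one_mul, abs_of_nonneg hb] at this
  rcases le_total b a with h | h
  · exact (htriv b hb).trans (by linarith)
  · have hcont : Continuous fun ξ : ℝ => Complex.exp (((-(c * ξ ^ 2) : ℝ) : ℂ) * Complex.I) := by
      fun_prop
    rw [← intervalIntegral.integral_add_adjacent_intervals (hcont.intervalIntegrable 0 a)
      (hcont.intervalIntegrable a b)]
    refine (norm_add_le _ _).trans ?_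
    have h1 := norm_integral_exp_mul_sq_le hc ha0 h
    rw [hca] at h1
    linarith [htriv a ha0.le]

/-- The two weights cancel against `1 + symb`, which leaves the plain truncated oscillatory
integral; evenness gives the factor `2`. -/
theorem inner_wtL2_mulOp_groupSymb (R : ℕ) (t : ℝ) :
    inner ℂ wtL2 (mulOp (groupSymb R t) (mulOp (fun ξ => (cut R ξ : ℂ)) wtL2 +
      mulOp (fun ξ => ((symb ξ * cut R ξ : ℝ) : ℂ)) wtL2)) =
    2 * ∫ ξ in (0 : ℝ)..R,
      Complex.exp (((-((t * (2 * Real.pi) ^ 2) * ξ ^ 2) : ℝ) : ℂ) * Complex.I) := by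
  set f : ℝ → ℂ :=
    fun ξ => Complex.exp (((-((t * (2 * Real.pi) ^ 2) * ξ ^ 2) : ℝ) : ℂ) * Complex.I) with hf
  have hR : (-R : ℝ) ≤ R := by have : (0 : ℝ) ≤ R := Nat.cast_nonneg R; linarith
  have h1 : inner ℂ wtL2 (mulOp (groupSymb R t) (mulOp (fun ξ => (cut R ξ : ℂ)) wtL2 +
      mulOp (fun ξ => ((symb ξ * cut R ξ : ℝ) : ℂ)) wtL2)) =
      ∫ ξ, (Icc (-R : ℝ) R).indicator f ξ := by
    rw [L2.inner_def]
    refine integral_congr_ae ?_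
    filter_upwards [coeFn_mulOp (memLp_groupSymb R t) (mulOp (fun ξ => (cut R ξ : ℂ)) wtL2 +
        mulOp (fun ξ => ((symb ξ * cut R ξ : ℝ) : ℂ)) wtL2), coeFn_mulOp (memLp_cut R) wtL2,
      coeFn_mulOp (memLp_symb_cut R) wtL2, memLp_two_wt.coeFn_toLp,
      Lp.coeFn_add (mulOp (fun ξ => (cut R ξ : ℂ)) wtL2)
        (mulOp (fun ξ => ((symb ξ * cut R ξ : ℝ) : ℂ)) wtL2)] with ξ h1 h2 h3 h4 h5
    rw [RCLike.inner_apply, h1, h5, Pi.add_apply, h2, h3, wtL2, h4, Complex.conj_ofReal]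
    have e1 : (wt ξ : ℂ) * wt ξ * (1 + symb ξ) = 1 := by exact_mod_cast wt_sq_mul ξ
    rw [indicator]
    by_cases h : |ξ| ≤ R
    · rw [if_pos (show ξ ∈ Icc (-R : ℝ) R from abs_le.1 h), hf, groupSymb, cut, if_pos h]
      have e2 : t * (symb ξ * 1) = t * (2 * Real.pi) ^ 2 * ξ ^ 2 := by rw [symb]; ring
      rw [e2]
      push_cast
      linear_combination (Complex.exp (-(↑t * (2 * ↑Real.pi) ^ 2 * ↑ξ ^ 2) * Complex.I)) * e1
    · rw [if_neg (show ξ ∉ Icc (-R : ℝ) R from fun h' => h (abs_le.2 h')), cut, if_neg h]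
      simp
  rw [h1, integral_indicator measurableSet_Icc, integral_Icc_eq_integral_Ioc,
    ← intervalIntegral.integral_of_le hR]
  have hfc : Continuous f := by fun_prop
  rw [← intervalIntegral.integral_add_adjacent_intervals (hfc.intervalIntegrable _ 0)
    (hfc.intervalIntegrable 0 _), two_mul]
  congr 1
  have := intervalIntegral.integral_comp_neg (a := -(R : ℝ)) (b := 0) f
  rw [neg_neg, neg_zero] at this
  rw [← this]
  simp [hf]

theorem kernel_bound : ∃ C : ℝ, 0 ≤ C ∧ ∀ (R : ℕ) (t : ℝ), t ≠ 0 →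
    ‖inner ℂ wtL2 (mulOp (groupSymb R t) (mulOp (fun ξ => (cut R ξ : ℂ)) wtL2 +
      mulOp (fun ξ => ((symb ξ * cut R ξ : ℝ) : ℂ)) wtL2))‖ ≤ C * |t| ^ (-1 / 2 : ℝ) := by
  refine ⟨4 * ((2 * Real.pi) ^ 2) ^ (-1 / 2 : ℝ), by positivity, fun R t ht => ?_⟩
  have hp : (2 * Real.pi) ^ 2 ≠ 0 := by positivity
  rw [inner_wtL2_mulOp_groupSymb, norm_mul, Complex.norm_two]
  have h := norm_integral_exp_mul_sq_le_rpow (mul_ne_zero ht hp) (Nat.cast_nonneg R)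
  rw [abs_mul, abs_of_pos (by positivity : 0 < (2 * Real.pi) ^ 2),
    Real.mul_rpow (abs_nonneg t) (by positivity)] at h
  linarith

/-! ### The concrete model -/

theorem conj_ofReal_mul_apply (m : ℝ → ℝ) (ξ : ℝ) : starRingEnd ℂ ((m ξ : ℝ) : ℂ) = (m ξ : ℂ) :=
  Complex.conj_ofReal _

theorem mulOp_wt_wt (x : L2) : mulOp (fun ξ => (wt ξ : ℂ)) (mulOp (fun ξ => (wt ξ : ℂ)) x) =
    mulOp (fun ξ => ((wt ξ * wt ξ : ℝ) : ℂ)) x :=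
  mulOp_mulOp memLp_wt memLp_wt memLp_wt_sq (fun ξ => by push_cast; rfl) x

theorem inner_mulOp_wt_sq (x y : L2) : inner ℂ x (mulOp (fun ξ => ((wt ξ * wt ξ : ℝ) : ℂ)) y) =
    inner ℂ (mulOp (fun ξ => (wt ξ : ℂ)) x) (mulOp (fun ξ => (wt ξ : ℂ)) y) := by
  rw [← mulOp_wt_wt, inner_mulOp_left memLp_wt memLp_wt (conj_ofReal_mul_apply wt)]

theorem norm_mulOp_wt_le (x : L2) : ‖mulOp (fun ξ => (wt ξ : ℂ)) x‖ ≤ ‖x‖ := by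
  have := norm_mulOp_le memLp_wt (C := 1) (fun ξ => by
    rw [Complex.norm_real, Real.norm_of_nonneg (wt_pos ξ).le]; exact wt_le_one ξ) x
  rwa [one_mul] at this

theorem re_inner_mulOp_wt_sq (x : L2) :
    (inner ℂ x (mulOp (fun ξ => ((wt ξ * wt ξ : ℝ) : ℂ)) x)).re =
      ‖mulOp (fun ξ => (wt ξ : ℂ)) x‖ ^ 2 := by
  rw [inner_mulOp_wt_sq]; exact Complex.re_inner_self _

theorem mulOp_cut_comm_wt_sq (R : ℕ) (x : L2) :
    mulOp (fun ξ => (cut R ξ : ℂ)) (mulOp (fun ξ => ((wt ξ * wt ξ : ℝ) : ℂ)) x) =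
      mulOp (fun ξ => ((wt ξ * wt ξ : ℝ) : ℂ)) (mulOp (fun ξ => (cut R ξ : ℂ)) x) := by
  refine Lp.ext ?_
  filter_upwards [coeFn_mulOp (memLp_cut R) (mulOp (fun ξ => ((wt ξ * wt ξ : ℝ) : ℂ)) x),
    coeFn_mulOp memLp_wt_sq x, coeFn_mulOp (memLp_cut R) x,
    coeFn_mulOp memLp_wt_sq (mulOp (fun ξ => (cut R ξ : ℂ)) x)] with ξ h1 h2 h3 h4
  rw [h1, h2, h4, h3, mul_left_comm]

/-- The Fourier transform of `H¹`, with the weight `(1 + 4π²ξ²)^{1/2}`. -/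
noncomputable def fourierModel : TruncatedModel L2 where
  P R := mulOp (fun ξ => (cut R ξ : ℂ))
  H R := mulOp (fun ξ => ((symb ξ * cut R ξ : ℝ) : ℂ))
  W R t := mulOp (groupSymb R t)
  a := mulOp (fun ξ => ((wt ξ * wt ξ : ℝ) : ℂ))
  g := wtL2
  inner_P R := inner_mulOp_left (memLp_cut R) (memLp_cut R) (conj_ofReal_mul_apply _)
  P_P {R S} h := mulOp_mulOp (memLp_cut R) (memLp_cut S) (memLp_cut R)
    fun ξ => by exact_mod_cast cut_mul_cut h ξ
  P_P' {R S} h := mulOp_mulOp (memLp_cut S) (memLp_cut R) (memLp_cut R)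
    fun ξ => by rw [mul_comm]; exact_mod_cast cut_mul_cut h ξ
  norm_P_le R x := by
    have := norm_mulOp_le (memLp_cut R) (C := 1) (fun ξ => by
      rw [Complex.norm_real, Real.norm_of_nonneg (cut_nonneg R ξ)]; exact cut_le_one R ξ) x
    rwa [one_mul] at this
  tendsto_P := by
    refine tendsto_mulOp memLp_cut (C := 1) (fun R ξ => ?_) fun ξ => ?_
    · rw [← Complex.ofReal_one, ← Complex.ofReal_sub, Complex.norm_real, Real.norm_eq_abs,
        abs_le]
      exact ⟨by linarith [cut_nonneg R ξ], by linarith [cut_le_one R ξ]⟩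
    · refine tendsto_const_nhds.congr' ?_
      filter_upwards [eventually_ge_atTop ⌈|ξ|⌉₊] with R hR
      rw [cut, if_pos ((Nat.le_ceil _).trans (by exact_mod_cast hR)), Complex.ofReal_one]
  H_P {R S} h := mulOp_mulOp (memLp_symb_cut R) (memLp_cut S) (memLp_symb_cut R)
    fun ξ => by rw [← Complex.ofReal_mul, mul_assoc, cut_mul_cut h]
  P_H {R S} h := mulOp_mulOp (memLp_cut R) (memLp_symb_cut S) (memLp_symb_cut R)
    fun ξ => by rw [← Complex.ofReal_mul, mul_left_comm, cut_mul_cut h]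
  inner_a := inner_mulOp_left memLp_wt_sq memLp_wt_sq (conj_ofReal_mul_apply fun ξ => wt ξ * wt ξ)
  norm_a_sq_le x := by
    rw [re_inner_mulOp_wt_sq, ← mulOp_wt_wt]
    gcongr
    exact norm_mulOp_wt_le _
  inner_a_le x := by
    rw [re_inner_mulOp_wt_sq]
    gcongr
    exact norm_mulOp_wt_le _
  P_a := mulOp_cut_comm_wt_sq
  a_H R x := by
    rw [eq_sub_iff_add_eq, mulOp_mulOp memLp_wt_sq (memLp_symb_cut R)
        ((memLp_symb_cut R).mul memLp_wt_sq) (fun _ => rfl),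
      mulOp_mulOp memLp_wt_sq (memLp_cut R) ((memLp_cut R).mul memLp_wt_sq) (fun _ => rfl)]
    refine mulOp_add ((memLp_symb_cut R).mul memLp_wt_sq) ((memLp_cut R).mul memLp_wt_sq)
      (memLp_cut R) (fun ξ => ?_) x
    have e1 := wt_sq_mul ξ
    simp only [Pi.mul_apply]
    norm_cast
    linear_combination cut R ξ * e1
  W_zero R := by
    ext1 x
    refine Lp.ext ?_
    filter_upwards [coeFn_mulOp (memLp_groupSymb R 0) x] with ξ h
    rw [h, groupSymb]
    simp
  norm_W_le R t x := by
    have := norm_mulOp_le (memLp_groupSymb R t) (C := 1) (fun ξ => (norm_groupSymb R t ξ).le) x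
    rwa [one_mul] at this
  hasDerivAt_W := hasDerivAt_mulOp_groupSymb
  kernel_le := kernel_bound

/-! ### The Fourier representation of `H¹(ℝ)` -/

open scoped FourierTransform LineDeriv in
theorem derivCLM_eq_lineDerivOp (T : 𝓢'(ℝ, ℂ)) :
    TemperedDistribution.derivCLM ℂ T = ∂_{(1 : ℝ)} T := by
  ext g
  rw [TemperedDistribution.derivCLM_apply_apply, TemperedDistribution.lineDerivOp_apply_apply]
  congr 2

/-- The `L²` Fourier transform. -/
noncomputable def fourierL2 : L2 ≃ₗᵢ[ℂ] L2 := Lp.fourierTransformₗᵢ ℝ ℂ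

/-- The symbol of `∂ₓ`. -/
noncomputable def dsymb (ξ : ℝ) : ℂ := 2 * Real.pi * Complex.I * ξ

theorem norm_dsymb_sq (ξ : ℝ) : ‖dsymb ξ‖ ^ 2 = symb ξ := by
  rw [dsymb, symb]
  simp [mul_pow, abs_of_pos Real.pi_pos]

open scoped FourierTransform LineDeriv in
theorem fourier_derivCLM_apply (p : L2) (η : 𝓢(ℝ, ℂ)) :
    (𝓕 (TemperedDistribution.derivCLM ℂ (Lp.toTemperedDistribution p)) : 𝓢'(ℝ, ℂ)) η =
      ∫ ξ, η ξ * (dsymb ξ * fourierL2 p ξ) := by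
  have hg : (fun ξ : ℝ => ((inner ℝ ξ (1 : ℝ) : ℝ) : ℂ)).HasTemperateGrowth := by fun_prop
  rw [derivCLM_eq_lineDerivOp, TemperedDistribution.fourier_lineDerivOp_eq,
    Lp.fourier_toTemperedDistribution_eq]
  change (2 * (Real.pi : ℂ) * Complex.I) • (TemperedDistribution.smulLeftCLM ℂ
    (fun ξ : ℝ => ((inner ℝ ξ (1 : ℝ) : ℝ) : ℂ)) (Lp.toTemperedDistribution (𝓕 p : L2))) η = _
  rw [TemperedDistribution.smulLeftCLM_apply_apply, Lp.toTemperedDistribution_apply, smul_eq_mul,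
    ← integral_const_mul]
  refine integral_congr_ae (ae_of_all _ fun ξ => ?_)
  simp only
  rw [SchwartzMap.smulLeftCLM_apply_apply hg]
  have h1 : (𝓕 p : L2) = fourierL2 p := rfl
  have h2 : (inner ℝ ξ (1 : ℝ) : ℝ) = ξ := by simp
  rw [h1, h2, dsymb, smul_eq_mul, smul_eq_mul]
  ring

open scoped FourierTransform in
-- The Fourier transform turns the distributional derivative into multiplication by `2πiξ`. The
-- product need not be square integrable a priori, so it is identified as a locally integrable
-- function by testing.
theorem derivCLM_eq_iff (p r : L2) :
    TemperedDistribution.derivCLM ℂ (Lp.toTemperedDistributionCLM ℂ volume 2 p) =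
      Lp.toTemperedDistributionCLM ℂ volume 2 r ↔
    fourierL2 r =ᵐ[volume] fun ξ => dsymb ξ * fourierL2 p ξ := by
  simp only [Lp.toTemperedDistributionCLM_apply]
  have hr : ∀ η : 𝓢(ℝ, ℂ), (𝓕 (Lp.toTemperedDistribution r) : 𝓢'(ℝ, ℂ)) η =
      ∫ ξ, η ξ * fourierL2 r ξ := by
    intro η
    rw [Lp.fourier_toTemperedDistribution_eq, Lp.toTemperedDistribution_apply]
    rfl
  constructor
  · intro h
    have hd : Continuous dsymb := by unfold dsymb; fun_prop
    have h1 : LocallyIntegrable (fourierL2 r : ℝ → ℂ) :=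
      (Lp.memLp (fourierL2 r)).locallyIntegrable (by norm_num)
    have h2 : LocallyIntegrable (fun ξ => dsymb ξ * fourierL2 p ξ) :=
      ((Lp.memLp (fourierL2 p)).locallyIntegrable (by norm_num)).continuous_smul hd
    refine ae_eq_of_integral_contDiff_smul_eq h1 h2 fun χ hχ hχc => ?_
    have hχ' : ContDiff ℝ ∞ (fun x => (χ x : ℂ)) := Complex.ofRealCLM.contDiff.comp hχ
    have hχc' : HasCompactSupport (fun x => (χ x : ℂ)) := hχc.comp_left Complex.ofReal_zero
    have h3 := hr (hχc'.toSchwartzMap hχ')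
    rw [← h, fourier_derivCLM_apply] at h3
    simp only [Complex.real_smul]
    exact h3.symm
  · intro h
    have h1 : (𝓕 (TemperedDistribution.derivCLM ℂ (Lp.toTemperedDistribution p)) : 𝓢'(ℝ, ℂ)) =
        𝓕 (Lp.toTemperedDistribution r) := by
      ext η
      rw [hr, fourier_derivCLM_apply]
      refine integral_congr_ae ?_
      filter_upwards [h] with ξ hξ
      rw [hξ]
    have h2 := congrArg (fun T : 𝓢'(ℝ, ℂ) => (𝓕⁻ T : 𝓢'(ℝ, ℂ))) h1
    simpa only [FourierTransform.fourierInv_fourier_eq] using h2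

/-- The symbol of `∂ₓ (1 - ∂ₓ²)^{-1/2}`. -/
noncomputable def dwt (ξ : ℝ) : ℂ := dsymb ξ * wt ξ

theorem norm_dwt_sq (ξ : ℝ) : ‖dwt ξ‖ ^ 2 = 1 - wt ξ ^ 2 := by
  rw [dwt, norm_mul, mul_pow, norm_dsymb_sq, Complex.norm_real, Real.norm_eq_abs, sq_abs]
  linear_combination wt_sq_mul ξ

theorem norm_dwt_le_one (ξ : ℝ) : ‖dwt ξ‖ ≤ 1 := by
  have h1 := norm_dwt_sq ξ
  have h2 := sq_nonneg (wt ξ)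
  exact (sq_le_one_iff₀ (norm_nonneg _)).1 (by linarith)

theorem memLp_dwt : MemLp dwt ∞ volume := by
  refine memLp_top_of_bound ?_ 1 (ae_of_all _ norm_dwt_le_one)
  have := measurable_wt
  unfold dwt dsymb
  fun_prop

theorem conj_dwt_mul_dwt (ξ : ℝ) :
    starRingEnd ℂ (dwt ξ) * dwt ξ + ((wt ξ * wt ξ : ℝ) : ℂ) = 1 := by
  rw [mul_comm, Complex.mul_conj, Complex.normSq_eq_norm_sq, norm_dwt_sq]
  push_cast
  ring

/-- The derivative part of the `H¹` product complements the `L²` part because `|dwt|² + wt² = 1`. -/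
theorem inner_mulOp_dwt (x y : L2) : inner ℂ (mulOp dwt x) (mulOp dwt y) =
    inner ℂ x (y - fourierModel.a y) := by
  have hc : MemLp (fun ξ => starRingEnd ℂ (dwt ξ)) ∞ volume := memLp_dwt.star
  rw [inner_mulOp_left memLp_dwt hc (fun _ => rfl), eq_comm]
  congr 1
  rw [sub_eq_iff_eq_add, mulOp_mulOp hc memLp_dwt (memLp_dwt.mul hc) (fun _ => rfl)]
  refine Lp.ext ?_
  change _ =ᵐ[volume] (mulOp _ y + mulOp (fun ξ => ((wt ξ * wt ξ : ℝ) : ℂ)) y : L2)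
  filter_upwards [coeFn_mulOp (memLp_dwt.mul hc) y, coeFn_mulOp memLp_wt_sq y,
    Lp.coeFn_add (mulOp ((fun ξ => starRingEnd ℂ (dwt ξ)) * dwt) y)
      (mulOp (fun ξ => ((wt ξ * wt ξ : ℝ) : ℂ)) y)] with ξ h1 h2 h3
  rw [h3, Pi.add_apply, h1, h2, ← add_mul, Pi.mul_apply, conj_dwt_mul_dwt, one_mul]

theorem inner_mulOp_wt (x y : L2) :
    inner ℂ (mulOp (fun ξ => (wt ξ : ℂ)) x) (mulOp (fun ξ => (wt ξ : ℂ)) y) =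
      inner ℂ x (fourierModel.a y) := (inner_mulOp_wt_sq x y).symm

/-- The element of `H¹` with Fourier transform `(1 + 4π²ξ²)^{-1/2} x(ξ)`. -/
noncomputable def ofFourierFun (x : L2) : SobolevH1 :=
  ⟨WithLp.toLp 2 (fourierL2.symm (mulOp (fun ξ => (wt ξ : ℂ)) x), fourierL2.symm (mulOp dwt x)), by
    refine (derivCLM_eq_iff _ _).2 ?_
    change fourierL2 (fourierL2.symm _) =ᵐ[volume] fun ξ => dsymb ξ * fourierL2 (fourierL2.symm _) ξ
    rw [LinearIsometryEquiv.apply_symm_apply, LinearIsometryEquiv.apply_symm_apply]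
    filter_upwards [coeFn_mulOp memLp_wt x, coeFn_mulOp memLp_dwt x] with ξ h1 h2
    rw [h1, h2, dwt, mul_assoc]⟩

theorem toL2_ofFourierFun (x : L2) :
    (ofFourierFun x).toL2 = fourierL2.symm (mulOp (fun ξ => (wt ξ : ℂ)) x) := rfl

theorem derivL2_ofFourierFun (x : L2) :
    (ofFourierFun x).derivL2 = fourierL2.symm (mulOp dwt x) := rfl

theorem inner_toL2_ofFourierFun (x y : L2) :
    inner ℂ (ofFourierFun x).toL2 (ofFourierFun y).toL2 = inner ℂ x (fourierModel.a y) := by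
  rw [toL2_ofFourierFun, toL2_ofFourierFun, LinearIsometryEquiv.inner_map_map, inner_mulOp_wt]

theorem inner_derivL2_ofFourierFun (x y : L2) :
    inner ℂ (ofFourierFun x).derivL2 (ofFourierFun y).derivL2 =
      inner ℂ x (y - fourierModel.a y) := by
  rw [derivL2_ofFourierFun, derivL2_ofFourierFun, LinearIsometryEquiv.inner_map_map,
    inner_mulOp_dwt]

theorem norm_sq_toL2_ofFourierFun (x : L2) :
    ‖(ofFourierFun x).toL2‖ ^ 2 = fourierModel.q x := by
  rw [← Complex.re_inner_self, inner_toL2_ofFourierFun, TruncatedModel.q]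

theorem norm_sq_derivL2_ofFourierFun (x : L2) :
    ‖(ofFourierFun x).derivL2‖ ^ 2 = fourierModel.k x := by
  rw [← Complex.re_inner_self, inner_derivL2_ofFourierFun, inner_sub_right, Complex.sub_re,
    Complex.re_inner_self, TruncatedModel.k, TruncatedModel.q]

theorem SobolevH1.norm_sq_eq (f : SobolevH1) : ‖f‖ ^ 2 = ‖f.toL2‖ ^ 2 + ‖f.derivL2‖ ^ 2 :=
  WithLp.prod_norm_sq_eq_of_L2 f.1

/-- The inverse of the weighted Fourier transform, as a linear isometry. -/
noncomputable def ofFourier : L2 →ₗᵢ[ℂ] SobolevH1 where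
  toFun := ofFourierFun
  map_add' x y := by
    refine Subtype.ext ((WithLp.equiv 2 _).injective (Prod.ext ?_ ?_))
    · change fourierL2.symm _ = fourierL2.symm _ + fourierL2.symm _
      rw [map_add, map_add]
    · change fourierL2.symm _ = fourierL2.symm _ + fourierL2.symm _
      rw [map_add, map_add]
  map_smul' c x := by
    refine Subtype.ext ((WithLp.equiv 2 _).injective (Prod.ext ?_ ?_))
    · change fourierL2.symm _ = c • fourierL2.symm _
      rw [map_smul, map_smul]
    · change fourierL2.symm _ = c • fourierL2.symm _
      rw [map_smul, map_smul]
  norm_map' x := by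
    have h : ‖ofFourierFun x‖ ^ 2 = ‖x‖ ^ 2 := by
      rw [SobolevH1.norm_sq_eq, norm_sq_toL2_ofFourierFun, norm_sq_derivL2_ofFourierFun,
        TruncatedModel.k]
      ring
    exact (sq_eq_sq₀ (norm_nonneg _) (norm_nonneg _)).1 h

theorem ofFourier_surjective : Function.Surjective ofFourier := by
  intro f
  have hc : MemLp (fun ξ => starRingEnd ℂ (dwt ξ)) ∞ volume := memLp_dwt.star
  have hf := (derivCLM_eq_iff _ _).1 f.2
  -- Formally this is `(1 + 4π²ξ²)^{1/2} f̂`, written with bounded multipliers of `f̂` and of the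
  -- transform of `f'` so that it visibly lies in `L²`.
  refine ⟨mulOp (fun ξ => (wt ξ : ℂ)) (fourierL2 f.toL2) +
    mulOp (fun ξ => starRingEnd ℂ (dwt ξ)) (fourierL2 f.derivL2), ?_⟩
  set x : L2 := mulOp (fun ξ => (wt ξ : ℂ)) (fourierL2 f.toL2) +
    mulOp (fun ξ => starRingEnd ℂ (dwt ξ)) (fourierL2 f.derivL2) with hx
  have hxae : ∀ᵐ ξ, (wt ξ : ℂ) * x ξ = fourierL2 f.toL2 ξ := by
    filter_upwards [hf, Lp.coeFn_add (mulOp (fun ξ => (wt ξ : ℂ)) (fourierL2 f.toL2))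
      (mulOp (fun ξ => starRingEnd ℂ (dwt ξ)) (fourierL2 f.derivL2)),
      coeFn_mulOp memLp_wt (fourierL2 f.toL2), coeFn_mulOp hc (fourierL2 f.derivL2)]
      with ξ h1 h2 h3 h4
    change fourierL2 f.derivL2 ξ = dsymb ξ * fourierL2 f.toL2 ξ at h1
    rw [hx, h2, Pi.add_apply, h3, h4, h1]
    have h5 := conj_dwt_mul_dwt ξ
    rw [dwt] at h5 ⊢
    push_cast at h5
    linear_combination fourierL2 f.toL2 ξ * h5
  refine Subtype.ext ((WithLp.equiv 2 _).injective (Prod.ext ?_ ?_))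
  · change fourierL2.symm _ = f.toL2
    rw [LinearIsometryEquiv.symm_apply_eq]
    refine Lp.ext ?_
    filter_upwards [coeFn_mulOp memLp_wt x, hxae] with ξ h1 h2
    rw [h1, h2]
  · change fourierL2.symm _ = f.derivL2
    rw [LinearIsometryEquiv.symm_apply_eq]
    refine Lp.ext ?_
    filter_upwards [coeFn_mulOp memLp_dwt x, hxae, hf] with ξ h1 h2 h3
    change fourierL2 f.derivL2 ξ = dsymb ξ * fourierL2 f.toL2 ξ at h3
    rw [h1, h3, ← h2, dwt, mul_assoc]

/-- The weighted Fourier transform from `H¹` to `L²`. -/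
noncomputable def toFourier : SobolevH1 ≃ₗᵢ[ℂ] L2 :=
  (LinearIsometryEquiv.ofSurjective ofFourier ofFourier_surjective).symm

theorem ofFourierFun_toFourier (f : SobolevH1) : ofFourierFun (toFourier f) = f :=
  (LinearIsometryEquiv.ofSurjective ofFourier ofFourier_surjective).apply_symm_apply f

theorem inner_toL2 (f h : SobolevH1) :
    inner ℂ f.toL2 h.toL2 = inner ℂ (toFourier f) (fourierModel.a (toFourier h)) := by
  rw [← inner_toL2_ofFourierFun, ofFourierFun_toFourier, ofFourierFun_toFourier]

theorem inner_derivL2 (f h : SobolevH1) : inner ℂ f.derivL2 h.derivL2 =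
    inner ℂ (toFourier f) (toFourier h - fourierModel.a (toFourier h)) := by
  rw [← inner_derivL2_ofFourierFun, ofFourierFun_toFourier, ofFourierFun_toFourier]

theorem charge_eq (f : SobolevH1) : f.charge = (1 / 2) * fourierModel.q (toFourier f) := by
  rw [SobolevH1.charge, ← norm_sq_eq_integral, ← norm_sq_toL2_ofFourierFun, ofFourierFun_toFourier]

open scoped FourierTransform in
-- A product of two `L²` functions is integrable, so the inverse Fourier integral is continuous. It
-- agrees almost everywhere with the `L²` transform, hence is the continuous representative; at the
-- origin it is the pairing with the weight.
theorem rep_ofFourierFun_zero (x : L2) : (ofFourierFun x).rep 0 = fourierModel.tr x := by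
  set y : L2 := mulOp (fun ξ => (wt ξ : ℂ)) x with hy
  have hyae : y =ᵐ[volume] fun ξ => (wt ξ : ℂ) * x ξ := coeFn_mulOp memLp_wt x
  have hyi : Integrable y := (memLp_two_wt.integrable_mul (Lp.memLp x)).congr hyae.symm
  have hcont : Continuous (𝓕⁻ (y : ℝ → ℂ)) := by
    exact VectorFourier.fourierIntegral_continuous Real.continuous_fourierChar
      (L := -innerₗ ℝ) continuous_inner.neg hyi
  have hae : (ofFourierFun x).toL2 =ᵐ[volume] 𝓕⁻ (y : ℝ → ℂ) := by
    have h1 : LocallyIntegrable ((ofFourierFun x).toL2 : ℝ → ℂ) :=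
      (Lp.memLp (ofFourierFun x).toL2).locallyIntegrable (by norm_num)
    refine ae_eq_of_integral_contDiff_smul_eq h1 hcont.locallyIntegrable fun χ hχ hχc => ?_
    have hχ' : ContDiff ℝ ∞ (fun x => (χ x : ℂ)) := Complex.ofRealCLM.contDiff.comp hχ
    have hχc' : HasCompactSupport (fun x => (χ x : ℂ)) := hχc.comp_left Complex.ofReal_zero
    set η : 𝓢(ℝ, ℂ) := hχc'.toSchwartzMap hχ' with hη
    have h2 : (𝓕⁻ (Lp.toTemperedDistribution y) : 𝓢'(ℝ, ℂ)) η =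
        Lp.toTemperedDistribution ((ofFourierFun x).toL2) η := by
      rw [Lp.fourierInv_toTemperedDistribution_eq]; rfl
    rw [TemperedDistribution.fourierInv_apply, Lp.toTemperedDistribution_apply,
      Lp.toTemperedDistribution_apply, SchwartzMap.fourierInv_coe] at h2
    have h3 : ∫ ξ, 𝓕⁻ (η : ℝ → ℂ) ξ • (y : ℝ → ℂ) ξ = ∫ ξ, η ξ • 𝓕⁻ (y : ℝ → ℂ) ξ := by
      have h4 := VectorFourier.integral_fourierIntegral_smul_eq_flip (L := -innerₗ ℝ)
        Real.continuous_fourierChar continuous_inner.neg (η.integrable (μ := volume)) hyi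
      have h5 : (-innerₗ ℝ).flip = -innerₗ ℝ := by ext; simp
      rw [h5] at h4
      exact h4
    simp only [Complex.real_smul]
    exact h2.symm.trans h3
  have heq : (ofFourierFun x).rep = 𝓕⁻ (y : ℝ → ℂ) :=
    ((ofFourierFun x).continuous_rep.ae_eq_iff_eq volume hcont).1
      ((ofFourierFun x).toL2_ae_eq_rep.symm.trans hae)
  rw [heq, Real.fourierInv_eq, TruncatedModel.tr, L2.inner_def]
  refine integral_congr_ae ?_
  filter_upwards [hyae, memLp_two_wt.coeFn_toLp] with ξ h1 h2
  rw [h1, RCLike.inner_apply]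
  change _ = x ξ * starRingEnd ℂ (wtL2 ξ)
  rw [wtL2, h2, Complex.conj_ofReal]
  simp [mul_comm]

theorem rep_zero_eq (f : SobolevH1) : f.rep 0 = fourierModel.tr (toFourier f) := by
  rw [← rep_ofFourierFun_zero, ofFourierFun_toFourier]

theorem energy_eq (U : ℂ → ℝ) (f : SobolevH1) :
    f.energy U = fourierModel.en U (toFourier f) := by
  rw [SobolevH1.energy, TruncatedModel.en, rep_zero_eq, integral_div, ← norm_sq_eq_integral,
    ← norm_sq_derivL2_ofFourierFun, ofFourierFun_toFourier]

/-! ### The untruncated evolution equation -/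

namespace TruncatedModel

variable {X : Type*} [NormedAddCommGroup X] [InnerProductSpace ℂ X] (M : TruncatedModel X)

/-- If `a x = 0` then `P R x = a (H R x)`, so by symmetry `‖P R x‖² = ⟪a (P R x), H R x⟫ = 0`. -/
theorem eq_zero_of_a {x : X} (h : M.a x = 0) : x = 0 := by
  refine M.ext_of_P fun R => ?_
  have h1 : M.a (M.H R x) = M.P R x := by rw [M.a_H, ← M.P_a, h, map_zero, sub_zero]
  have h2 : M.a (M.P R x) = 0 := by rw [← M.P_a, h, map_zero]
  have h3 : inner ℂ (M.P R x) (M.P R x) = (0 : ℂ) := by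
    nth_rw 2 [← h1]
    rw [← M.inner_a, h2, inner_zero_left]
  rw [inner_self_eq_zero.1 h3, map_zero]

/-- `P R + H R` is the truncation of `1 - ∂ₓ²`, hence inverts `a` on low frequencies. -/
theorem P_a_add_H_a (R : ℕ) (x : X) : M.P R (M.a x) + M.H R (M.a x) = M.P R x := by
  refine sub_eq_zero.1 (M.eq_zero_of_a ?_)
  rw [map_sub, map_add, M.a_H, M.P_a]
  abel

/-- The velocity `-i (w - a w) + i F(w(0)) g` of the untruncated equation. -/
noncomputable def velocity (F : ℂ → ℂ) (x : X) : X :=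
  -(Complex.I • (x - M.a x)) + (Complex.I * F (M.tr x)) • M.g

theorem continuous_velocity {F : ℂ → ℂ} (hF : Continuous F) : Continuous (M.velocity F) := by
  have := M.continuous_tr
  unfold velocity
  fun_prop

/-- Applying `a` regularizes the equation by two derivatives: the point mass becomes the vector `g`,
and the full velocity makes sense in `X`. -/
theorem a_velocity_truncated (F : ℂ → ℂ) (R : ℕ) (x : X) :
    M.a (-(Complex.I • M.H R x) + (Complex.I * F (M.tr x)) • M.e R) =
      M.P R (M.velocity F x) := by
  rw [velocity, map_add, map_add, map_neg, map_neg, map_smul, map_smul, map_smul, map_smul,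
    M.a_H, M.a_e, map_sub, M.P_a]

/-- Solutions of all truncated equations solve the untruncated equation. -/
theorem hasDerivAt_of_solves [CompleteSpace X] {F : ℂ → ℂ} (hF : Continuous F) {w : ℝ → X}
    (hw : Continuous w) (h : ∀ R, M.Solves F R w) (t : ℝ) :
    HasDerivAt (fun t => M.a (w t)) (M.velocity F (w t)) t := by
  have hV : Continuous fun t => M.velocity F (w t) := (M.continuous_velocity hF).comp hw
  have hI : ∀ t, HasDerivAt (fun t => ∫ s in (0 : ℝ)..t, M.velocity F (w s))
      (M.velocity F (w t)) t := fun t => hV.integral_hasStrictDerivAt 0 t |>.hasDerivAt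
  -- Each truncation of this difference has zero derivative, and the truncations separate points.
  have hconst : ∀ t, M.a (w t) - ∫ s in (0 : ℝ)..t, M.velocity F (w s) = M.a (w 0) := by
    intro t
    refine M.ext_of_P fun R => ?_
    have hd : ∀ t, HasDerivAt
        (fun t => M.P R (M.a (w t) - ∫ s in (0 : ℝ)..t, M.velocity F (w s))) 0 t := by
      intro t
      have h1 := (h R t).complexCLM M.a
      rw [M.a_velocity_truncated] at h1
      have h2 := h1.sub ((hI t).complexCLM (M.P R))
      rw [sub_self] at h2
      refine h2.congr_of_eventuallyEq (Eventually.of_forall fun s => ?_)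
      simp only [map_sub, M.P_a, Pi.sub_apply]
    have h3 := is_const_of_deriv_eq_zero (fun t => (hd t).differentiableAt)
      (fun t => (hd t).deriv) t 0
    simpa using h3
  have h4 : (fun t => M.a (w t)) = fun t => M.a (w 0) + ∫ s in (0 : ℝ)..t, M.velocity F (w s) :=
    funext fun t => by rw [← hconst t]; abel
  rw [h4]
  exact (hI t).const_add _

/-- Solutions of the untruncated equation solve all truncated equations. -/
theorem solves_of_hasDerivAt {F : ℂ → ℂ} {w : ℝ → X}
    (h : ∀ t, HasDerivAt (fun t => M.a (w t)) (M.velocity F (w t)) t) (R : ℕ) :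
    M.Solves F R w := by
  intro t
  have h1 := (h t).complexCLM (M.P R + M.H R)
  have h2 : (M.P R + M.H R) (M.velocity F (w t)) =
      -(Complex.I • M.H R (w t)) + (Complex.I * F (M.tr (w t))) • M.e R := by
    have h3 : (M.P R + M.H R) (w t - M.a (w t)) = M.H R (w t) := by
      rw [map_sub, _root_.add_apply, _root_.add_apply, M.P_a_add_H_a]
      abel
    rw [velocity, map_add, map_neg, map_smul, map_smul, h3]
    rfl
  rw [h2] at h1
  refine h1.congr_of_eventuallyEq (Eventually.of_forall fun s => ?_)
  exact (M.P_a_add_H_a R (w s)).symm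

end TruncatedModel

/-- A continuous function with vanishing distributional derivative is constant. -/
theorem eq_of_integral_deriv_mul_eq_zero {f : ℝ → ℂ} (hf : Continuous f)
    (h : ∀ η : ℝ → ℝ, ContDiff ℝ ∞ η → HasCompactSupport η → ∫ t, deriv η t • f t = 0)
    (s t : ℝ) : f s = f t := by
  let φ : ℕ → ContDiffBump (0 : ℝ) := fun n =>
    ⟨1 / ((n : ℝ) + 1) / 2, 1 / ((n : ℝ) + 1), by positivity, half_lt_self (by positivity)⟩
  have hφ : Tendsto (fun n => (φ n).rOut) atTop (𝓝 0) := tendsto_one_div_add_atTop_nhds_zero_nat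
  have hlim := ContDiffBump.convolution_tendsto_right_of_continuous (μ := volume) hφ hf
  refine tendsto_nhds_unique (hlim s) ((hlim t).congr fun n => ?_)
  set r : ℝ → ℝ := (φ n).normed volume with hr
  have hrs : ContDiff ℝ ∞ r := (φ n).contDiff_normed
  have hrc : HasCompactSupport r := (φ n).hasCompactSupport_normed
  -- Mollify: the derivative of the convolution is, up to sign, the hypothesis tested with the
  -- reflected bump `t ↦ r (x - t)`. So every mollification is constant, and these converge
  -- pointwise to `f`.
  have hd : ∀ x, HasDerivAt (convolution r f (ContinuousLinearMap.lsmul ℝ ℝ) volume) 0 x := by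
    intro x
    have h1 := hrc.hasDerivAt_convolution_left (ContinuousLinearMap.lsmul ℝ ℝ)
      (hrs.of_le (by exact_mod_cast le_top)) (hf.locallyIntegrable (μ := volume)) x
    refine h1.congr_deriv ?_
    have h2 := h (fun t => r (x - t)) (hrs.comp (contDiff_const.sub contDiff_id))
      (hrc.comp_homeomorph (Homeomorph.subLeft x))
    have h3 : ∀ t, deriv (fun t => r (x - t)) t = -deriv r (x - t) := fun t =>
      deriv_comp_const_sub _ _ _
    simp only [h3, neg_smul, integral_neg, neg_eq_zero] at h2
    rw [convolution_def, ← h2]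
    have h4 := integral_sub_left_eq_self (fun t => deriv r (x - t) • f t) volume x
    simp only [sub_sub_cancel] at h4
    exact h4
  exact is_const_of_deriv_eq_zero (fun t => (hd t).differentiableAt) (fun t => (hd t).deriv) t s

/-! ### Test functions in `H¹` -/

/-- The element of `H¹` with given function and given distributional derivative. -/
noncomputable def SobolevH1.mk (p r : L2)
    (h : TemperedDistribution.derivCLM ℂ (Lp.toTemperedDistributionCLM ℂ volume 2 p) =
      Lp.toTemperedDistributionCLM ℂ volume 2 r) : SobolevH1 :=
  ⟨WithLp.toLp 2 (p, r), h⟩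

/-- The class in `L²` of a Schwartz function. -/
noncomputable def schwartzL2 (χ : 𝓢(ℝ, ℂ)) : L2 := χ.toLp 2

theorem coeFn_schwartzL2 (χ : 𝓢(ℝ, ℂ)) : schwartzL2 χ =ᵐ[volume] χ := χ.coeFn_toLp 2 volume

theorem derivCLM_schwartzL2 (χ : 𝓢(ℝ, ℂ)) :
    TemperedDistribution.derivCLM ℂ (Lp.toTemperedDistributionCLM ℂ volume 2 (schwartzL2 χ)) =
      Lp.toTemperedDistributionCLM ℂ volume 2 (schwartzL2 (SchwartzMap.derivCLM ℂ ℂ χ)) := by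
  rw [Lp.toTemperedDistributionCLM_apply, Lp.toTemperedDistributionCLM_apply, schwartzL2,
    schwartzL2, Lp.toTemperedDistribution_toLp_eq, Lp.toTemperedDistribution_toLp_eq]
  exact TemperedDistribution.derivCLM_toTemperedDistributionCLM_eq (𝕜 := ℂ) χ

/-- A Schwartz function as an element of `H¹`. -/
noncomputable def testH1 (χ : 𝓢(ℝ, ℂ)) : SobolevH1 :=
  SobolevH1.mk _ _ (derivCLM_schwartzL2 χ)

theorem toL2_testH1 (χ : 𝓢(ℝ, ℂ)) : (testH1 χ).toL2 = schwartzL2 χ := rfl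

theorem derivL2_testH1 (χ : 𝓢(ℝ, ℂ)) :
    (testH1 χ).derivL2 = schwartzL2 (SchwartzMap.derivCLM ℂ ℂ χ) := rfl

theorem rep_testH1 (χ : 𝓢(ℝ, ℂ)) : (testH1 χ).rep = χ :=
  ((testH1 χ).continuous_rep.ae_eq_iff_eq volume χ.continuous).1
    ((testH1 χ).toL2_ae_eq_rep.symm.trans (coeFn_schwartzL2 χ))

theorem inner_schwartzL2 (χ : 𝓢(ℝ, ℂ)) (f : L2) :
    inner ℂ (schwartzL2 χ) f = ∫ x, f x * starRingEnd ℂ (χ x) := by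
  rw [L2.inner_def]
  refine integral_congr_ae ?_
  filter_upwards [coeFn_schwartzL2 χ] with x hx
  rw [hx, RCLike.inner_apply]

theorem inner_testH1 (χ : 𝓢(ℝ, ℂ)) (f : SobolevH1) : inner ℂ (testH1 χ) f =
    inner ℂ (schwartzL2 χ) f.toL2 +
      inner ℂ (schwartzL2 (SchwartzMap.derivCLM ℂ ℂ χ)) f.derivL2 := rfl

theorem integrable_mul_conj_schwartz (χ : 𝓢(ℝ, ℂ)) (f : L2) :
    Integrable fun x => f x * starRingEnd ℂ (χ x) :=
  (Lp.memLp f).integrable_mul (χ.memLp 2 volume).star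

open scoped FourierTransform in
/-- Schwartz functions are total in `H¹`. -/
theorem eq_zero_of_inner_testH1 {f : SobolevH1} (h : ∀ χ, inner ℂ (testH1 χ) f = 0) : f = 0 := by
  have hf := (derivCLM_eq_iff _ _).1 f.2
  change fourierL2 f.derivL2 =ᵐ[volume] fun ξ => dsymb ξ * fourierL2 f.toL2 ξ at hf
  have hF : ∀ η : 𝓢(ℝ, ℂ), fourierL2 (schwartzL2 (𝓕⁻ η)) = schwartzL2 η := by
    intro η
    have h1 := SchwartzMap.toLp_fourier_eq (𝓕⁻ η : 𝓢(ℝ, ℂ))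
    rw [FourierTransform.fourier_fourierInv_eq] at h1
    exact h1
  have hsymb : Continuous fun ξ => ((1 + symb ξ : ℝ) : ℂ) := by unfold symb; fun_prop
  have hloc : LocallyIntegrable (fun ξ => ((1 + symb ξ : ℝ) : ℂ) * fourierL2 f.toL2 ξ) :=
    ((Lp.memLp (fourierL2 f.toL2)).locallyIntegrable (by norm_num)).continuous_smul hsymb
  have hzero : ∀ᵐ ξ, ((1 + symb ξ : ℝ) : ℂ) * fourierL2 f.toL2 ξ = 0 := by
    refine ae_eq_zero_of_integral_contDiff_smul_eq_zero hloc fun ρ hρ hρc => ?_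
    have hρ' : ContDiff ℝ ∞ (fun x => (ρ x : ℂ)) := Complex.ofRealCLM.contDiff.comp hρ
    have hρc' : HasCompactSupport (fun x => (ρ x : ℂ)) := hρc.comp_left Complex.ofReal_zero
    set η : 𝓢(ℝ, ℂ) := hρc'.toSchwartzMap hρ' with hη
    have hηx : ∀ ξ, η ξ = (ρ ξ : ℂ) := fun ξ => rfl
    -- Testing on the Fourier side turns the `H¹` product into the integral of `η` against `(1 +
    -- symb) f̂`.
    have h1 := h (𝓕⁻ η)
    have h2 := (derivCLM_eq_iff _ _).1 (derivCLM_schwartzL2 (𝓕⁻ η))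
    rw [hF] at h2
    rw [inner_testH1, ← LinearIsometryEquiv.inner_map_map fourierL2,
      ← LinearIsometryEquiv.inner_map_map fourierL2
        (schwartzL2 (SchwartzMap.derivCLM ℂ ℂ (𝓕⁻ η))), hF, L2.inner_def, L2.inner_def,
      ← integral_add (L2.integrable_inner _ _) (L2.integrable_inner _ _)] at h1
    rw [← h1]
    refine integral_congr_ae ?_
    filter_upwards [h2, hf, coeFn_schwartzL2 η] with ξ e1 e2 e3
    rw [e1, e2, e3, hηx, RCLike.inner_apply, RCLike.inner_apply, map_mul, Complex.conj_ofReal,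
      Complex.real_smul]
    have e4 : starRingEnd ℂ (dsymb ξ) * dsymb ξ = (symb ξ : ℂ) := by
      rw [mul_comm, Complex.mul_conj, Complex.normSq_eq_norm_sq, norm_dsymb_sq]
    push_cast
    linear_combination -(fourierL2 f.toL2 ξ * (ρ ξ : ℂ)) * e4
  have h3 : f.toL2 = 0 := by
    rw [← fourierL2.map_eq_zero_iff]
    refine Lp.ext ?_
    filter_upwards [hzero, Lp.coeFn_zero ℂ 2 (volume : Measure ℝ)] with ξ h1 h2
    rw [h2, Pi.zero_apply]
    refine (mul_eq_zero.1 h1).resolve_left ?_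
    exact_mod_cast (by have := symb_nonneg ξ; positivity : (1 + symb ξ : ℝ) ≠ 0)
  have h4 : f.derivL2 = 0 := by
    rw [← fourierL2.map_eq_zero_iff]
    refine Lp.ext ?_
    filter_upwards [hf, hzero, Lp.coeFn_zero ℂ 2 (volume : Measure ℝ)] with ξ h0 h1 h2
    rw [h0, h2, Pi.zero_apply, h3, map_zero, h2, Pi.zero_apply, mul_zero]
  have h5 := f.norm_sq_eq
  rw [h3, h4, norm_zero] at h5
  exact norm_eq_zero.1 (by simpa using h5)

/-- Compactly supported smooth functions are total in `H¹`. -/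
theorem eq_zero_of_inner_testH1_of_hasCompactSupport {f : SobolevH1}
    (h : ∀ χ : 𝓢(ℝ, ℂ), HasCompactSupport χ → inner ℂ (testH1 χ) f = 0) : f = 0 := by
  refine eq_zero_of_inner_testH1 fun χ => ?_
  obtain ⟨ρ⟩ : Nonempty (ContDiffBump (0 : ℝ)) := inferInstance
  have hρs : ContDiff ℝ ∞ ρ := ρ.contDiff
  obtain ⟨C, hC⟩ := (hρs.continuous_deriv (by simp)).bounded_above_of_compact_support
    ρ.hasCompactSupport.deriv
  let s : ℕ → ℝ := fun n => 1 / ((n : ℝ) + 1)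
  have hs0 : ∀ n, s n ≠ 0 := fun n => by positivity
  have hs : Tendsto s atTop (𝓝 0) := tendsto_one_div_add_atTop_nhds_zero_nat
  -- Widening cutoffs of a Schwartz function. The derivative falling on the cutoff carries the
  -- factor `s n → 0`, so dominated convergence recovers the pairing with `χ`.
  let r : ℕ → ℝ → ℂ := fun n x => (ρ (s n * x) : ℂ) * χ x
  have hrs : ∀ n, ContDiff ℝ ∞ (r n) := fun n =>
    (Complex.ofRealCLM.contDiff.comp (hρs.comp (contDiff_const.mul contDiff_id))).mul χ.smooth'
  have hrc : ∀ n, HasCompactSupport (r n) := fun n => by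
    have h1 : HasCompactSupport fun x => ρ (s n * x) :=
      ρ.hasCompactSupport.comp_homeomorph (Homeomorph.mulLeft₀ (s n) (hs0 n))
    exact (h1.comp_left (g := fun a : ℝ => (a : ℂ)) Complex.ofReal_zero).mul_right
  have hrd : ∀ n x, deriv (r n) x =
      ((s n * deriv ρ (s n * x) : ℝ) : ℂ) * χ x + (ρ (s n * x) : ℂ) * deriv χ x := by
    intro n x
    have h1 : HasDerivAt (fun x => ρ (s n * x)) (deriv ρ (s n * x) * s n) x := by
      have h2 : HasDerivAt (fun x => s n * x) (s n) x := by
        simpa using (hasDerivAt_id x).const_mul (s n)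
      exact ((hρs.differentiable (by simp) _).hasDerivAt).comp x h2
    have h3 := h1.ofReal_comp.mul (χ.differentiable x).hasDerivAt
    rw [mul_comm (s n)]
    exact h3.deriv
  have hpair : ∀ n, ∫ x, ((ρ (s n * x) : ℂ) * (f.toL2 x * starRingEnd ℂ (χ x) +
      f.derivL2 x * starRingEnd ℂ (deriv χ x)) +
      ((s n * deriv ρ (s n * x) : ℝ) : ℂ) * (f.derivL2 x * starRingEnd ℂ (χ x))) = 0 := by
    intro n
    have h1 := h ((hrc n).toSchwartzMap (hrs n)) (hrc n)
    rw [inner_testH1, inner_schwartzL2, inner_schwartzL2, ← integral_add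
      (integrable_mul_conj_schwartz _ _) (integrable_mul_conj_schwartz _ _)] at h1
    rw [← h1]
    refine integral_congr_ae (ae_of_all _ fun x => ?_)
    have e1 : (hrc n).toSchwartzMap (hrs n) x = (ρ (s n * x) : ℂ) * χ x := rfl
    have e2 : SchwartzMap.derivCLM ℂ ℂ ((hrc n).toSchwartzMap (hrs n)) x = deriv (r n) x := rfl
    simp only [e1, e2, hrd, map_add, map_mul, Complex.conj_ofReal]
    ring
  have hg1 := integrable_mul_conj_schwartz χ f.toL2
  have hg2 := integrable_mul_conj_schwartz (SchwartzMap.derivCLM ℂ ℂ χ) f.derivL2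
  have hg3 := integrable_mul_conj_schwartz χ f.derivL2
  rw [inner_testH1, inner_schwartzL2, inner_schwartzL2, ← integral_add hg1 hg2]
  refine tendsto_nhds_unique (f := fun n => ∫ x, ((ρ (s n * x) : ℂ) *
      (f.toL2 x * starRingEnd ℂ (χ x) + f.derivL2 x * starRingEnd ℂ (deriv χ x)) +
      ((s n * deriv ρ (s n * x) : ℝ) : ℂ) * (f.derivL2 x * starRingEnd ℂ (χ x)))) (l := atTop) ?_
    (by simp only [hpair]; exact tendsto_const_nhds)
  have hρc : Continuous ρ := hρs.continuous
  have hρc' : Continuous (deriv ρ) := hρs.continuous_deriv (by simp)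
  have hm1 := hg1.aestronglyMeasurable
  have hm2 := hg2.aestronglyMeasurable
  have hm3 := hg3.aestronglyMeasurable
  have hs1 : ∀ n, |s n| ≤ 1 := fun n => by
    have : (0 : ℝ) ≤ n := n.cast_nonneg
    rw [abs_of_pos (by positivity)]
    exact (div_le_one (by positivity)).2 (by linarith)
  have hC0 : 0 ≤ C := (norm_nonneg _).trans (hC 0)
  refine tendsto_integral_of_dominated_convergence
    (fun x => ‖f.toL2 x * starRingEnd ℂ (χ x) + f.derivL2 x * starRingEnd ℂ (deriv χ x)‖ +
      C * ‖f.derivL2 x * starRingEnd ℂ (χ x)‖) (fun n => ?_)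
    ((hg1.add hg2).norm.add (hg3.norm.const_mul C)) (fun n => ae_of_all _ fun x => ?_)
    (ae_of_all _ fun x => ?_)
  · have h1 : Continuous fun x => (ρ (s n * x) : ℂ) := by fun_prop
    have h2 : Continuous fun x => ((s n * deriv ρ (s n * x) : ℝ) : ℂ) := by fun_prop
    exact (h1.aestronglyMeasurable.mul (hm1.add hm2)).add (h2.aestronglyMeasurable.mul hm3)
  · refine (norm_add_le _ _).trans (add_le_add ?_ ?_)
    · rw [norm_mul, Complex.norm_real, Real.norm_of_nonneg ρ.nonneg]
      exact mul_le_of_le_one_left (norm_nonneg _) ρ.le_one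
    · rw [norm_mul, Complex.norm_real, Real.norm_eq_abs, abs_mul]
      refine mul_le_mul_of_nonneg_right ?_ (norm_nonneg _)
      have h1 := hC (s n * x)
      rw [Real.norm_eq_abs] at h1
      have := hs1 n
      have := abs_nonneg (deriv ρ (s n * x))
      nlinarith [abs_nonneg (s n)]
  · have hsx : Tendsto (fun n => s n * x) atTop (𝓝 0) := by simpa using hs.mul_const x
    have h1 : Tendsto (fun n => ρ (s n * x)) atTop (𝓝 1) := by
      have h2 := (hρc.tendsto 0).comp hsx
      rwa [ρ.one_of_mem_closedBall (Metric.mem_closedBall_self ρ.rIn_pos.le)] at h2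
    have h3 : Tendsto (fun n => s n * deriv ρ (s n * x)) atTop (𝓝 0) := by
      simpa using hs.mul ((hρc'.tendsto 0).comp hsx)
    have h4 := (((Complex.continuous_ofReal.tendsto _).comp h1).mul_const
      (f.toL2 x * starRingEnd ℂ (χ x) + f.derivL2 x * starRingEnd ℂ (deriv χ x))).add
      (((Complex.continuous_ofReal.tendsto _).comp h3).mul_const
        (f.derivL2 x * starRingEnd ℂ (χ x)))
    simpa using h4

/-! ### Pairing with test functions -/

theorem contDiff_conj {E : Type*} [NormedAddCommGroup E] [NormedSpace ℝ E] {f : E → ℂ}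
    (hf : ContDiff ℝ ∞ f) : ContDiff ℝ ∞ fun x => starRingEnd ℂ (f x) :=
  Complex.conjCLE.contDiff.comp hf

/-- The complex conjugate of a smooth compactly supported function as a Schwartz function. -/
noncomputable def conjSchwartz {f : ℝ → ℂ} (hf : ContDiff ℝ ∞ f) (hc : HasCompactSupport f) :
    𝓢(ℝ, ℂ) :=
  (hc.comp_left (g := starRingEnd ℂ) (map_zero _)).toSchwartzMap (contDiff_conj hf)

theorem conjSchwartz_apply {f : ℝ → ℂ} (hf : ContDiff ℝ ∞ f) (hc : HasCompactSupport f) (x : ℝ) :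
    conjSchwartz hf hc x = starRingEnd ℂ (f x) := rfl

theorem deriv_conjSchwartz {f : ℝ → ℂ} (hf : ContDiff ℝ ∞ f) (hc : HasCompactSupport f) (x : ℝ) :
    SchwartzMap.derivCLM ℂ ℂ (conjSchwartz hf hc) x = starRingEnd ℂ (deriv f x) :=
  deriv.star (f := f)

/-- The weak formulation is bilinear while the inner product is conjugate linear on the left;
representing test functions by their conjugates reconciles the two. -/
theorem inner_conjSchwartz {f : ℝ → ℂ} (hf : ContDiff ℝ ∞ f) (hc : HasCompactSupport f)
    (h : SobolevH1) :
    inner ℂ (schwartzL2 (conjSchwartz hf hc)) h.toL2 = ∫ x, h.rep x * f x := by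
  rw [inner_schwartzL2]
  refine integral_congr_ae ?_
  filter_upwards [h.toL2_ae_eq_rep] with x hx
  rw [hx, conjSchwartz_apply, Complex.conj_conj]

/-- The functional on `H¹` represented by a smooth compactly supported function. -/
noncomputable def testVec {f : ℝ → ℂ} (hf : ContDiff ℝ ∞ f) (hc : HasCompactSupport f) : L2 :=
  toFourier (testH1 (conjSchwartz hf hc))

theorem inner_testVec_a {f : ℝ → ℂ} (hf : ContDiff ℝ ∞ f) (hc : HasCompactSupport f)
    (h : SobolevH1) :
    inner ℂ (testVec hf hc) (fourierModel.a (toFourier h)) = ∫ x, h.rep x * f x := by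
  rw [testVec, ← inner_toL2, toL2_testH1, inner_conjSchwartz]

theorem inner_testVec_g {f : ℝ → ℂ} (hf : ContDiff ℝ ∞ f) (hc : HasCompactSupport f) :
    inner ℂ (testVec hf hc) fourierModel.g = f 0 := by
  rw [← inner_conj_symm]
  change starRingEnd ℂ (fourierModel.tr (testVec hf hc)) = _
  rw [testVec, ← rep_zero_eq, rep_testH1, conjSchwartz_apply, Complex.conj_conj]

/-- `1 - a` encodes the product of the derivatives. The defining property of the distributional
derivative, tested with `f'`, moves the second derivative onto `f`. -/
theorem inner_testVec_sub_a {f : ℝ → ℂ} (hf : ContDiff ℝ ∞ f) (hc : HasCompactSupport f)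
    (h : SobolevH1) :
    inner ℂ (testVec hf hc) (toFourier h - fourierModel.a (toFourier h)) =
      -∫ x, h.rep x * iteratedDeriv 2 f x := by
  have hf' : ContDiff ℝ ∞ (deriv f) := (contDiff_infty_iff_deriv.1 hf).2
  set G : 𝓢(ℝ, ℂ) := hc.deriv.toSchwartzMap hf' with hG
  have h1 := congrArg (fun T => T G) h.2
  simp only [TemperedDistribution.derivCLM_apply_apply, Lp.toTemperedDistributionCLM_apply,
    Lp.toTemperedDistribution_apply, map_neg] at h1
  have e1 : ∀ x, SchwartzMap.derivCLM ℂ ℂ G x = iteratedDeriv 2 f x := fun x => by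
    rw [iteratedDeriv_succ, iteratedDeriv_one]; rfl
  have e2 : ∀ x, G x = deriv f x := fun x => rfl
  simp only [e1, e2, smul_eq_mul] at h1
  rw [testVec, ← inner_derivL2, derivL2_testH1, inner_schwartzL2]
  have h2 : ∫ x, h.rep x * iteratedDeriv 2 f x = ∫ x, iteratedDeriv 2 f x * h.1.fst x := by
    refine integral_congr_ae ?_
    filter_upwards [h.toL2_ae_eq_rep] with x hx
    rw [← hx, mul_comm]
    rfl
  rw [h2, h1]
  refine integral_congr_ae (ae_of_all _ fun x => ?_)
  simp only [deriv_conjSchwartz, Complex.conj_conj]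
  exact mul_comm _ _

theorem inner_testVec_velocity {f : ℝ → ℂ} (hf : ContDiff ℝ ∞ f) (hc : HasCompactSupport f)
    (F : ℂ → ℂ) (h : SobolevH1) :
    inner ℂ (testVec hf hc) (fourierModel.velocity F (toFourier h)) =
      Complex.I * (∫ x, h.rep x * iteratedDeriv 2 f x) + Complex.I * F (h.rep 0) * f 0 := by
  rw [TruncatedModel.velocity, inner_add_right, inner_neg_right, inner_smul_right,
    inner_smul_right, inner_testVec_sub_a, inner_testVec_g, ← rep_zero_eq]
  ring

theorem eq_zero_of_inner_testVec {x : L2}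
    (h : ∀ (f : ℝ → ℂ) (hf : ContDiff ℝ ∞ f) (hc : HasCompactSupport f),
      inner ℂ (testVec hf hc) x = 0) : x = 0 := by
  rw [← toFourier.symm.map_eq_zero_iff]
  refine eq_zero_of_inner_testH1_of_hasCompactSupport fun χ hχ => ?_
  have hc : HasCompactSupport fun x => starRingEnd ℂ (χ x) :=
    hχ.comp_left (g := starRingEnd ℂ) (map_zero _)
  have h1 := h _ (contDiff_conj χ.smooth') hc
  have h2 : conjSchwartz (contDiff_conj χ.smooth') hc = χ := by
    ext x
    exact Complex.conj_conj _
  rw [← h1, testVec, h2]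
  conv_rhs => rw [← toFourier.apply_symm_apply x]
  exact (LinearIsometryEquiv.inner_map_map toFourier (testH1 χ) (toFourier.symm x)).symm

/-! ### Time slices of test functions -/

section Slice

variable {Φ : ℝ × ℝ → ℂ}

theorem contDiff_slice (hΦ : ContDiff ℝ ∞ Φ) (t : ℝ) : ContDiff ℝ ∞ fun x => Φ (x, t) :=
  hΦ.comp (contDiff_id.prodMk contDiff_const)

theorem slice_eq_zero {x : ℝ} (hx : x ∉ Prod.fst '' tsupport Φ) (t : ℝ) : Φ (x, t) = 0 :=
  image_eq_zero_of_notMem_tsupport fun h => hx ⟨_, h, rfl⟩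

theorem slice_eq_zero' {t : ℝ} (ht : t ∉ Prod.snd '' tsupport Φ) (x : ℝ) : Φ (x, t) = 0 :=
  image_eq_zero_of_notMem_tsupport fun h => ht ⟨_, h, rfl⟩

theorem hasCompactSupport_slice (hc : HasCompactSupport Φ) (t : ℝ) :
    HasCompactSupport fun x => Φ (x, t) :=
  HasCompactSupport.intro (hc.isCompact.image continuous_fst) fun _ hx => slice_eq_zero hx t

/-- The class in `L²` of `x ↦ conj Φ(x, t)`. -/
noncomputable def slice (hΦ : ContDiff ℝ ∞ Φ) (hc : HasCompactSupport Φ) (t : ℝ) : L2 :=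
  schwartzL2 (conjSchwartz (contDiff_slice hΦ t) (hasCompactSupport_slice hc t))

theorem inner_slice (hΦ : ContDiff ℝ ∞ Φ) (hc : HasCompactSupport Φ) (t : ℝ) (h : SobolevH1) :
    inner ℂ (slice hΦ hc t) h.toL2 = ∫ x, h.rep x * Φ (x, t) :=
  inner_conjSchwartz _ _ h

theorem coeFn_slice (hΦ : ContDiff ℝ ∞ Φ) (hc : HasCompactSupport Φ) (t : ℝ) :
    slice hΦ hc t =ᵐ[volume] fun x => starRingEnd ℂ (Φ (x, t)) :=
  coeFn_schwartzL2 _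

theorem slice_of_notMem (hΦ : ContDiff ℝ ∞ Φ) (hc : HasCompactSupport Φ) {t : ℝ}
    (ht : t ∉ Prod.snd '' tsupport Φ) : slice hΦ hc t = 0 := by
  refine Lp.ext ?_
  filter_upwards [coeFn_slice hΦ hc t, Lp.coeFn_zero ℂ 2 (volume : Measure ℝ)] with x h1 h2
  rw [h1, h2, slice_eq_zero' ht, map_zero, Pi.zero_apply]

/-- A partial derivative of a function on the plane. -/
noncomputable def partialDeriv (v : ℝ × ℝ) (Φ : ℝ × ℝ → ℂ) : ℝ × ℝ → ℂ := fun p => fderiv ℝ Φ p v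

theorem contDiff_partialDeriv (hΦ : ContDiff ℝ ∞ Φ) (v : ℝ × ℝ) :
    ContDiff ℝ ∞ (partialDeriv v Φ) :=
  (hΦ.fderiv_right (m := ∞) (by simp)).clm_apply contDiff_const

theorem hasCompactSupport_partialDeriv (hc : HasCompactSupport Φ) (v : ℝ × ℝ) :
    HasCompactSupport (partialDeriv v Φ) := hc.fderiv_apply ℝ v

theorem hasDerivAt_time (hΦ : ContDiff ℝ ∞ Φ) (x t : ℝ) :
    HasDerivAt (fun s => Φ (x, s)) (partialDeriv (0, 1) Φ (x, t)) t :=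
  (hΦ.differentiable (by simp) (x, t)).hasFDerivAt.comp_hasDerivAt t
    ((hasDerivAt_const t x).prodMk (hasDerivAt_id t))

theorem hasDerivAt_space (hΦ : ContDiff ℝ ∞ Φ) (x t : ℝ) :
    HasDerivAt (fun y => Φ (y, t)) (partialDeriv (1, 0) Φ (x, t)) x :=
  (hΦ.differentiable (by simp) (x, t)).hasFDerivAt.comp_hasDerivAt x
    ((hasDerivAt_id x).prodMk (hasDerivAt_const x t))

theorem iteratedDeriv_two_slice (hΦ : ContDiff ℝ ∞ Φ) (x t : ℝ) :
    iteratedDeriv 2 (fun y => Φ (y, t)) x = partialDeriv (1, 0) (partialDeriv (1, 0) Φ) (x, t) := by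
  rw [iteratedDeriv_succ, iteratedDeriv_one, funext fun y => (hasDerivAt_space hΦ y t).deriv]
  exact (hasDerivAt_space (contDiff_partialDeriv hΦ _) x t).deriv

theorem norm_le_of_ae_le_indicator {f : L2} {K : Set ℝ} (hK : IsCompact K) {c : ℝ} (hc : 0 ≤ c)
    (h : ∀ᵐ x, ‖f x‖ ≤ K.indicator (fun _ => c) x) : ‖f‖ ≤ c * √(volume.real K) := by
  have h1 : ‖f‖ ≤ ‖indicatorConstLp 2 hK.measurableSet
      (hK.measure_lt_top (μ := volume)).ne c‖ := by
    refine Lp.norm_le_norm_of_ae_le ?_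
    filter_upwards [h, indicatorConstLp_coeFn (p := 2) (hs := hK.measurableSet)
      (hμs := hK.measure_lt_top.ne) (c := c)] with x h1 h2
    rw [h2]
    exact h1.trans (le_abs_self _)
  refine h1.trans ?_
  rw [norm_indicatorConstLp (by norm_num) (by norm_num), Real.norm_of_nonneg hc, Real.sqrt_eq_rpow]
  simp

/-- The mean value inequality applied to `f s - (s - t) f' t`. -/
theorem norm_sub_sub_smul_le {f f' : ℝ → ℂ} (hf : ∀ s, HasDerivAt f (f' s) s) {C : ℝ}
    (hC : ∀ s t, ‖f' s - f' t‖ ≤ C * |s - t|) (hC0 : 0 ≤ C) (t r : ℝ) :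
    ‖f (t + r) - f t - (r : ℂ) * f' t‖ ≤ C * r ^ 2 := by
  have hd : ∀ s ∈ uIcc t (t + r), HasDerivWithinAt (fun s => f s - ((s - t : ℝ) : ℂ) * f' t)
      (f' s - f' t) (uIcc t (t + r)) s := by
    intro s _
    have h1 : HasDerivAt (fun s : ℝ => s - t) 1 s := (hasDerivAt_id s).sub_const t
    have h2 := (hf s).sub (h1.ofReal_comp.mul_const (f' t))
    simp only [Complex.ofReal_one, one_mul] at h2
    exact h2.hasDerivWithinAt
  have hb : ∀ s ∈ uIcc t (t + r), ‖f' s - f' t‖ ≤ C * |r| := by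
    intro s hs
    refine (hC s t).trans (mul_le_mul_of_nonneg_left ?_ hC0)
    simpa using abs_sub_left_of_mem_uIcc hs
  have h3 := (convex_uIcc t (t + r)).norm_image_sub_le_of_norm_hasDerivWithin_le hd hb
    left_mem_uIcc right_mem_uIcc
  simp only [add_sub_cancel_left, sub_self, Complex.ofReal_zero, zero_mul, sub_zero,
    Real.norm_eq_abs] at h3
  rw [mul_assoc, abs_mul_abs_self, ← sq] at h3
  rwa [sub_right_comm] at h3

/-- A bounded second time derivative gives a pointwise remainder `C r²`. All slices vanish off one
compact set `K`, so this bound passes to `L²` with the factor `√|K|`. -/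
theorem hasDerivAt_slice (hΦ : ContDiff ℝ ∞ Φ) (hc : HasCompactSupport Φ) (t : ℝ) :
    HasDerivAt (slice hΦ hc) (slice (contDiff_partialDeriv hΦ (0, 1))
      (hasCompactSupport_partialDeriv hc (0, 1)) t) t := by
  have hΦ' := contDiff_partialDeriv hΦ (0, 1)
  have hc' := hasCompactSupport_partialDeriv hc (0, 1)
  obtain ⟨C, hC⟩ := (contDiff_partialDeriv hΦ' (0, 1)).continuous.bounded_above_of_compact_support
    (hasCompactSupport_partialDeriv hc' (0, 1))
  have hC0 : 0 ≤ C := (norm_nonneg _).trans (hC 0)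
  set K : Set ℝ := Prod.fst '' tsupport Φ with hKdef
  have hK : IsCompact K := hc.isCompact.image continuous_fst
  have hlip : ∀ x s t, ‖partialDeriv (0, 1) Φ (x, s) - partialDeriv (0, 1) Φ (x, t)‖ ≤
      C * |s - t| := fun x s t =>
    convex_univ.norm_image_sub_le_of_norm_hasDerivWithin_le
      (fun r _ => (hasDerivAt_time hΦ' x r).hasDerivWithinAt) (fun r _ => hC (x, r))
      (mem_univ t) (mem_univ s)
  rw [hasDerivAt_iff_isLittleO_nhds_zero]
  refine Asymptotics.IsBigO.trans_isLittleO (g := fun r : ℝ => r ^ 2) ?_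
    (Asymptotics.isLittleO_pow_id one_lt_two)
  refine Asymptotics.IsBigO.of_bound (C * √(volume.real K)) (Eventually.of_forall fun r => ?_)
  rw [Real.norm_of_nonneg (sq_nonneg r), mul_right_comm]
  refine norm_le_of_ae_le_indicator hK (by positivity) ?_
  have e0 : r • slice hΦ' hc' t = (r : ℂ) • slice hΦ' hc' t := (Complex.coe_smul r _).symm
  rw [e0]
  filter_upwards [coeFn_slice hΦ hc t, coeFn_slice hΦ hc (t + r), coeFn_slice hΦ' hc' t,
    Lp.coeFn_sub (slice hΦ hc (t + r) - slice hΦ hc t) ((r : ℂ) • slice hΦ' hc' t),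
    Lp.coeFn_sub (slice hΦ hc (t + r)) (slice hΦ hc t),
    Lp.coeFn_smul (r : ℂ) (slice hΦ' hc' t)] with x h1 h2 h3 h4 h5 h6
  rw [h4, Pi.sub_apply, h5, Pi.sub_apply, h6, Pi.smul_apply, h1, h2, h3]
  have h7 : starRingEnd ℂ (Φ (x, t + r)) - starRingEnd ℂ (Φ (x, t)) -
      (r : ℂ) • starRingEnd ℂ (partialDeriv (0, 1) Φ (x, t)) =
      starRingEnd ℂ (Φ (x, t + r) - Φ (x, t) - (r : ℂ) * partialDeriv (0, 1) Φ (x, t)) := by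
    simp
  rw [h7, RCLike.norm_conj]
  by_cases hx : x ∈ K
  · rw [indicator_of_mem hx]
    exact norm_sub_sub_smul_le (fun s => hasDerivAt_time hΦ x s) (hlip x) hC0 t r
  · rw [indicator_of_notMem hx]
    have h8 : partialDeriv (0, 1) Φ (x, t) = 0 := by
      rw [← (hasDerivAt_time hΦ x t).deriv, funext fun s => slice_eq_zero hx s, deriv_const]
    rw [h8, slice_eq_zero hx, slice_eq_zero hx]
    simp

theorem continuous_slice (hΦ : ContDiff ℝ ∞ Φ) (hc : HasCompactSupport Φ) :
    Continuous (slice hΦ hc) :=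
  continuous_iff_continuousAt.2 fun t => (hasDerivAt_slice hΦ hc t).continuousAt

end Slice

/-! ### Equivalence with the weak formulation -/

theorem SobolevH1.continuous_toL2 : Continuous SobolevH1.toL2 :=
  (continuous_fst.comp (WithLp.prod_continuous_ofLp 2 _ _)).comp continuous_subtype_val

/-- The Leibniz rule at a point where the differentiable factor vanishes. -/
theorem hasDerivAt_inner_of_eq_zero {D : ℝ → L2} {D' : L2} {ψ : ℝ → L2} {t : ℝ}
    (hD : HasDerivAt D D' t) (h0 : D t = 0) (hψ : ContinuousAt ψ t) :
    HasDerivAt (fun s => inner ℂ (D s) (ψ s)) (inner ℂ D' (ψ t)) t := by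
  rw [hasDerivAt_iff_tendsto_slope] at hD ⊢
  -- Since `D t = 0`, the difference quotient of the product is the slope of `D` paired with `ψ s`,
  -- so continuity of `ψ` is enough.
  refine (hD.inner (𝕜 := ℂ) (hψ.tendsto.mono_left nhdsWithin_le_nhds)).congr fun s => ?_
  have e : (s - t)⁻¹ • D s = (((s - t)⁻¹ : ℝ) : ℂ) • D s := (Complex.coe_smul _ _).symm
  rw [slope_def_module, slope_def_module, h0, inner_zero_left, sub_zero, sub_zero, e,
    inner_smul_left, Complex.conj_ofReal, Complex.real_smul]

theorem integral_eq_zero_of_hasDerivAt_of_hasCompactSupport {f f' : ℝ → ℂ}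
    (h : ∀ t, HasDerivAt f (f' t) t) (hf' : Continuous f') (hc : HasCompactSupport f) :
    ∫ t, f' t = 0 := by
  have hf : Continuous f := continuous_iff_continuousAt.2 fun t => (h t).continuousAt
  have hd : deriv f = f' := funext fun t => (h t).deriv
  have hc' : HasCompactSupport f' := hd ▸ hc.deriv
  exact integral_eq_zero_of_hasDerivAt_of_integrable h
    (hf'.integrable_of_hasCompactSupport hc') (hf.integrable_of_hasCompactSupport hc)

/-- The weak formulation says that the time derivative of the pairing of `Φ(·, t)` with `ψ t`
integrates to zero, the pairing having compact support in time. -/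
theorem isConcentratedNLSSolution_of_hasDerivAt {F : ℂ → ℂ} (hF : Continuous F)
    {ψ : C(ℝ, SobolevH1)}
    (h : ∀ t, HasDerivAt (fun t => fourierModel.a (toFourier (ψ t)))
      (fourierModel.velocity F (toFourier (ψ t))) t) :
    IsConcentratedNLSSolution F ψ := by
  intro Φ hΦ hc
  have hΦt := contDiff_partialDeriv hΦ (0, 1)
  have hct := hasCompactSupport_partialDeriv hc (0, 1)
  have hΦxx := contDiff_partialDeriv (contDiff_partialDeriv hΦ (1, 0)) (1, 0)
  have hcxx := hasCompactSupport_partialDeriv (hasCompactSupport_partialDeriv hc (1, 0)) (1, 0)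
  have hψ : Continuous fun t => (ψ t).toL2 := SobolevH1.continuous_toL2.comp ψ.continuous
  have hrep : Continuous fun t => (ψ t).rep 0 := by
    simp only [rep_zero_eq]
    exact fourierModel.continuous_tr.comp (toFourier.continuous.comp ψ.continuous)
  have hsupp : ∀ {Ψ : ℝ × ℝ → ℂ} (hΨ : ContDiff ℝ ∞ Ψ) (hcΨ : HasCompactSupport Ψ),
      HasCompactSupport fun t => inner ℂ (slice hΨ hcΨ t) (ψ t).toL2 := fun hΨ hcΨ =>
    HasCompactSupport.intro (hcΨ.isCompact.image continuous_snd) fun t ht => by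
      rw [slice_of_notMem hΨ hcΨ ht, inner_zero_left]
  set A : ℝ → ℂ := fun t => inner ℂ (slice hΦt hct t) (ψ t).toL2 with hA
  set B : ℝ → ℂ := fun t => inner ℂ (slice hΦxx hcxx t) (ψ t).toL2 with hB
  set D : ℝ → ℂ := fun t => F ((ψ t).rep 0) * Φ (0, t) with hD
  have hAc : Continuous A := (continuous_slice hΦt hct).inner hψ
  have hBc : Continuous B := (continuous_slice hΦxx hcxx).inner hψ
  have hDc : Continuous D := by have := hΦ.continuous; fun_prop
  have hDs : HasCompactSupport D :=
    HasCompactSupport.intro (hc.isCompact.image continuous_snd) fun t ht => by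
      rw [hD]; simp only [slice_eq_zero' ht, mul_zero]
  have hAi := hAc.integrable_of_hasCompactSupport (μ := volume) (hsupp hΦt hct)
  have hBi := hBc.integrable_of_hasCompactSupport (μ := volume) (hsupp hΦxx hcxx)
  have hDi := hDc.integrable_of_hasCompactSupport (μ := volume) hDs
  have hder : ∀ t, HasDerivAt (fun t => inner ℂ (slice hΦ hc t) (ψ t).toL2)
      (A t + (Complex.I * B t + Complex.I * D t)) t := by
    intro t
    -- As an `L²` curve `ψ` is only known to be continuous, so the ordinary product rule is
    -- unavailable. The test slice is split into its increment from time `t`, handled here, and the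
    -- frozen slice, handled by `h`.
    have h1 := hasDerivAt_inner_of_eq_zero
      ((hasDerivAt_slice hΦ hc t).sub_const (slice hΦ hc t)) (sub_self _) hψ.continuousAt
    have hf := contDiff_slice hΦ t
    have hfc := hasCompactSupport_slice hc t
    have h2 := (h t).complexCLM (innerSL ℂ (testVec hf hfc))
    simp only [innerSL_apply_apply, inner_testVec_velocity, inner_testVec_a,
      ← inner_slice hΦ hc] at h2
    refine ((h1.add h2).congr_deriv ?_).congr_of_eventuallyEq (Eventually.of_forall fun s => ?_)
    · simp only [hA, hB, hD]
      rw [inner_slice hΦxx hcxx]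
      simp only [iteratedDeriv_two_slice hΦ]
      ring
    · simp only [Pi.add_apply]
      rw [← inner_add_left, sub_add_cancel]
  have hint := integral_eq_zero_of_hasDerivAt_of_hasCompactSupport hder (by fun_prop)
    (hsupp hΦ hc)
  have hIB := hBi.const_mul Complex.I
  have hID := hDi.const_mul Complex.I
  rw [integral_add (g := fun t => Complex.I * B t + Complex.I * D t) hAi (hIB.add hID),
    integral_add hIB hID, integral_const_mul, integral_const_mul] at hint
  have e1 : ∫ t : ℝ, ∫ x : ℝ, (ψ t).rep x * deriv (fun s => Φ (x, s)) t = ∫ t, A t := by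
    simp only [hA, inner_slice hΦt hct, fun x t => (hasDerivAt_time hΦ x t).deriv]
  have e2 : ∫ t : ℝ, ∫ x : ℝ, (ψ t).rep x * iteratedDeriv 2 (fun y => Φ (y, t)) x =
      ∫ t, B t := by
    simp only [hB, inner_slice hΦxx hcxx, iteratedDeriv_two_slice hΦ]
  rw [e1, e2]
  linear_combination (-Complex.I) * hint + ((∫ t, B t) + ∫ t, D t) * Complex.I_mul_I

/-- Product test functions `f(x) η(t)` show that `a w` minus the integrated velocity has zero
distributional time derivative against each `f`. Such pairings are constant and they separate points
of `L²`. -/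
theorem hasDerivAt_of_isConcentratedNLSSolution {F : ℂ → ℂ} (hF : Continuous F)
    {ψ : C(ℝ, SobolevH1)} (h : IsConcentratedNLSSolution F ψ) (t : ℝ) :
    HasDerivAt (fun t => fourierModel.a (toFourier (ψ t)))
      (fourierModel.velocity F (toFourier (ψ t))) t := by
  have hw : Continuous fun t => toFourier (ψ t) := toFourier.continuous.comp ψ.continuous
  set V : ℝ → L2 := fun t => fourierModel.velocity F (toFourier (ψ t)) with hVdef
  have hV : Continuous V := (fourierModel.continuous_velocity hF).comp hw
  set J : ℝ → L2 := fun t => ∫ s in (0 : ℝ)..t, V s with hJdef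
  have hJ : ∀ t, HasDerivAt J (V t) t := fun t => (hV.integral_hasStrictDerivAt 0 t).hasDerivAt
  have hJc : Continuous J := continuous_iff_continuousAt.2 fun t => (hJ t).continuousAt
  have hconst : ∀ t, fourierModel.a (toFourier (ψ t)) - J t =
      fourierModel.a (toFourier (ψ 0)) - J 0 := by
    intro t
    rw [← sub_eq_zero]
    refine eq_zero_of_inner_testVec fun f hf hc => ?_
    rw [inner_sub_right, sub_eq_zero]
    refine eq_of_integral_deriv_mul_eq_zero
      (f := fun t => inner ℂ (testVec hf hc) (fourierModel.a (toFourier (ψ t)) - J t))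
      (by fun_prop) (fun η hη hηc => ?_) t 0
    have hη' : Continuous (deriv η) := hη.continuous_deriv (by simp)
    have hfη : ContDiff ℝ ∞ fun p : ℝ × ℝ => f p.1 * (η p.2 : ℂ) :=
      (hf.comp contDiff_fst).mul (Complex.ofRealCLM.contDiff.comp (hη.comp contDiff_snd))
    have hfηc : HasCompactSupport fun p : ℝ × ℝ => f p.1 * (η p.2 : ℂ) := by
      refine HasCompactSupport.intro (hc.isCompact.prod hηc.isCompact) fun p hp => ?_
      rw [mem_prod, not_and_or] at hp
      rcases hp with hp | hp
      · rw [image_eq_zero_of_notMem_tsupport hp, zero_mul]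
      · rw [image_eq_zero_of_notMem_tsupport hp, Complex.ofReal_zero, mul_zero]
    have h1 := h _ hfη hfηc
    have d1 : ∀ x t, deriv (fun s => f x * (η s : ℂ)) t = f x * ((deriv η t : ℝ) : ℂ) := fun x t =>
      (((hη.differentiable (by simp) t).hasDerivAt.ofReal_comp).const_mul (f x)).deriv
    have d2 : ∀ x t, iteratedDeriv 2 (fun y => f y * (η t : ℂ)) x =
        iteratedDeriv 2 f x * (η t : ℂ) := fun x t => by
      rw [iteratedDeriv_succ, iteratedDeriv_one, iteratedDeriv_succ, iteratedDeriv_one,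
        funext fun y => deriv_mul_const_field (u := f) (x := y) (η t : ℂ)]
      exact deriv_mul_const_field _
    simp only [d1, d2, ← mul_assoc, integral_mul_const] at h1
    simp only [← inner_testVec_a hf hc] at h1
    have hp : ∀ t, HasDerivAt (fun t => (η t : ℂ) * inner ℂ (testVec hf hc) (J t))
        (((deriv η t : ℝ) : ℂ) * inner ℂ (testVec hf hc) (J t) +
          (η t : ℂ) * inner ℂ (testVec hf hc) (V t)) t := fun t =>
      ((hη.differentiable (by simp) t).hasDerivAt.ofReal_comp).mul
        ((hJ t).complexCLM (innerSL ℂ (testVec hf hc)))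
    have hηC : HasCompactSupport fun t => (η t : ℂ) := hηc.comp_left Complex.ofReal_zero
    have hηC' : HasCompactSupport fun t => ((deriv η t : ℝ) : ℂ) :=
      hηc.deriv.comp_left (g := fun a : ℝ => (a : ℂ)) Complex.ofReal_zero
    have hηcont := hη.continuous
    have hFc : Continuous fun t => F ((ψ t).rep 0) := by
      simp only [rep_zero_eq]
      exact hF.comp (fourierModel.continuous_tr.comp hw)
    have hXc : Continuous fun t => ∫ x, (ψ t).rep x * iteratedDeriv 2 f x := by
      have e : (fun t => ∫ x, (ψ t).rep x * iteratedDeriv 2 f x) = fun t =>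
          -inner ℂ (testVec hf hc) (toFourier (ψ t) - fourierModel.a (toFourier (ψ t))) :=
        funext fun t => by rw [inner_testVec_sub_a, neg_neg]
      rw [e]
      fun_prop
    have h2 := integral_eq_zero_of_hasDerivAt_of_hasCompactSupport hp (by fun_prop)
      hηC.mul_right
    have i1 : Integrable fun t => ((deriv η t : ℝ) : ℂ) * inner ℂ (testVec hf hc) (J t) :=
      Continuous.integrable_of_hasCompactSupport (by fun_prop) hηC'.mul_right
    have i2 : Integrable fun t => (η t : ℂ) * inner ℂ (testVec hf hc) (V t) :=
      Continuous.integrable_of_hasCompactSupport (by fun_prop) hηC.mul_right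
    have i3 : Integrable fun t => ((deriv η t : ℝ) : ℂ) *
        inner ℂ (testVec hf hc) (fourierModel.a (toFourier (ψ t))) :=
      Continuous.integrable_of_hasCompactSupport (by fun_prop) hηC'.mul_right
    have i4 : Integrable fun t => (∫ x, (ψ t).rep x * iteratedDeriv 2 f x) * (η t : ℂ) :=
      Continuous.integrable_of_hasCompactSupport (by fun_prop) hηC.mul_left
    have i5 : Integrable fun t => F ((ψ t).rep 0) * f 0 * (η t : ℂ) :=
      ((hFc.mul continuous_const).mul (by fun_prop)).integrable_of_hasCompactSupport hηC.mul_left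
    rw [integral_add i1 i2] at h2
    have h3 : ∫ t, (η t : ℂ) * inner ℂ (testVec hf hc) (V t) =
        Complex.I * (∫ t, (∫ x, (ψ t).rep x * iteratedDeriv 2 f x) * (η t : ℂ)) +
          Complex.I * ∫ t, F ((ψ t).rep 0) * f 0 * (η t : ℂ) := by
      rw [← integral_const_mul, ← integral_const_mul,
        ← integral_add (i4.const_mul _) (i5.const_mul _)]
      refine integral_congr_ae (ae_of_all _ fun t => ?_)
      simp only [hVdef, inner_testVec_velocity]
      ring
    have h4 : ∫ t, inner ℂ (testVec hf hc) (fourierModel.a (toFourier (ψ t))) *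
        ((deriv η t : ℝ) : ℂ) =
        ∫ t, ((deriv η t : ℝ) : ℂ) * inner ℂ (testVec hf hc) (fourierModel.a (toFourier (ψ t))) :=
      integral_congr_ae (ae_of_all _ fun t => mul_comm _ _)
    rw [h4] at h1
    rw [h3] at h2
    simp only [Complex.real_smul, inner_sub_right, mul_sub]
    rw [integral_sub i3 i1]
    linear_combination Complex.I * h1 - h2 + (∫ t, ((deriv η t : ℝ) : ℂ) *
      inner ℂ (testVec hf hc) (fourierModel.a (toFourier (ψ t)))) * Complex.I_mul_I
  have h5 : (fun t => fourierModel.a (toFourier (ψ t))) = fun t =>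
      (fourierModel.a (toFourier (ψ 0)) - J 0) + J t :=
    funext fun t => by rw [← hconst t]; abel
  rw [h5]
  exact (hJ t).const_add _

theorem isConcentratedNLSSolution_iff {F : ℂ → ℂ} (hF : Continuous F) (ψ : C(ℝ, SobolevH1)) :
    IsConcentratedNLSSolution F ψ ↔ ∀ R, fourierModel.Solves F R fun t => toFourier (ψ t) :=
  ⟨fun h => fourierModel.solves_of_hasDerivAt (hasDerivAt_of_isConcentratedNLSSolution hF h),
    fun h => isConcentratedNLSSolution_of_hasDerivAt hF
      (fourierModel.hasDerivAt_of_solves hF (toFourier.continuous.comp ψ.continuous) h)⟩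

/-! ### The main theorem: transfer from the Fourier model to `H¹`. -/

theorem theorem1 (U : ℂ → ℝ) (u : ℝ → ℝ) (F : ℂ → ℂ) (A B : ℝ)
    (hU : ContDiff ℝ 2 U)
    (hF : ∀ z : ℂ, F z = -∇ U z)
    (hu : ∀ z : ℂ, U z = u (‖z‖ ^ 2))
    (hB : 0 < B)
    (hAB : ∀ z : ℂ, A - B * ‖z‖ ^ 2 ≤ U z) :
    ∃ S : SobolevH1 → C(ℝ, SobolevH1),
      -- existence and uniqueness of the solution `S φ` with initial data `φ`
      (∀ φ : SobolevH1, IsConcentratedNLSSolution F (S φ) ∧ S φ 0 = φ ∧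
        ∀ ψ : C(ℝ, SobolevH1), IsConcentratedNLSSolution F ψ → ψ 0 = φ → ψ = S φ) ∧
      -- conservation of charge and energy
      (∀ (φ : SobolevH1) (t : ℝ),
        (S φ t).charge = φ.charge ∧ (S φ t).energy U = φ.energy U) ∧
      -- a priori bound
      (∃ Λ : SobolevH1 → ℝ, ∀ φ : SobolevH1, 0 < Λ φ ∧ ∀ t : ℝ, ‖S φ t‖ ≤ Λ φ) ∧
      -- continuity of the solution map from `H¹` to `L^∞([0,T], H¹)`
      (∀ T : ℝ, 0 < T →
        (∀ φ : SobolevH1, MemLp (S φ) ⊤ (volume.restrict (Icc 0 T))) ∧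
        ∀ φ : SobolevH1, Tendsto
          (fun φ' : SobolevH1 =>
            eLpNorm (fun t => S φ' t - S φ t) ⊤ (volume.restrict (Icc 0 T)))
          (𝓝 φ) (𝓝 0)) := by
  have hFd : ContDiff ℝ 1 F := by
    rw [funext hF]
    exact (contDiff_gradient hU).neg
  have hFc := hFd.continuous
  obtain ⟨S, Λ, hS⟩ := fourierModel.global_wellposedness hU hF hu hB.le hAB
  let Ψ : SobolevH1 → C(ℝ, SobolevH1) := fun φ =>
    ⟨fun t => toFourier.symm (S (toFourier φ) t),
      toFourier.symm.continuous.comp (hS (toFourier φ)).2.1⟩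
  have hΨ : ∀ φ t, toFourier (Ψ φ t) = S (toFourier φ) t := fun φ t =>
    toFourier.apply_symm_apply _
  have hΨs : ∀ φ R, fourierModel.Solves F R fun t => toFourier (Ψ φ t) := fun φ R => by
    simp only [hΨ]
    exact (hS (toFourier φ)).2.2.1 R
  have hΨ0 : ∀ φ, Ψ φ 0 = φ := fun φ => toFourier.injective (by rw [hΨ, (hS _).1])
  have hbd : ∀ φ t, ‖Ψ φ t‖ ≤ Λ (toFourier φ) := fun φ t => by
    rw [← toFourier.norm_map, hΨ]
    exact (hS (toFourier φ)).2.2.2.2.2.1 t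
  refine ⟨Ψ, fun φ => ⟨(isConcentratedNLSSolution_iff hFc _).2 (hΨs φ), hΨ0 φ, fun ψ hψ hψ0 => ?_⟩,
    fun φ t => ?_, ⟨fun φ => Λ (toFourier φ), fun φ => ⟨(hS (toFourier φ)).2.2.2.2.1, hbd φ⟩⟩,
    fun T hT => ⟨fun φ => ?_, fun φ => ?_⟩⟩
  · have hψc : Continuous fun t => toFourier (ψ t) := toFourier.continuous.comp ψ.continuous
    have hΨc : Continuous fun t => toFourier (Ψ φ t) := toFourier.continuous.comp (Ψ φ).continuous
    -- Uniqueness needs boundedness only on compact time intervals, which continuity of both curves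
    -- supplies; conservation laws need not be known for the competitor `ψ`.
    have h1 := fourierModel.eq_of_solves hFd ((isConcentratedNLSSolution_iff hFc ψ).1 hψ) (hΨs φ)
      (fourierModel.continuous_tr.comp hψc) (fourierModel.continuous_tr.comp hΨc)
      (fun T => by
        obtain ⟨C, hC⟩ := (isCompact_Icc (a := -T) (b := T)).exists_bound_of_continuousOn
          hψc.continuousOn
        obtain ⟨C', hC'⟩ := (isCompact_Icc (a := -T) (b := T)).exists_bound_of_continuousOn
          hΨc.continuousOn
        exact ⟨max C C', fun t ht => ⟨(hC t (abs_le.1 ht)).trans (le_max_left _ _),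
          (hC' t (abs_le.1 ht)).trans (le_max_right _ _)⟩⟩)
      (by rw [hψ0, hΨ0])
    exact ContinuousMap.ext fun t => toFourier.injective (congrFun h1 t)
  · rw [charge_eq, charge_eq, energy_eq, energy_eq, hΨ]
    obtain ⟨h1, h2⟩ := (hS (toFourier φ)).2.2.2.1 t
    rw [h1, h2]
    exact ⟨rfl, rfl⟩
  · exact memLp_top_of_bound
      ((Ψ φ).continuous.continuousOn.aestronglyMeasurable_of_isCompact isCompact_Icc
        measurableSet_Icc) _ (ae_of_all _ (hbd φ))
  · rw [ENNReal.tendsto_nhds_zero]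
    intro ε hε
    obtain ⟨δ, hδ, hδε⟩ : ∃ δ : ℝ, 0 < δ ∧ ENNReal.ofReal δ ≤ ε := by
      obtain ⟨r, hr0, hr⟩ := ENNReal.lt_iff_exists_nnreal_btwn.1 hε
      exact ⟨r, by exact_mod_cast hr0, by rw [ENNReal.ofReal_coe_nnreal]; exact hr.le⟩
    have h1 := (hS (toFourier φ)).2.2.2.2.2.2 T hT.le
    rw [Metric.tendstoUniformlyOn_iff] at h1
    filter_upwards [(toFourier.continuous.tendsto φ).eventually (h1 δ hδ)] with φ' hφ'
    rw [eLpNorm_exponent_top]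
    refine (eLpNormEssSup_le_of_ae_bound (C := δ) ?_).trans hδε
    refine (ae_restrict_iff' measurableSet_Icc).2 (ae_of_all _ fun t ht => ?_)
    rw [← toFourier.norm_map, map_sub, hΨ, hΨ, ← dist_eq_norm, dist_comm]
    exact (hφ' t ht).le
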